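/- Let $B\subset\mathbb{R}^2$ be the open unit disk centered at the origin, $r=|x|$, and let $\varphi,\psi:[0,1]\to[0,\infty)$ be non-increasing Lipschitz continuous functions with $\varphi(0)=\psi(0)=1$, $\varphi>0$ on $[0,1)$, and $\int_0^1 M(s)\,ds<\infty$, where $M(s)=\max_{0\le r\le s}\psi(r)/\varphi(r)$ for $0\le s<1$. For $\alpha,\lambda>0$ consider the problem $$-\Delta u-\alpha\, r\varphi(r)\,\partial_r u=\lambda\,\psi(r)\,e^{u}\ \text{ in } B,\qquad u>0\ \text{ in } B,\qquad u=0\ \text{ on }\partial B.\tag{P}$$ A classical solution is a function $u\in C^2(B)\cap C(\overline B)$ satisfying (P); a classical solution $u$ is minimal if $u\le v$ on $\overline B$ for every classical solution $v$ of (P) with the same $\alpha,\lambda$. Let $\lambda^*(\alpha)$ be the supremum of those $\lambda>0$ for which (P) has a classical solution. A function $u^*_\alpha$ on $\overline B$ is called the extremal solution if $\lambda^*(\alpha)>0$, a minimal solution $u_{\lambda,\alpha}$ exists for every $0<\lambda<\lambda^*(\alpha)$, and $u^*_\alpha(x)=\lim_{\lambda\uparrow\lambda^*(\alpha)}u_{\lambda,\alpha}(x)$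 for every $x\in\overline B$. Then for all sufficiently large $\alpha$ the extremal solution $u^*_\alpha$ exists and is a classical solution of (P) with $\lambda=\lambda^*(\alpha)$, and, as $\alpha\to\infty$, $$\lambda^*(\alpha)=\frac{2\alpha}{\log\alpha}\left(1+O\!\left(\frac1{\sqrt{\log\alpha}}\right)\right),\qquad u^*_\alpha(0)=O(\log\log\alpha),$$ $$\int_B \big(u^*_\alpha(x)\big)^p\,dx\to 0\quad\text{for every real } 1\le p<\infty,\qquad \int_B\psi(|x|)\,e^{u^*_\alpha(x)}\,dx\to\int_B\psi(|x|)\,dx.$$ The constants in the $O$-terms may depend on $\varphi$ and $\psi$ but not on $\alpha$. -/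

import Mathlib

open Filter Topology MeasureTheory Set

/-- The plane `ℝ²` with its Euclidean norm; `B` is `Metric.ball (0 : Plane) 1`. -/
abbrev Plane : Type := EuclideanSpace ℝ (Fin 2)

/-- `M(s) = max_{0 ≤ r ≤ s} ψ(r)/φ(r)`. -/
noncomputable def profileRatioMax (φ ψ : ℝ → ℝ) (s : ℝ) : ℝ :=
  sSup ((fun r => ψ r / φ r) '' Icc 0 s)

/-- The standing assumptions on the profiles `φ, ψ`, as functions on `[0,1]`. -/
structure AdmissibleProfiles (φ ψ : ℝ → ℝ) : Prop where
  lipschitz_phi : ∃ L, LipschitzOnWith L φ (Icc 0 1)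
  lipschitz_psi : ∃ L, LipschitzOnWith L ψ (Icc 0 1)
  antitone_phi : AntitoneOn φ (Icc 0 1)
  antitone_psi : AntitoneOn ψ (Icc 0 1)
  nonneg_phi : ∀ r ∈ Icc (0 : ℝ) 1, 0 ≤ φ r
  nonneg_psi : ∀ r ∈ Icc (0 : ℝ) 1, 0 ≤ ψ r
  phi_zero : φ 0 = 1
  psi_zero : ψ 0 = 1
  pos_phi : ∀ r ∈ Ico (0 : ℝ) 1, 0 < φ r
  integrable_ratio : IntegrableOn (profileRatioMax φ ψ) (Ioo 0 1)

/-- `u ∈ C²(B) ∩ C(B̄)` is a classical positive solution of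
`-Δu - α r φ(r) ∂u/∂r = lam ψ(r) f(u)` in `B`, `u > 0` in `B`, `u = 0` on `∂B`, with `r = ‖x‖`.
Here `r ∂u/∂r` at `x` is the derivative of `u` at `x` in the direction `x`. -/
structure IsClassicalSolution (φ ψ f : ℝ → ℝ) (α lam : ℝ) (u : Plane → ℝ) : Prop where
  contDiffOn : ContDiffOn ℝ 2 u (Metric.ball 0 1)
  continuousOn : ContinuousOn u (Metric.closedBall 0 1)
  equation : ∀ x ∈ Metric.ball (0 : Plane) 1,
    -(Laplacian.laplacian u x) - α * φ ‖x‖ * fderiv ℝ u x x = lam * ψ ‖x‖ * f (u x)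
  pos : ∀ x ∈ Metric.ball (0 : Plane) 1, 0 < u x
  boundary : ∀ x ∈ Metric.sphere (0 : Plane) 1, u x = 0

/-- The minimal (smallest) classical solution. -/
def IsMinimalSolution (φ ψ f : ℝ → ℝ) (α lam : ℝ) (u : Plane → ℝ) : Prop :=
  IsClassicalSolution φ ψ f α lam u ∧
    ∀ v, IsClassicalSolution φ ψ f α lam v → ∀ x ∈ Metric.closedBall (0 : Plane) 1, u x ≤ v x

/-- The critical value `λ*(α)`: the supremum of the `lam > 0` for which the problem has a
classical solution. -/
noncomputable def criticalValue (φ ψ f : ℝ → ℝ) (α : ℝ) : ℝ :=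
  sSup {lam : ℝ | 0 < lam ∧ ∃ u, IsClassicalSolution φ ψ f α lam u}

/-- `u` is the extremal solution `u*_α`: for every `0 < lam < λ*(α)` there is a minimal solution
`u_{lam,α}`, and `u` is the pointwise limit of the `u_{lam,α}` on `B̄` as `lam` increases
to `λ*(α)`. -/
def IsExtremalSolution (φ ψ f : ℝ → ℝ) (α : ℝ) (u : Plane → ℝ) : Prop :=
  0 < criticalValue φ ψ f α ∧
    ∃ U : ℝ → Plane → ℝ,
      (∀ lam ∈ Ioo 0 (criticalValue φ ψ f α), IsMinimalSolution φ ψ f α lam (U lam)) ∧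
      ∀ x ∈ Metric.closedBall (0 : Plane) 1,
        Tendsto (fun lam => U lam x) (𝓝[<] (criticalValue φ ψ f α)) (𝓝 (u x))

set_option maxSynthPendingDepth 3

/-! In the radial variable the operator is `-(r E u')' / (r E)` with `E = exp(α Φ)`, so the linear
problem has an explicit, order-preserving solution operator, `radialSolve`. A maximum principle that
does not assume radial symmetry (`radialSolve_le_of_supersolution`) keeps the monotone iteration
from zero below every classical solution. Solvability at one parameter therefore gives a minimal
solution, necessarily radial, at every smaller one, and the problem becomes one-dimensional.

Upper bound for the parameter: since `u` and `ψ` decrease and `φ ≤ 1`, a solution satisfies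
`(e^{-u})' ≥ lam s (1 - ℓ s) / (2 + α s²)`. Integrating gives `IsRadialSolution.exp_neg_ge`. At `r =
1` it yields `lam ≤ (2α / log α)(1 + O(1 / log α))`. At `r = (log α)^{-2}`, for `lam` near the
critical value, it forces `e^{-u}` close to `1`, so `u` is small outside a tiny disk.

Lower bound: equality in that inequality suggests `e^{-u} ≈ δ + log(1 + α r²) / log α`. A corrected
version `D` of the right-hand side (`layerDenom`) makes `log (D(1) / D(r)) + (9ℓ / log α) ∫_r^1 M`
dominate the iteration (`gelfandIter_le_layer`) for `lam` up to `(2α / log α)(1 - O(δ))`. The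
differential inequality requires `δ² log α` to exceed a constant, which is the source of the error
`1 / √(log α)`.

Regularity: within distance of order `α^{-1/2}` of the origin the drift is negligible and the
equation is close to Liouville's. A comparison with the explicit Liouville profile gives `u(0) ≤ 3
log (40 α / lam)` for every radial solution (`IsRadialSolution.apply_zero_le`). Near the critical
value this is `O(log log α)`, so the minimal solutions converge to a classical one. On the disk of
radius `(log α)^{-2}`, of area `O((log α)^{-4})`, `e^u` is at most `(40 log α)^3`; together with the
smallness outside, this gives all the integral limits. -/

/-- A continuous non-increasing profile on the whole line with value `1` at the origin and an
explicit linear lower bound. -/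
structure LinearlyBoundedProfile (ℓ : ℝ) (φ : ℝ → ℝ) : Prop where
  one_le : 1 ≤ ℓ
  continuous : Continuous φ
  antitone : Antitone φ
  nonneg : ∀ r, 0 ≤ φ r
  zero : φ 0 = 1
  lower : ∀ r, 0 ≤ r → 1 - ℓ * r ≤ φ r

theorem LinearlyBoundedProfile.le_one {ℓ : ℝ} {φ : ℝ → ℝ} (hφ : LinearlyBoundedProfile ℓ φ)
    {r : ℝ} (hr : 0 ≤ r) : φ r ≤ 1 := by
  rw [← hφ.zero]; exact hφ.antitone hr

/-! ### The radial linear problem and its solution operator. -/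

/-- `Φ(r) = ∫₀ʳ t φ(t) dt`. -/
noncomputable def driftPotential (φ : ℝ → ℝ) (r : ℝ) : ℝ := ∫ t in (0 : ℝ)..r, t * φ t

/-- The integrating factor `exp(α Φ(r))` of the drift. -/
noncomputable def driftWeight (φ : ℝ → ℝ) (α r : ℝ) : ℝ := Real.exp (α * driftPotential φ r)

/-- `-U'(s)/s` for the radial solution `U` of the linear problem with right-hand side `h`. -/
noncomputable def radialSlope (φ : ℝ → ℝ) (α : ℝ) (h : ℝ → ℝ) (s : ℝ) : ℝ :=
  ∫ τ in (0 : ℝ)..1, τ * (driftWeight φ α (s * τ) / driftWeight φ α s) * h (s * τ)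

/-- The radial solution of `-Δu - α r φ ∂ᵣu = h`, `u = 0` on the unit circle. -/
noncomputable def radialSolve (φ : ℝ → ℝ) (α : ℝ) (h : ℝ → ℝ) (r : ℝ) : ℝ :=
  ∫ s in r..1, s * radialSlope φ α h s

theorem hasDerivAt_driftPotential {φ : ℝ → ℝ} (hφ : Continuous φ) (r : ℝ) :
    HasDerivAt (driftPotential φ) (r * φ r) r :=
  ((continuous_id.mul hφ).integral_hasStrictDerivAt 0 r).hasDerivAt

theorem hasDerivAt_driftWeight {φ : ℝ → ℝ} (hφ : Continuous φ) (α r : ℝ) :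
    HasDerivAt (driftWeight φ α) (driftWeight φ α r * (α * (r * φ r))) r :=
  ((hasDerivAt_driftPotential hφ r).const_mul α).exp

theorem continuous_driftWeight {φ : ℝ → ℝ} (hφ : Continuous φ) (α : ℝ) :
    Continuous (driftWeight φ α) :=
  continuous_iff_continuousAt.2 fun r => (hasDerivAt_driftWeight hφ α r).continuousAt

theorem driftWeight_pos (φ : ℝ → ℝ) (α r : ℝ) : 0 < driftWeight φ α r := Real.exp_pos _

theorem driftWeight_zero (φ : ℝ → ℝ) (α : ℝ) : driftWeight φ α 0 = 1 := by
  simp [driftWeight, driftPotential]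

theorem monotoneOn_driftWeight {φ : ℝ → ℝ} (hφ : Continuous φ) (hφ0 : ∀ r, 0 ≤ φ r) {α : ℝ}
    (hα : 0 ≤ α) : MonotoneOn (driftWeight φ α) (Ici 0) := by
  refine monotoneOn_of_deriv_nonneg (convex_Ici 0) (continuous_driftWeight hφ α).continuousOn
    (fun x _ => (hasDerivAt_driftWeight hφ α x).differentiableAt.differentiableWithinAt) ?_
  intro x hx
  rw [interior_Ici] at hx
  rw [(hasDerivAt_driftWeight hφ α x).deriv]
  exact mul_nonneg (driftWeight_pos _ _ _).le (mul_nonneg hα (mul_nonneg hx.le (hφ0 x)))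

theorem driftWeight_ratio_le_one {φ : ℝ → ℝ} (hφ : Continuous φ) (hφ0 : ∀ r, 0 ≤ φ r) {α : ℝ}
    (hα : 0 ≤ α) {s t : ℝ} (ht : 0 ≤ t) (hts : t ≤ s) :
    driftWeight φ α t / driftWeight φ α s ≤ 1 :=
  (div_le_one (driftWeight_pos _ _ _)).2
    (monotoneOn_driftWeight hφ hφ0 hα ht (ht.trans hts) hts)

theorem continuous_radialSlope_integrand {φ h : ℝ → ℝ} (hφ : Continuous φ) (hh : Continuous h)
    (α : ℝ) : Continuous (Function.uncurry fun s τ : ℝ =>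
      τ * (driftWeight φ α (s * τ) / driftWeight φ α s) * h (s * τ)) := by
  have hE := continuous_driftWeight hφ α
  have h1 : Continuous fun p : ℝ × ℝ => driftWeight φ α (p.1 * p.2) :=
    hE.comp (continuous_fst.mul continuous_snd)
  have h2 : Continuous fun p : ℝ × ℝ => driftWeight φ α p.1 := hE.comp continuous_fst
  have h3 : Continuous fun p : ℝ × ℝ => h (p.1 * p.2) :=
    hh.comp (continuous_fst.mul continuous_snd)
  exact (continuous_snd.mul (h1.div h2 fun p => (driftWeight_pos _ _ _).ne')).mul h3

theorem continuous_radialSlope_slice {φ h : ℝ → ℝ} (hφ : Continuous φ) (hh : Continuous h)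
    (α s : ℝ) : Continuous fun τ : ℝ =>
      τ * (driftWeight φ α (s * τ) / driftWeight φ α s) * h (s * τ) :=
  (continuous_radialSlope_integrand hφ hh α).comp (continuous_const.prodMk continuous_id)

theorem continuous_radialSlope {φ h : ℝ → ℝ} (hφ : Continuous φ) (hh : Continuous h) (α : ℝ) :
    Continuous (radialSlope φ α h) :=
  intervalIntegral.continuous_parametric_intervalIntegral_of_continuous'
    (continuous_radialSlope_integrand hφ hh α) 0 1

/-- The substitution `t = s τ` recovers the formula obtained by integrating `-(t E u')' = t E h`.
The scaled integral over `[0,1]` is preferred as the definition because it stays continuous at `s =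
0`. -/
theorem sq_mul_radialSlope (φ h : ℝ → ℝ) (α s : ℝ) :
    s ^ 2 * radialSlope φ α h s =
      (∫ t in (0 : ℝ)..s, t * driftWeight φ α t * h t) / driftWeight φ α s := by
  have h1 := intervalIntegral.smul_integral_comp_mul_left (a := 0) (b := 1)
    (fun t => t * driftWeight φ α t * h t) s
  simp only [mul_zero, mul_one, smul_eq_mul] at h1
  rw [← h1, radialSlope, ← intervalIntegral.integral_const_mul,
    ← intervalIntegral.integral_const_mul, ← intervalIntegral.integral_div]
  congr 1; ext τ; ring

theorem hasDerivAt_weightedIntegral {φ h : ℝ → ℝ} (hφ : Continuous φ) (hh : Continuous h)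
    (α s : ℝ) : HasDerivAt (fun s => ∫ t in (0 : ℝ)..s, t * driftWeight φ α t * h t)
      (s * driftWeight φ α s * h s) s :=
  (((continuous_id.mul (continuous_driftWeight hφ α)).mul
    hh).integral_hasStrictDerivAt 0 s).hasDerivAt

theorem hasDerivAt_radialSlope {φ h : ℝ → ℝ} (hφ : Continuous φ) (hh : Continuous h)
    (α : ℝ) {s : ℝ} (hs : 0 < s) :
    HasDerivAt (radialSlope φ α h)
      ((h s - 2 * radialSlope φ α h s - α * s ^ 2 * φ s * radialSlope φ α h s) / s) s := by
  have hE := driftWeight_pos φ α s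
  have h1 : HasDerivAt (fun s => (∫ t in (0 : ℝ)..s, t * driftWeight φ α t * h t) /
      driftWeight φ α s / s ^ 2) _ s :=
    ((hasDerivAt_weightedIntegral hφ hh α s).div (hasDerivAt_driftWeight hφ α s) hE.ne').div
      (hasDerivAt_pow 2 s) (by positivity)
  have h2 : radialSlope φ α h =ᶠ[𝓝 s] fun s =>
      (∫ t in (0 : ℝ)..s, t * driftWeight φ α t * h t) / driftWeight φ α s / s ^ 2 := by
    filter_upwards [lt_mem_nhds hs] with t ht
    rw [← sq_mul_radialSlope, mul_div_cancel_left₀]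
    positivity
  refine (h1.congr_of_eventuallyEq h2).congr_deriv ?_
  have h3 : (∫ t in (0 : ℝ)..s, t * driftWeight φ α t * h t) =
      s ^ 2 * radialSlope φ α h s * driftWeight φ α s := by
    rw [sq_mul_radialSlope, div_mul_cancel₀ _ hE.ne']
  simp only [Pi.div_apply]
  rw [h3]
  field_simp
  ring

theorem hasDerivAt_radialSolve {φ h : ℝ → ℝ} (hφ : Continuous φ) (hh : Continuous h)
    (α r : ℝ) : HasDerivAt (radialSolve φ α h) (-(r * radialSlope φ α h r)) r := by
  have hc := continuous_id.mul (continuous_radialSlope hφ hh α)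
  have h1 := (hc.integral_hasStrictDerivAt 1 r).hasDerivAt.neg
  refine h1.congr_of_eventuallyEq (Eventually.of_forall fun x => ?_)
  simp only [radialSolve, Pi.neg_apply]
  rw [intervalIntegral.integral_symm]
  rfl

theorem continuous_radialSolve {φ h : ℝ → ℝ} (hφ : Continuous φ) (hh : Continuous h) (α : ℝ) :
    Continuous (radialSolve φ α h) :=
  continuous_iff_continuousAt.2 fun r => (hasDerivAt_radialSolve hφ hh α r).continuousAt

theorem radialSolve_one (φ h : ℝ → ℝ) (α : ℝ) : radialSolve φ α h 1 = 0 := by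
  simp [radialSolve]

theorem radialSlope_mono {φ h g : ℝ → ℝ} (hφ : Continuous φ) (hh : Continuous h)
    (hg : Continuous g) (α : ℝ) {s : ℝ} (hs : 0 ≤ s) (hle : ∀ t ∈ Icc 0 s, h t ≤ g t) :
    radialSlope φ α h s ≤ radialSlope φ α g s := by
  refine intervalIntegral.integral_mono_on zero_le_one
    ((continuous_radialSlope_slice hφ hh α s).intervalIntegrable _ _)
    ((continuous_radialSlope_slice hφ hg α s).intervalIntegrable _ _) fun τ hτ => ?_
  refine mul_le_mul_of_nonneg_left
    (hle _ ⟨mul_nonneg hs hτ.1, mul_le_of_le_one_right hs hτ.2⟩) ?_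
  exact mul_nonneg hτ.1 (div_nonneg (driftWeight_pos _ _ _).le (driftWeight_pos _ _ _).le)

theorem radialSlope_const_mul (φ h : ℝ → ℝ) (α c s : ℝ) :
    radialSlope φ α (fun t => c * h t) s = c * radialSlope φ α h s := by
  rw [radialSlope, radialSlope, ← intervalIntegral.integral_const_mul]
  congr 1; ext τ; ring

theorem radialSlope_sub {φ h g : ℝ → ℝ} (hφ : Continuous φ) (hh : Continuous h)
    (hg : Continuous g) (α s : ℝ) :
    radialSlope φ α (fun t => h t - g t) s = radialSlope φ α h s - radialSlope φ α g s := by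
  rw [radialSlope, radialSlope, radialSlope, ← intervalIntegral.integral_sub
    ((continuous_radialSlope_slice hφ hh α s).intervalIntegrable _ _)
    ((continuous_radialSlope_slice hφ hg α s).intervalIntegrable _ _)]
  congr 1; ext τ; ring

theorem radialSlope_nonneg {φ h : ℝ → ℝ} (α : ℝ) {s : ℝ} (hs : 0 ≤ s)
    (hh0 : ∀ t ∈ Icc 0 s, 0 ≤ h t) : 0 ≤ radialSlope φ α h s := by
  refine intervalIntegral.integral_nonneg zero_le_one fun τ hτ => ?_
  exact mul_nonneg (mul_nonneg hτ.1
    (div_nonneg (driftWeight_pos _ _ _).le (driftWeight_pos _ _ _).le))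
    (hh0 _ ⟨mul_nonneg hs hτ.1, mul_le_of_le_one_right hs hτ.2⟩)

theorem radialSolve_mono {φ h g : ℝ → ℝ} (hφ : Continuous φ) (hh : Continuous h)
    (hg : Continuous g) (α : ℝ) (hle : ∀ t ∈ Icc (0 : ℝ) 1, h t ≤ g t) {r : ℝ}
    (hr : r ∈ Icc (0 : ℝ) 1) : radialSolve φ α h r ≤ radialSolve φ α g r := by
  refine intervalIntegral.integral_mono_on hr.2
    ((continuous_id.mul (continuous_radialSlope hφ hh α)).intervalIntegrable _ _)
    ((continuous_id.mul (continuous_radialSlope hφ hg α)).intervalIntegrable _ _) fun s hs => ?_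
  have hs0 : 0 ≤ s := hr.1.trans hs.1
  exact mul_le_mul_of_nonneg_left
    (radialSlope_mono hφ hh hg α hs0 fun t ht => hle t ⟨ht.1, ht.2.trans hs.2⟩) hs0

theorem radialSolve_congr {φ h g : ℝ → ℝ} (hφ : Continuous φ) (hh : Continuous h)
    (hg : Continuous g) (α : ℝ) (heq : ∀ t ∈ Icc (0 : ℝ) 1, h t = g t) {r : ℝ}
    (hr : r ∈ Icc (0 : ℝ) 1) : radialSolve φ α h r = radialSolve φ α g r :=
  le_antisymm (radialSolve_mono hφ hh hg α (fun t ht => (heq t ht).le) hr)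
    (radialSolve_mono hφ hg hh α (fun t ht => (heq t ht).ge) hr)

theorem radialSolve_sub {φ h g : ℝ → ℝ} (hφ : Continuous φ) (hh : Continuous h)
    (hg : Continuous g) (α r : ℝ) :
    radialSolve φ α (fun t => h t - g t) r = radialSolve φ α h r - radialSolve φ α g r := by
  have h1 : Continuous fun s => s * radialSlope φ α h s :=
    continuous_id.mul (continuous_radialSlope hφ hh α)
  have h2 : Continuous fun s => s * radialSlope φ α g s :=
    continuous_id.mul (continuous_radialSlope hφ hg α)
  rw [radialSolve, radialSolve, radialSolve, ← intervalIntegral.integral_sub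
    (h1.intervalIntegrable _ _) (h2.intervalIntegrable _ _)]
  congr 1; ext s
  rw [radialSlope_sub hφ hh hg]; ring

theorem radialSolve_const_mul (φ h : ℝ → ℝ) (α c r : ℝ) :
    radialSolve φ α (fun t => c * h t) r = c * radialSolve φ α h r := by
  rw [radialSolve, radialSolve, ← intervalIntegral.integral_const_mul]
  congr 1; ext s
  rw [radialSlope_const_mul]; ring

theorem radialSolve_nonneg {φ h : ℝ → ℝ} (α : ℝ) (hh0 : ∀ t ∈ Icc (0 : ℝ) 1, 0 ≤ h t) {r : ℝ}
    (hr : r ∈ Icc (0 : ℝ) 1) : 0 ≤ radialSolve φ α h r := by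
  refine intervalIntegral.integral_nonneg hr.2 fun s hs => ?_
  have hs0 : 0 ≤ s := hr.1.trans hs.1
  exact mul_nonneg hs0
    (radialSlope_nonneg α hs0 fun t ht => hh0 t ⟨ht.1, ht.2.trans hs.2⟩)

theorem radialSolve_antitoneOn {φ h : ℝ → ℝ} (hφ : Continuous φ) (hh : Continuous h)
    (α : ℝ) (hh0 : ∀ t ∈ Icc (0 : ℝ) 1, 0 ≤ h t) :
    AntitoneOn (radialSolve φ α h) (Icc 0 1) := by
  refine antitoneOn_of_deriv_nonpos (convex_Icc 0 1) (continuous_radialSolve hφ hh α).continuousOn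
    (fun x _ => (hasDerivAt_radialSolve hφ hh α x).differentiableAt.differentiableWithinAt) ?_
  intro x hx
  rw [interior_Icc] at hx
  rw [(hasDerivAt_radialSolve hφ hh α x).deriv]
  exact neg_nonpos.2 (mul_nonneg hx.1.le
    (radialSlope_nonneg α hx.1.le fun t ht => hh0 t ⟨ht.1, ht.2.trans hx.2.le⟩))

/-! ### Radial functions on the plane: regularity and the equation. -/

/-- The inner product as a continuous bilinear map. -/
noncomputable def realInnerCLM (E : Type*) [NormedAddCommGroup E] [InnerProductSpace ℝ E] :
    E →L[ℝ] E →L[ℝ] ℝ := innerSL ℝ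

theorem realInnerCLM_apply {E : Type*} [NormedAddCommGroup E] [InnerProductSpace ℝ E] (x : E) :
    realInnerCLM E x = innerSL ℝ x := rfl

/-- Writing the radial derivative as `‖x‖ * c` makes the gradient `c x`, a form that also covers the
origin. Away from it, `f ∘ √` is composed with the smooth squared norm. -/
theorem hasFDerivAt_comp_norm {E : Type*} [NormedAddCommGroup E] [InnerProductSpace ℝ E]
    {f : ℝ → ℝ} {c : ℝ} {x : E} (hf : HasDerivAt f (‖x‖ * c) ‖x‖) :
    HasFDerivAt (fun y : E => f ‖y‖) (c • realInnerCLM E x) x := by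
  rcases eq_or_ne x 0 with rfl | hx
  · simp only [norm_zero, zero_mul] at hf
    rw [map_zero, smul_zero]
    rw [hasFDerivAt_iff_isLittleO_nhds_zero]
    have h1 := (hasDerivAt_iff_isLittleO_nhds_zero.1 hf).comp_tendsto
      (tendsto_norm_zero (E := E))
    simpa [Function.comp_def] using h1.of_norm_right
  · have hx' : (0 : ℝ) < ‖x‖ := norm_pos_iff.2 hx
    have h1 : HasFDerivAt (fun y : E => ‖y‖ ^ 2) (2 • realInnerCLM E x) x :=
      (hasStrictFDerivAt_norm_sq x).hasFDerivAt
    have h2 : HasDerivAt f (‖x‖ * c) (√(‖x‖ ^ 2)) := by rwa [Real.sqrt_sq hx'.le]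
    have h3 : HasDerivAt (fun t => f √t) (‖x‖ * c * (1 / (2 * √(‖x‖ ^ 2)))) (‖x‖ ^ 2) :=
      h2.comp _ (Real.hasDerivAt_sqrt (by positivity))
    have h4 := h3.comp_hasFDerivAt x h1
    rw [Real.sqrt_sq hx'.le] at h4
    have h5 : (fun y : E => f ‖y‖) = (fun t => f √t) ∘ fun y : E => ‖y‖ ^ 2 := by
      ext y; simp [Real.sqrt_sq (norm_nonneg y)]
    rw [h5]
    refine h4.congr_fderiv ?_
    ext v
    simp [realInnerCLM_apply]
    field_simp

/-- `s k'(s)` for `k = radialSlope φ α h`. -/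
noncomputable def radialSlopeEuler (φ : ℝ → ℝ) (α : ℝ) (h : ℝ → ℝ) (s : ℝ) : ℝ :=
  h s - 2 * radialSlope φ α h s - α * s ^ 2 * φ s * radialSlope φ α h s

theorem radialSlope_zero (φ h : ℝ → ℝ) (α : ℝ) : radialSlope φ α h 0 = h 0 / 2 := by
  simp only [radialSlope, zero_mul, div_self (driftWeight_pos φ α 0).ne', mul_one]
  rw [intervalIntegral.integral_mul_const]
  simp
  ring

theorem radialSlopeEuler_zero (φ h : ℝ → ℝ) (α : ℝ) : radialSlopeEuler φ α h 0 = 0 := by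
  simp [radialSlopeEuler, radialSlope_zero]; ring

theorem continuous_radialSlopeEuler {φ h : ℝ → ℝ} (hφ : Continuous φ) (hh : Continuous h)
    (α : ℝ) : Continuous (radialSlopeEuler φ α h) := by
  have := continuous_radialSlope hφ hh α
  unfold radialSlopeEuler
  fun_prop

/-- The second derivative of `x ↦ radialSolve φ α h ‖x‖`. -/
noncomputable def radialHessian {E : Type*} [NormedAddCommGroup E] [InnerProductSpace ℝ E]
    (φ : ℝ → ℝ) (α : ℝ) (h : ℝ → ℝ) (x : E) :
    E →L[ℝ] E →L[ℝ] ℝ :=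
  -(radialSlope φ α h ‖x‖ • realInnerCLM E +
    (radialSlopeEuler φ α h ‖x‖ / ‖x‖ ^ 2) • (realInnerCLM E x).smulRight (realInnerCLM E x))

/-- Only the origin is delicate. There the rank-one term has norm `|s k'(s)|`, which tends to `0`
because the Euler expression is continuous and vanishes at `0`. -/
theorem continuous_radialHessian {E : Type*} [NormedAddCommGroup E] [InnerProductSpace ℝ E]
    {φ h : ℝ → ℝ} (hφ : Continuous φ) (hh : Continuous h)
    (α : ℝ) : Continuous (radialHessian (E := E) φ α h) := by
  have hk := continuous_radialSlope hφ hh α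
  have hq := continuous_radialSlopeEuler hφ hh α
  have hc : Continuous fun x : E => radialSlope φ α h ‖x‖ • realInnerCLM E :=
    (hk.comp continuous_norm).smul continuous_const
  have hB : Continuous fun x : E => (realInnerCLM E x).smulRight (realInnerCLM E x) := by
    have h1 : Continuous fun x : E => realInnerCLM E x := (realInnerCLM E).continuous
    exact ((ContinuousLinearMap.smulRightL ℝ E (E →L[ℝ] ℝ)).continuous.comp h1).clm_apply
      h1
  refine (hc.add (continuous_iff_continuousAt.2 fun x => ?_)).neg
  rcases eq_or_ne x 0 with rfl | hx
  · have h0 : Tendsto (fun x : E => |radialSlopeEuler φ α h ‖x‖|) (𝓝 0) (𝓝 0) := by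
      have := ((hq.comp continuous_norm).abs.tendsto (0 : E))
      simpa [radialSlopeEuler_zero] using this
    rw [ContinuousAt]
    simp only [norm_zero, map_zero]
    have hz : (radialSlopeEuler φ α h 0 / 0 ^ 2) •
        (0 : E →L[ℝ] ℝ).smulRight (0 : E →L[ℝ] ℝ) = 0 := by
      simp [radialSlopeEuler_zero]
    rw [hz]
    refine squeeze_zero_norm (fun y => ?_) h0
    rw [norm_smul, ContinuousLinearMap.norm_smulRight_apply, realInnerCLM_apply, innerSL_apply_norm, norm_div,
      Real.norm_eq_abs, norm_pow, norm_norm]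
    rcases eq_or_ne y 0 with rfl | hy
    · simp
    · have : (0 : ℝ) < ‖y‖ := norm_pos_iff.2 hy
      apply le_of_eq
      field_simp
  · exact (((hq.comp continuous_norm).continuousAt).div
      ((continuous_norm.pow 2).continuousAt) (by simpa using hx)).smul hB.continuousAt

theorem hasFDerivAt_radialSolve_norm {E : Type*} [NormedAddCommGroup E] [InnerProductSpace ℝ E]
    {φ h : ℝ → ℝ} (hφ : Continuous φ) (hh : Continuous h)
    (α : ℝ) (x : E) : HasFDerivAt (fun y : E => radialSolve φ α h ‖y‖)
      (-(radialSlope φ α h ‖x‖ • realInnerCLM E x)) x := by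
  rw [← neg_smul]
  exact hasFDerivAt_comp_norm (by simpa using hasDerivAt_radialSolve hφ hh α ‖x‖)

theorem hasFDerivAt_radialGradient {E : Type*} [NormedAddCommGroup E] [InnerProductSpace ℝ E]
    {φ h : ℝ → ℝ} (hφ : Continuous φ) (hh : Continuous h)
    (α : ℝ) (x : E) :
    HasFDerivAt (fun y : E => -(radialSlope φ α h ‖y‖ • realInnerCLM E y))
      (radialHessian φ α h x) x := by
  refine HasFDerivAt.neg ?_
  rcases eq_or_ne x 0 with rfl | hx
  · simp only [norm_zero, radialSlopeEuler_zero, zero_div, zero_smul, add_zero]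
    rw [hasFDerivAt_iff_isLittleO_nhds_zero]
    have h0 : Tendsto (fun x : E => radialSlope φ α h ‖x‖ - radialSlope φ α h 0)
        (𝓝 0) (𝓝 0) := by
      have := (((continuous_radialSlope hφ hh α).comp continuous_norm).tendsto (0 : E)).sub_const
        (radialSlope φ α h 0)
      simpa using this
    have h1 : (fun x : E => (radialSlope φ α h ‖x‖ - radialSlope φ α h 0) • realInnerCLM E x)
        =o[𝓝 0] fun x : E => (1 : ℝ) • x :=
      ((Asymptotics.isLittleO_one_iff ℝ).2 h0).smul_isBigO
        ((realInnerCLM E).isBigO_id _)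
    simp only [one_smul] at h1
    refine h1.congr_left fun y => ?_
    simp [sub_smul]
  · have hx' : (0 : ℝ) < ‖x‖ := norm_pos_iff.2 hx
    have h1 : HasFDerivAt (fun y : E => radialSlope φ α h ‖y‖)
        ((radialSlopeEuler φ α h ‖x‖ / ‖x‖ ^ 2) • realInnerCLM E x) x := by
      refine hasFDerivAt_comp_norm ((hasDerivAt_radialSlope hφ hh α hx').congr_deriv ?_)
      rw [radialSlopeEuler]
      field_simp
    refine (h1.smul (realInnerCLM E).hasFDerivAt).congr_fderiv ?_
    ext v w
    simp
    ring

theorem contDiff_radialSolve_norm {E : Type*} [NormedAddCommGroup E] [InnerProductSpace ℝ E]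
    {φ h : ℝ → ℝ} (hφ : Continuous φ) (hh : Continuous h)
    (α : ℝ) : ContDiff ℝ 2 fun y : E => radialSolve φ α h ‖y‖ := by
  have hd : fderiv ℝ (fun y : E => radialSolve φ α h ‖y‖) =
      fun y => -(radialSlope φ α h ‖y‖ • realInnerCLM E y) :=
    funext fun x => (hasFDerivAt_radialSolve_norm hφ hh α x).fderiv
  have hd2 : fderiv ℝ (fun y : E => -(radialSlope φ α h ‖y‖ • realInnerCLM E y)) =
      radialHessian φ α h := funext fun x => (hasFDerivAt_radialGradient hφ hh α x).fderiv
  have : (2 : WithTop ℕ∞) = 1 + 1 := by norm_num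
  rw [this, contDiff_succ_iff_fderiv]
  refine ⟨fun x => (hasFDerivAt_radialSolve_norm hφ hh α x).differentiableAt, by simp, ?_⟩
  rw [hd, contDiff_one_iff_fderiv]
  refine ⟨fun x => (hasFDerivAt_radialGradient hφ hh α x).differentiableAt, ?_⟩
  rw [hd2]
  exact continuous_radialHessian hφ hh α

/-- In dimension two the trace of the Hessian is `-(2k + s k')` and the derivative along `x` is `-k
‖x‖²`; the first-order equation for the slope `k` turns the combination into `h`. -/
theorem radialSolve_equation {φ h : ℝ → ℝ} (hφ : Continuous φ) (hh : Continuous h)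
    (α : ℝ) (x : Plane) :
    -(Laplacian.laplacian (fun y : Plane => radialSolve φ α h ‖y‖) x) -
      α * φ ‖x‖ * fderiv ℝ (fun y : Plane => radialSolve φ α h ‖y‖) x x = h ‖x‖ := by
  have hd : fderiv ℝ (fun y : Plane => radialSolve φ α h ‖y‖) =
      fun y => -(radialSlope φ α h ‖y‖ • realInnerCLM Plane y) :=
    funext fun x => (hasFDerivAt_radialSolve_norm hφ hh α x).fderiv
  have hd2 := (hasFDerivAt_radialGradient hφ hh α x).fderiv
  have hsum := (EuclideanSpace.basisFun (Fin 2) ℝ).sum_sq_inner_right x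
  have hsymm := fun i : Fin 2 => real_inner_comm x (EuclideanSpace.single i (1 : ℝ))
  rw [InnerProductSpace.laplacian_eq_iteratedFDeriv_orthonormalBasis _
    (EuclideanSpace.basisFun (Fin 2) ℝ)]
  simp only [iteratedFDeriv_two_apply, hd, hd2, radialHessian]
  have hxx : radialSlopeEuler φ α h ‖x‖ / ‖x‖ ^ 2 * ‖x‖ ^ 2 = radialSlopeEuler φ α h ‖x‖ := by
    rcases eq_or_ne x 0 with rfl | hx
    · simp [radialSlopeEuler_zero]
    · exact div_mul_cancel₀ _ (by simpa using hx)
  have hq : radialSlopeEuler φ α h ‖x‖ = h ‖x‖ - 2 * radialSlope φ α h ‖x‖ -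
    α * ‖x‖ ^ 2 * φ ‖x‖ * radialSlope φ α h ‖x‖ := rfl
  simp only [Fin.sum_univ_two] at hsum ⊢
  simp [realInnerCLM_apply, innerSL_apply_apply] at hsum ⊢
  rw [EuclideanSpace.real_norm_sq_eq] at *
  simp only [Fin.sum_univ_two] at *
  rw [hsymm, hsymm] at hsum
  linear_combination radialSlopeEuler φ α h ‖x‖ / (x.ofLp 0 ^ 2 + x.ofLp 1 ^ 2) * hsum + hxx + hq

/-! ### Maximum principle. -/

theorem second_deriv_nonneg_of_isLocalMin {g g' : ℝ → ℝ} {c : ℝ} (hmin : IsLocalMin g 0)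
    (hg : ∀ᶠ t in 𝓝 0, HasDerivAt g (g' t) t) (hg' : HasDerivAt g' c 0) : 0 ≤ c := by
  by_contra! hc
  have h0 : g' 0 = 0 := hmin.hasDerivAt_eq_zero hg.self_of_nhds
  have h1 : ∀ᶠ t in 𝓝[>] (0 : ℝ), g' t < 0 := by
    have h2 := hg'.tendsto_slope_zero_right.eventually (gt_mem_nhds hc)
    filter_upwards [h2, self_mem_nhdsWithin] with t ht ht0
    simp only [zero_add, h0, sub_zero, smul_eq_mul] at ht
    have := mul_neg_of_pos_of_neg (show (0 : ℝ) < t from ht0) ht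
    rwa [mul_inv_cancel_left₀ (ne_of_gt ht0)] at this
  obtain ⟨ε, hε, hP⟩ := Metric.eventually_nhds_iff.1 (hg.and hmin)
  obtain ⟨δ, hδ, hQ⟩ := mem_nhdsGT_iff_exists_Ioo_subset.1 h1
  have hδ' : (0 : ℝ) < δ := hδ
  set t := min ε δ / 2
  have hm : 0 < min ε δ := lt_min hε hδ'
  have ht : 0 < t := by positivity
  have htε : t < ε := (half_lt_self hm).trans_le (min_le_left _ _)
  have htδ : t < δ := (half_lt_self hm).trans_le (min_le_right _ _)
  have hmem : ∀ s ∈ Icc 0 t, dist s 0 < ε := fun s hs => by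
    rw [Real.dist_eq, sub_zero, abs_of_nonneg hs.1]; exact hs.2.trans_lt htε
  obtain ⟨ξ, hξ, hξ'⟩ := exists_hasDerivAt_eq_slope g g' ht
    (fun s hs => (hP (hmem s hs)).1.continuousAt.continuousWithinAt)
    (fun s hs => (hP (hmem s (Ioo_subset_Icc_self hs))).1)
  have h3 : g' ξ < 0 := hQ ⟨hξ.1, hξ.2.trans htδ⟩
  have h4 : g 0 ≤ g t := (hP (hmem t ⟨ht.le, le_rfl⟩)).2
  rw [hξ', sub_zero] at h3
  exact absurd h3 (not_lt.2 (div_nonneg (sub_nonneg.2 h4) ht.le))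

theorem fderiv_fderiv_nonneg_of_isLocalMin {E : Type*} [NormedAddCommGroup E] [NormedSpace ℝ E]
    {f : E → ℝ} {x : E} (hf : ContDiffAt ℝ 2 f x) (hmin : IsLocalMin f x) (v : E) :
    0 ≤ fderiv ℝ (fderiv ℝ f) x v v := by
  have hline : ∀ t : ℝ, HasDerivAt (fun t : ℝ => x + t • v) v t := fun t => by
    simpa using ((hasDerivAt_id t).smul_const v).const_add x
  have htend : Tendsto (fun t : ℝ => x + t • v) (𝓝 0) (𝓝 x) := by
    have := (hline 0).continuousAt.tendsto
    simpa using this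
  have hd : ∀ᶠ y in 𝓝 x, DifferentiableAt ℝ f y :=
    (hf.eventually (by simp)).mono fun y hy => hy.differentiableAt (by norm_num)
  have hd2 : DifferentiableAt ℝ (fderiv ℝ f) x :=
    (hf.fderiv_right (m := 1) (by norm_num)).differentiableAt (by norm_num)
  refine second_deriv_nonneg_of_isLocalMin (g := fun t : ℝ => f (x + t • v))
    (g' := fun t => fderiv ℝ f (x + t • v) v) ?_ ?_ ?_
  · have := htend.eventually hmin
    filter_upwards [this] with t ht
    simpa using ht
  · filter_upwards [htend.eventually hd] with t ht
    exact ht.hasFDerivAt.comp_hasDerivAt t (hline t)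
  · have h1 : HasFDerivAt (fderiv ℝ f) (fderiv ℝ (fderiv ℝ f) x) (x + (0 : ℝ) • v) := by
      simpa using hd2.hasFDerivAt
    have h2 := h1.comp_hasDerivAt (0 : ℝ) (hline 0)
    simpa using h2.clm_apply (hasDerivAt_const (0 : ℝ) v)

theorem laplacian_nonneg_of_isLocalMin {f : Plane → ℝ} {x : Plane} (hf : ContDiffAt ℝ 2 f x)
    (hmin : IsLocalMin f x) : 0 ≤ Laplacian.laplacian f x := by
  rw [InnerProductSpace.laplacian_eq_iteratedFDeriv_orthonormalBasis _
    (EuclideanSpace.basisFun (Fin 2) ℝ)]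
  refine Finset.sum_nonneg fun i _ => ?_
  rw [iteratedFDeriv_two_apply]
  exact fderiv_fderiv_nonneg_of_isLocalMin hf hmin _

/-- At an interior minimum of `v - u` the gradients agree, so the drift terms cancel whatever their
sign, while the Laplacian of the difference is nonnegative; this contradicts strictness. -/
theorem radialSolve_le_of_strict_supersolution {φ h : ℝ → ℝ} (hφ : Continuous φ)
    (hh : Continuous h) {α : ℝ} {v : Plane → ℝ} (hv2 : ContDiffOn ℝ 2 v (Metric.ball 0 1))
    (hvc : ContinuousOn v (Metric.closedBall 0 1))
    (hv : ∀ x ∈ Metric.ball (0 : Plane) 1,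
      h ‖x‖ < -(Laplacian.laplacian v x) - α * φ ‖x‖ * fderiv ℝ v x x)
    (hb : ∀ x ∈ Metric.sphere (0 : Plane) 1, 0 ≤ v x) :
    ∀ x ∈ Metric.closedBall (0 : Plane) 1, radialSolve φ α h ‖x‖ ≤ v x := by
  set u : Plane → ℝ := fun y => radialSolve φ α h ‖y‖ with hu
  have hu2 : ContDiff ℝ 2 u := contDiff_radialSolve_norm hφ hh α
  obtain ⟨x₀, hx₀, hmin⟩ := (isCompact_closedBall (0 : Plane) 1).exists_isMinOn
    ⟨0, Metric.mem_closedBall_self zero_le_one⟩ (hvc.sub hu2.continuous.continuousOn)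
  suffices h0 : 0 ≤ v x₀ - u x₀ from fun x hx => sub_nonneg.1 (h0.trans (hmin hx))
  rcases eq_or_lt_of_le (mem_closedBall_zero_iff.1 hx₀) with h1 | h1
  · have h2 : u x₀ = 0 := by simp [hu, h1, radialSolve_one]
    rw [h2, sub_zero]
    exact hb x₀ (mem_sphere_zero_iff_norm.2 h1)
  · exfalso
    have hball : x₀ ∈ Metric.ball (0 : Plane) 1 := mem_ball_zero_iff.2 h1
    have hnhds : Metric.ball (0 : Plane) 1 ∈ 𝓝 x₀ := Metric.isOpen_ball.mem_nhds hball
    have hva : ContDiffAt ℝ 2 v x₀ := hv2.contDiffAt hnhds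
    have hua : ContDiffAt ℝ 2 u x₀ := hu2.contDiffAt
    have hloc : IsLocalMin (v - u) x₀ :=
      (hmin.on_subset Metric.ball_subset_closedBall).isLocalMin hnhds
    have hlap : 0 ≤ Laplacian.laplacian (v - u) x₀ :=
      laplacian_nonneg_of_isLocalMin (hva.sub hua) hloc
    rw [hva.laplacian_sub hua] at hlap
    have hgrad := hloc.fderiv_eq_zero
    rw [fderiv_sub (hva.differentiableAt (by norm_num)) (hua.differentiableAt (by norm_num)),
      sub_eq_zero] at hgrad
    have heq := radialSolve_equation hφ hh α x₀
    have := hv x₀ hball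
    rw [hgrad] at this
    linarith

/-- Strictness is restored by lowering the source by a constant `ε`, which by linearity costs `ε`
times the solution with source `1`; then `ε` is sent to zero. -/
theorem radialSolve_le_of_supersolution {φ h : ℝ → ℝ} (hφ : Continuous φ)
    (hh : Continuous h) {α : ℝ} {v : Plane → ℝ} (hv2 : ContDiffOn ℝ 2 v (Metric.ball 0 1))
    (hvc : ContinuousOn v (Metric.closedBall 0 1))
    (hv : ∀ x ∈ Metric.ball (0 : Plane) 1,
      h ‖x‖ ≤ -(Laplacian.laplacian v x) - α * φ ‖x‖ * fderiv ℝ v x x)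
    (hb : ∀ x ∈ Metric.sphere (0 : Plane) 1, 0 ≤ v x) :
    ∀ x ∈ Metric.closedBall (0 : Plane) 1, radialSolve φ α h ‖x‖ ≤ v x := by
  intro x hx
  have hS : 0 ≤ radialSolve φ α (fun _ => 1) ‖x‖ :=
    radialSolve_nonneg α (fun _ _ => zero_le_one) ⟨norm_nonneg x, mem_closedBall_zero_iff.1 hx⟩
  refine le_of_forall_pos_le_add fun η hη => ?_
  set ε := η / (radialSolve φ α (fun _ => 1) ‖x‖ + 1) with hε
  have hε0 : 0 < ε := by positivity
  have h1 := radialSolve_le_of_strict_supersolution (h := fun t => h t - ε * 1) hφ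
    (hh.sub (continuous_const (y := ε * 1))) hv2 hvc
    (fun y hy => (by simpa using hε0 : h ‖y‖ - ε * 1 < h ‖y‖).trans_le (hv y hy)) hb x hx
  rw [radialSolve_sub hφ hh continuous_const, radialSolve_const_mul] at h1
  have h2 : ε * radialSolve φ α (fun _ => 1) ‖x‖ ≤ η := by
    rw [hε, div_mul_eq_mul_div, div_le_iff₀ (by positivity)]
    nlinarith
  linarith

/-! ### Monotone iteration and passage to the limit. -/

/-- The source term `lam ψ(r) e^{u(r)}` of a radial function. -/
noncomputable def gelfandSource (ψ : ℝ → ℝ) (lam : ℝ) (u : ℝ → ℝ) (r : ℝ) : ℝ :=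
  lam * ψ r * Real.exp (u r)

/-- The monotone iteration started at zero. -/
noncomputable def gelfandIter (φ ψ : ℝ → ℝ) (α lam : ℝ) : ℕ → ℝ → ℝ
  | 0 => 0
  | n + 1 => radialSolve φ α (gelfandSource ψ lam (gelfandIter φ ψ α lam n))

/-- `u` solves the radial integral equation on `[0,1]`. -/
def IsRadialSolution (φ ψ : ℝ → ℝ) (α lam : ℝ) (u : ℝ → ℝ) : Prop :=
  ∃ h : ℝ → ℝ, Continuous h ∧ u = radialSolve φ α h ∧
    ∀ r ∈ Icc (0 : ℝ) 1, h r = gelfandSource ψ lam u r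

theorem continuous_gelfandSource {ψ u : ℝ → ℝ} (hψ : Continuous ψ) (hu : Continuous u)
    (lam : ℝ) : Continuous (gelfandSource ψ lam u) :=
  (continuous_const.mul hψ).mul (Real.continuous_exp.comp hu)

theorem gelfandSource_nonneg {ψ : ℝ → ℝ} (hψ0 : ∀ r, 0 ≤ ψ r) {lam : ℝ} (hlam : 0 ≤ lam)
    (u : ℝ → ℝ) (r : ℝ) : 0 ≤ gelfandSource ψ lam u r :=
  mul_nonneg (mul_nonneg hlam (hψ0 r)) (Real.exp_pos _).le

theorem gelfandSource_mono {ψ u v : ℝ → ℝ} (hψ0 : ∀ r, 0 ≤ ψ r) {lam lam' r : ℝ}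
    (hlam : 0 ≤ lam) (hle : lam ≤ lam') (huv : u r ≤ v r) :
    gelfandSource ψ lam u r ≤ gelfandSource ψ lam' v r :=
  mul_le_mul (mul_le_mul_of_nonneg_right hle (hψ0 r)) (Real.exp_le_exp.2 huv)
    (Real.exp_pos _).le (mul_nonneg (hlam.trans hle) (hψ0 r))

section Iteration

variable {φ ψ : ℝ → ℝ}

theorem continuous_gelfandIter (hφ : Continuous φ) (hψ : Continuous ψ) (α lam : ℝ) (n : ℕ) :
    Continuous (gelfandIter φ ψ α lam n) := by
  induction n with
  | zero => exact continuous_const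
  | succ n ih => exact continuous_radialSolve hφ (continuous_gelfandSource hψ ih lam) α

theorem gelfandIter_nonneg (hψ0 : ∀ r, 0 ≤ ψ r) (α : ℝ)
    {lam : ℝ} (hlam : 0 ≤ lam) (n : ℕ) {r : ℝ} (hr : r ∈ Icc (0 : ℝ) 1) :
    0 ≤ gelfandIter φ ψ α lam n r := by
  cases n with
  | zero => exact le_rfl
  | succ n => exact radialSolve_nonneg α (fun t _ => gelfandSource_nonneg hψ0 hlam _ t) hr

theorem gelfandIter_le_succ (hφ : Continuous φ) (hψ : Continuous ψ) (hψ0 : ∀ r, 0 ≤ ψ r) (α : ℝ)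
    {lam : ℝ} (hlam : 0 ≤ lam) (n : ℕ) : ∀ r ∈ Icc (0 : ℝ) 1,
    gelfandIter φ ψ α lam n r ≤ gelfandIter φ ψ α lam (n + 1) r := by
  induction n with
  | zero => exact fun r hr => gelfandIter_nonneg hψ0 α hlam 1 hr
  | succ n ih =>
    intro r hr
    exact radialSolve_mono hφ
      (continuous_gelfandSource hψ (continuous_gelfandIter hφ hψ α lam n) lam)
      (continuous_gelfandSource hψ (continuous_gelfandIter hφ hψ α lam (n + 1)) lam) α
      (fun t ht => gelfandSource_mono hψ0 hlam le_rfl (ih t ht)) hr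

theorem gelfandIter_mono_param (hφ : Continuous φ) (hψ : Continuous ψ) (hψ0 : ∀ r, 0 ≤ ψ r)
    (α : ℝ) {lam lam' : ℝ} (hlam : 0 ≤ lam) (hle : lam ≤ lam') (n : ℕ) : ∀ r ∈ Icc (0 : ℝ) 1,
    gelfandIter φ ψ α lam n r ≤ gelfandIter φ ψ α lam' n r := by
  induction n with
  | zero => exact fun r _ => le_rfl
  | succ n ih =>
    intro r hr
    exact radialSolve_mono hφ
      (continuous_gelfandSource hψ (continuous_gelfandIter hφ hψ α lam n) lam)
      (continuous_gelfandSource hψ (continuous_gelfandIter hφ hψ α lam' n) lam') α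
      (fun t ht => gelfandSource_mono hψ0 hlam hle (ih t ht)) hr

/-- The comparison function need not be radial. This is what makes the limit of the iteration
minimal among all classical solutions. -/
theorem gelfandIter_le_classical (hφ : Continuous φ) (hψ : Continuous ψ) (hψ0 : ∀ r, 0 ≤ ψ r)
    {α lam : ℝ} (hlam : 0 ≤ lam) {v : Plane → ℝ}
    (hv : IsClassicalSolution φ ψ Real.exp α lam v) (n : ℕ) :
    ∀ x ∈ Metric.closedBall (0 : Plane) 1, gelfandIter φ ψ α lam n ‖x‖ ≤ v x := by
  induction n with
  | zero =>
    intro x hx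
    rcases eq_or_lt_of_le (mem_closedBall_zero_iff.1 hx) with h | h
    · exact (hv.boundary x (mem_sphere_zero_iff_norm.2 h)).ge
    · exact (hv.pos x (mem_ball_zero_iff.2 h)).le
  | succ n ih =>
    refine radialSolve_le_of_supersolution hφ
      (continuous_gelfandSource hψ (continuous_gelfandIter hφ hψ α lam n) lam)
      hv.contDiffOn hv.continuousOn (fun x hx => ?_) (fun x hx => (hv.boundary x hx).ge)
    rw [hv.equation x hx]
    exact mul_le_mul_of_nonneg_left
      (Real.exp_le_exp.2 (ih x (Metric.ball_subset_closedBall hx)))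
      (mul_nonneg hlam (hψ0 _))

theorem abs_radialSlope_le (hφ : Continuous φ) (hφ0 : ∀ r, 0 ≤ φ r) {α : ℝ} (hα : 0 ≤ α)
    {h : ℝ → ℝ} {C : ℝ} (hC : ∀ t ∈ Icc (0 : ℝ) 1, |h t| ≤ C) {s : ℝ}
    (hs : s ∈ Icc (0 : ℝ) 1) : |radialSlope φ α h s| ≤ C := by
  have hC0 : 0 ≤ C := (abs_nonneg _).trans (hC s hs)
  have := intervalIntegral.norm_integral_le_of_norm_le_const (a := 0) (b := 1) (C := C)
    (f := fun τ => τ * (driftWeight φ α (s * τ) / driftWeight φ α s) * h (s * τ)) ?_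
  · simpa [radialSlope] using this
  · intro τ hτ
    rw [uIoc_of_le zero_le_one] at hτ
    have hm : s * τ ∈ Icc (0 : ℝ) 1 :=
      ⟨mul_nonneg hs.1 hτ.1.le, mul_le_one₀ hs.2 hτ.1.le hτ.2⟩
    have h1 := driftWeight_ratio_le_one hφ hφ0 hα hm.1 (mul_le_of_le_one_right hs.1 hτ.2)
    have h0 : 0 ≤ driftWeight φ α (s * τ) / driftWeight φ α s :=
      div_nonneg (driftWeight_pos _ _ _).le (driftWeight_pos _ _ _).le
    rw [Real.norm_eq_abs, abs_mul, abs_mul, abs_of_pos hτ.1, abs_of_nonneg h0]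
    calc τ * (driftWeight φ α (s * τ) / driftWeight φ α s) * |h (s * τ)|
        ≤ 1 * 1 * C := mul_le_mul (mul_le_mul hτ.2 h1 h0 zero_le_one) (hC _ hm)
          (abs_nonneg _) (by norm_num)
      _ = C := by ring

theorem abs_radialSolve_sub_le (hφ : Continuous φ) (hφ0 : ∀ r, 0 ≤ φ r) {α : ℝ} (hα : 0 ≤ α)
    {h : ℝ → ℝ} (hh : Continuous h) {C : ℝ} (hC : ∀ t ∈ Icc (0 : ℝ) 1, |h t| ≤ C) {r s : ℝ}
    (hr : r ∈ Icc (0 : ℝ) 1) (hs : s ∈ Icc (0 : ℝ) 1) :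
    |radialSolve φ α h s - radialSolve φ α h r| ≤ C * |s - r| := by
  refine (convex_Icc (0 : ℝ) 1).norm_image_sub_le_of_norm_hasDerivWithin_le
    (fun x _ => (hasDerivAt_radialSolve hφ hh α x).hasDerivWithinAt) (fun x hx => ?_) hr hs
  rw [norm_neg, Real.norm_eq_abs, abs_mul, abs_of_nonneg hx.1]
  exact (mul_le_of_le_one_left (abs_nonneg _) hx.2).trans (abs_radialSlope_le hφ hφ0 hα hC hx)

theorem tendsto_radialSlope (hφ : Continuous φ) (hφ0 : ∀ r, 0 ≤ φ r) {α : ℝ} (hα : 0 ≤ α)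
    {ι : Type*} {l : Filter ι} [l.IsCountablyGenerated] {H : ι → ℝ → ℝ} {h : ℝ → ℝ}
    (hH : ∀ i, Continuous (H i)) {C : ℝ}
    (hC : ∀ᶠ i in l, ∀ t ∈ Icc (0 : ℝ) 1, |H i t| ≤ C)
    (hlim : ∀ t ∈ Icc (0 : ℝ) 1, Tendsto (fun i => H i t) l (𝓝 (h t))) {s : ℝ}
    (hs : s ∈ Icc (0 : ℝ) 1) :
    Tendsto (fun i => radialSlope φ α (H i) s) l (𝓝 (radialSlope φ α h s)) := by
  refine intervalIntegral.tendsto_integral_filter_of_dominated_convergence (fun _ => C)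
    (Eventually.of_forall fun i =>
      (continuous_radialSlope_slice hφ (hH i) α s).aestronglyMeasurable) ?_
    intervalIntegrable_const ?_
  · filter_upwards [hC] with i hi
    refine Eventually.of_forall fun τ hτ => ?_
    rw [uIoc_of_le zero_le_one] at hτ
    have hm : s * τ ∈ Icc (0 : ℝ) 1 :=
      ⟨mul_nonneg hs.1 hτ.1.le, mul_le_one₀ hs.2 hτ.1.le hτ.2⟩
    have h1 := driftWeight_ratio_le_one hφ hφ0 hα hm.1 (mul_le_of_le_one_right hs.1 hτ.2)
    have h0 : 0 ≤ driftWeight φ α (s * τ) / driftWeight φ α s :=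
      div_nonneg (driftWeight_pos _ _ _).le (driftWeight_pos _ _ _).le
    rw [Real.norm_eq_abs, abs_mul, abs_mul, abs_of_pos hτ.1, abs_of_nonneg h0]
    calc τ * (driftWeight φ α (s * τ) / driftWeight φ α s) * |H i (s * τ)|
        ≤ 1 * 1 * C := mul_le_mul (mul_le_mul hτ.2 h1 h0 zero_le_one) (hi _ hm)
          (abs_nonneg _) (by norm_num)
      _ = C := by ring
  · refine Eventually.of_forall fun τ hτ => ?_
    rw [uIoc_of_le zero_le_one] at hτ
    exact (hlim _ ⟨mul_nonneg hs.1 hτ.1.le, mul_le_one₀ hs.2 hτ.1.le hτ.2⟩).const_mul _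

theorem tendsto_radialSolve (hφ : Continuous φ) (hφ0 : ∀ r, 0 ≤ φ r) {α : ℝ} (hα : 0 ≤ α)
    {ι : Type*} {l : Filter ι} [l.IsCountablyGenerated] {H : ι → ℝ → ℝ} {h : ℝ → ℝ}
    (hH : ∀ i, Continuous (H i)) {C : ℝ}
    (hC : ∀ᶠ i in l, ∀ t ∈ Icc (0 : ℝ) 1, |H i t| ≤ C)
    (hlim : ∀ t ∈ Icc (0 : ℝ) 1, Tendsto (fun i => H i t) l (𝓝 (h t))) {r : ℝ}
    (hr : r ∈ Icc (0 : ℝ) 1) :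
    Tendsto (fun i => radialSolve φ α (H i) r) l (𝓝 (radialSolve φ α h r)) := by
  refine intervalIntegral.tendsto_integral_filter_of_dominated_convergence (fun _ => C)
    (Eventually.of_forall fun i =>
      (continuous_id.mul (continuous_radialSlope hφ (hH i) α)).aestronglyMeasurable) ?_
    intervalIntegrable_const ?_
  · filter_upwards [hC] with i hi
    refine Eventually.of_forall fun s hs => ?_
    rw [uIoc_of_le hr.2] at hs
    have hs' : s ∈ Icc (0 : ℝ) 1 := ⟨hr.1.trans hs.1.le, hs.2⟩
    rw [Real.norm_eq_abs, abs_mul, abs_of_nonneg hs'.1]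
    exact (mul_le_of_le_one_left (abs_nonneg _) hs'.2).trans
      (abs_radialSlope_le hφ hφ0 hα hi hs')
  · refine Eventually.of_forall fun s hs => ?_
    rw [uIoc_of_le hr.2] at hs
    exact (tendsto_radialSlope hφ hφ0 hα hH hC hlim ⟨hr.1.trans hs.1.le, hs.2⟩).const_mul _

/-- A pointwise limit of uniformly bounded approximate solutions is a radial solution. -/
theorem exists_isRadialSolution_of_tendsto (hφ : Continuous φ) (hφ0 : ∀ r, 0 ≤ φ r)
    (hψ : Continuous ψ) (hψ0 : ∀ r, 0 ≤ ψ r) (hψ1 : ∀ r, 0 ≤ r → ψ r ≤ 1) {α : ℝ} (hα : 0 ≤ α)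
    {ι : Type*} {l : Filter ι} [l.NeBot] [l.IsCountablyGenerated] {lams : ι → ℝ} {lam B : ℝ}
    {f : ι → ℝ → ℝ} {u : ℝ → ℝ} (hf : ∀ i, Continuous (f i))
    (hlams : Tendsto lams l (𝓝 lam)) (hlams0 : ∀ᶠ i in l, 0 ≤ lams i)
    (hB : ∀ᶠ i in l, ∀ r ∈ Icc (0 : ℝ) 1, f i r ≤ B)
    (hfu : ∀ r ∈ Icc (0 : ℝ) 1, Tendsto (fun i => f i r) l (𝓝 (u r)))
    (hgu : ∀ r ∈ Icc (0 : ℝ) 1,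
      Tendsto (fun i => radialSolve φ α (gelfandSource ψ (lams i) (f i)) r) l (𝓝 (u r))) :
    ∃ w, IsRadialSolution φ ψ α lam w ∧ ∀ r ∈ Icc (0 : ℝ) 1, w r = u r := by
  set C := (lam + 1) * 1 * Real.exp B with hCdef
  have hlam1 : ∀ᶠ i in l, lams i ≤ lam + 1 :=
    (hlams.eventually (gt_mem_nhds (lt_add_one lam))).mono fun i hi => hi.le
  have hC : ∀ᶠ i in l, ∀ t ∈ Icc (0 : ℝ) 1, |gelfandSource ψ (lams i) (f i) t| ≤ C := by
    filter_upwards [hlam1, hlams0, hB] with i h1 h0 hBi t ht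
    rw [abs_of_nonneg (gelfandSource_nonneg hψ0 h0 _ _)]
    exact mul_le_mul (mul_le_mul h1 (hψ1 t ht.1) (hψ0 t) (h0.trans h1))
      (Real.exp_le_exp.2 (hBi t ht)) (Real.exp_pos _).le
      (mul_nonneg (h0.trans h1) zero_le_one)
  have hcont : ∀ i, Continuous (gelfandSource ψ (lams i) (f i)) := fun i =>
    continuous_gelfandSource hψ (hf i) _
  -- The approximations share a Lipschitz constant, so their pointwise limit is continuous and can
  -- be put back into the source.
  have hlip : ∀ r ∈ Icc (0 : ℝ) 1, ∀ s ∈ Icc (0 : ℝ) 1, |u s - u r| ≤ C * |s - r| := by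
    intro r hr s hs
    refine le_of_tendsto ((hgu s hs).sub (hgu r hr)).abs ?_
    filter_upwards [hC] with i hi
    exact abs_radialSolve_sub_le hφ hφ0 hα (hcont i) hi hr hs
  have hC0 : 0 ≤ C := by
    obtain ⟨i, hi⟩ := hC.exists
    exact (abs_nonneg _).trans (hi 0 ⟨le_rfl, zero_le_one⟩)
  have huc : ContinuousOn u (Icc 0 1) := by
    refine (LipschitzOnWith.of_dist_le_mul (K := ⟨C, hC0⟩) fun s hs r hr => ?_).continuousOn
    exact hlip r hr s hs
  -- The solution operator takes sources continuous on the whole line, whereas `u` is controlled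
  -- only on `[0,1]`.
  set v : ℝ → ℝ := IccExtend zero_le_one ((Icc (0 : ℝ) 1).domRestrict u) with hv
  have hvc : Continuous v := (continuousOn_iff_continuous_domRestrict.1 huc).Icc_extend'
  have hvu : ∀ r ∈ Icc (0 : ℝ) 1, v r = u r := fun r hr => by
    rw [hv, IccExtend_of_mem _ _ hr]; rfl
  set h := gelfandSource ψ lam v with hh
  have hlim : ∀ t ∈ Icc (0 : ℝ) 1,
      Tendsto (fun i => gelfandSource ψ (lams i) (f i) t) l (𝓝 (h t)) := by
    intro t ht
    rw [hh, gelfandSource, hvu t ht]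
    exact (hlams.mul_const _).mul ((Real.continuous_exp.tendsto _).comp (hfu t ht))
  have hw : ∀ r ∈ Icc (0 : ℝ) 1, radialSolve φ α h r = u r := fun r hr =>
    tendsto_nhds_unique (tendsto_radialSolve hφ hφ0 hα hcont hC hlim hr) (hgu r hr)
  refine ⟨radialSolve φ α h, ⟨h, continuous_gelfandSource hψ hvc lam, rfl, fun r hr => ?_⟩, hw⟩
  rw [hh, gelfandSource, gelfandSource, hvu r hr, ← hw r hr]

end Iteration

/-! ### Radial solutions, minimal solutions and the extremal solution. -/

section Radial

variable {φ ψ : ℝ → ℝ} {ℓ α lam : ℝ} {u : ℝ → ℝ}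

theorem IsRadialSolution.continuous (hφ : Continuous φ) (hu : IsRadialSolution φ ψ α lam u) :
    Continuous u := by
  obtain ⟨h, hh, rfl, -⟩ := hu
  exact continuous_radialSolve hφ hh α

theorem IsRadialSolution.antitoneOn (hφ : Continuous φ) (hψ0 : ∀ r, 0 ≤ ψ r) (hlam : 0 ≤ lam)
    (hu : IsRadialSolution φ ψ α lam u) : AntitoneOn u (Icc 0 1) := by
  obtain ⟨h, hh, rfl, heq⟩ := hu
  exact radialSolve_antitoneOn hφ hh α fun t ht => by
    rw [heq t ht]; exact gelfandSource_nonneg hψ0 hlam _ t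

theorem IsRadialSolution.apply_one (hu : IsRadialSolution φ ψ α lam u) : u 1 = 0 := by
  obtain ⟨h, hh, rfl, -⟩ := hu
  exact radialSolve_one φ h α

theorem IsRadialSolution.nonneg (hφ : Continuous φ) (hψ0 : ∀ r, 0 ≤ ψ r) (hlam : 0 ≤ lam)
    (hu : IsRadialSolution φ ψ α lam u) {r : ℝ} (hr : r ∈ Icc (0 : ℝ) 1) : 0 ≤ u r := by
  rw [← hu.apply_one]
  exact hu.antitoneOn hφ hψ0 hlam hr ⟨zero_le_one, le_rfl⟩ hr.2

theorem IsRadialSolution.le_apply_zero (hφ : Continuous φ) (hψ0 : ∀ r, 0 ≤ ψ r) (hlam : 0 ≤ lam)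
    (hu : IsRadialSolution φ ψ α lam u) {r : ℝ} (hr : r ∈ Icc (0 : ℝ) 1) : u r ≤ u 0 :=
  hu.antitoneOn hφ hψ0 hlam ⟨le_rfl, zero_le_one⟩ hr hr.1

theorem radialSlope_pos {h : ℝ → ℝ} (hφ : Continuous φ) (hh : Continuous h) (α : ℝ) {s c : ℝ}
    (hs : s ∈ Icc (0 : ℝ) 1) (hc : c ∈ Ioc (0 : ℝ) 1) (hh0 : ∀ t ∈ Icc (0 : ℝ) 1, 0 ≤ h t)
    (hpos : ∀ t ∈ Icc 0 c, 0 < h t) : 0 < radialSlope φ α h s := by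
  refine intervalIntegral.integral_pos zero_lt_one
    (continuous_radialSlope_slice hφ hh α s).continuousOn (fun τ hτ => ?_) ⟨c, ⟨hc.1.le, hc.2⟩, ?_⟩
  · exact mul_nonneg (mul_nonneg hτ.1.le
      (div_nonneg (driftWeight_pos _ _ _).le (driftWeight_pos _ _ _).le))
      (hh0 _ ⟨mul_nonneg hs.1 hτ.1.le, mul_le_one₀ hs.2 hτ.1.le hτ.2⟩)
  · exact mul_pos (mul_pos hc.1 (div_pos (driftWeight_pos _ _ _) (driftWeight_pos _ _ _)))
      (hpos _ ⟨mul_nonneg hs.1 hc.1.le, mul_le_of_le_one_left hc.1.le hs.2⟩)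

theorem IsRadialSolution.pos (hφ : Continuous φ) (hψ : LinearlyBoundedProfile ℓ ψ)
    (hlam : 0 < lam) (hu : IsRadialSolution φ ψ α lam u) {r : ℝ} (hr : r ∈ Ico (0 : ℝ) 1) :
    0 < u r := by
  obtain ⟨h, hh, rfl, heq⟩ := hu
  have hℓ := hψ.one_le
  have hh0 : ∀ t ∈ Icc (0 : ℝ) 1, 0 ≤ h t := fun t ht => by
    rw [heq t ht]; exact gelfandSource_nonneg hψ.nonneg hlam.le _ t
  -- On `[0, 1/(2ℓ)]` the linear lower bound gives `ψ ≥ 1/2`. Farther out `ψ` may vanish, but the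
  -- slope at `s` integrates the source from the origin and so stays positive.
  have hc : 1 / (2 * ℓ) ∈ Ioc (0 : ℝ) 1 :=
    ⟨by positivity, by rw [div_le_one (by positivity)]; linarith⟩
  have hpos : ∀ t ∈ Icc 0 (1 / (2 * ℓ)), 0 < h t := by
    intro t ht
    rw [heq t ⟨ht.1, ht.2.trans hc.2⟩]
    have h1 := hψ.lower t ht.1
    have h2 : ℓ * t ≤ 1 / 2 := by
      have := mul_le_mul_of_nonneg_left ht.2 (by linarith : 0 ≤ ℓ)
      rwa [show ℓ * (1 / (2 * ℓ)) = 1 / 2 by field_simp] at this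
    exact mul_pos (mul_pos hlam (by linarith)) (Real.exp_pos _)
  have hk := fun s hs => radialSlope_pos hφ hh α (s := s) hs hc hh0 hpos
  refine intervalIntegral.integral_pos hr.2
    (continuous_id.mul (continuous_radialSlope hφ hh α)).continuousOn (fun s hs => ?_)
    ⟨1, ⟨hr.2.le, le_rfl⟩, ?_⟩
  · exact mul_nonneg (hr.1.trans hs.1.le) (hk s ⟨hr.1.trans hs.1.le, hs.2⟩).le
  · exact mul_pos one_pos (hk 1 ⟨zero_le_one, le_rfl⟩)

theorem IsRadialSolution.isClassicalSolution (hφ : Continuous φ)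
    (hψ : LinearlyBoundedProfile ℓ ψ) (hlam : 0 < lam) (hu : IsRadialSolution φ ψ α lam u) :
    IsClassicalSolution φ ψ Real.exp α lam fun x => u ‖x‖ := by
  have hpos := fun r => hu.pos hφ hψ hlam (r := r)
  have hone := hu.apply_one
  obtain ⟨h, hh, rfl, heq⟩ := hu
  refine ⟨(contDiff_radialSolve_norm hφ hh α).contDiffOn,
    ((continuous_radialSolve hφ hh α).comp continuous_norm).continuousOn, fun x hx => ?_,
    fun x hx => hpos _ ⟨norm_nonneg x, mem_ball_zero_iff.1 hx⟩, fun x hx => ?_⟩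
  · rw [radialSolve_equation hφ hh α x]
    exact heq _ ⟨norm_nonneg x, (mem_ball_zero_iff.1 hx).le⟩
  · rw [mem_sphere_zero_iff_norm.1 hx, hone]

theorem gelfandIter_le_of_isRadialSolution (hφ : Continuous φ) (hψ : Continuous ψ)
    (hψ0 : ∀ r, 0 ≤ ψ r) (hlam : 0 ≤ lam) (hu : IsRadialSolution φ ψ α lam u) (n : ℕ) :
    ∀ r ∈ Icc (0 : ℝ) 1, gelfandIter φ ψ α lam n r ≤ u r := by
  induction n with
  | zero => exact fun r hr => hu.nonneg hφ hψ0 hlam hr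
  | succ n ih =>
    intro r hr
    obtain ⟨h, hh, rfl, heq⟩ := hu
    refine radialSolve_mono hφ
      (continuous_gelfandSource hψ (continuous_gelfandIter hφ hψ α lam n) lam) hh α
      (fun t ht => ?_) hr
    rw [heq t ht]
    exact gelfandSource_mono hψ0 hlam le_rfl (ih t ht)

/-- If the iteration from zero stays bounded, it converges to a radial solution. -/
theorem exists_isRadialSolution_of_bounded (hφ : LinearlyBoundedProfile ℓ φ)
    (hψ : LinearlyBoundedProfile ℓ ψ) (hα : 0 ≤ α) (hlam : 0 ≤ lam) {B : ℝ}
    (hB : ∀ n, ∀ r ∈ Icc (0 : ℝ) 1, gelfandIter φ ψ α lam n r ≤ B) :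
    ∃ u, IsRadialSolution φ ψ α lam u ∧
      ∀ r ∈ Icc (0 : ℝ) 1, Tendsto (fun n => gelfandIter φ ψ α lam n r) atTop (𝓝 (u r)) := by
  have hlim : ∀ r ∈ Icc (0 : ℝ) 1, Tendsto (fun n => gelfandIter φ ψ α lam n r) atTop
      (𝓝 (⨆ n, gelfandIter φ ψ α lam n r)) := fun r hr =>
    tendsto_atTop_ciSup (monotone_nat_of_le_succ fun n =>
      gelfandIter_le_succ hφ.continuous hψ.continuous hψ.nonneg α hlam n r hr)
      ⟨B, forall_mem_range.2 fun n => hB n r hr⟩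
  obtain ⟨w, hw, hwu⟩ := exists_isRadialSolution_of_tendsto hφ.continuous hφ.nonneg hψ.continuous
    hψ.nonneg (fun r hr => hψ.le_one hr) hα (l := atTop) (lams := fun _ : ℕ => lam)
    (continuous_gelfandIter hφ.continuous hψ.continuous α lam) tendsto_const_nhds
    (Eventually.of_forall fun _ => hlam) (Eventually.of_forall hB) hlim
    (fun r hr => (hlim r hr).comp (tendsto_add_atTop_nat 1))
  exact ⟨w, hw, fun r hr => by rw [hwu r hr]; exact hlim r hr⟩

theorem isMinimalSolution_of_tendsto (hφ : Continuous φ) (hψ : LinearlyBoundedProfile ℓ ψ)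
    (hlam : 0 < lam) (hu : IsRadialSolution φ ψ α lam u)
    (hlim : ∀ r ∈ Icc (0 : ℝ) 1,
      Tendsto (fun n => gelfandIter φ ψ α lam n r) atTop (𝓝 (u r))) :
    IsMinimalSolution φ ψ Real.exp α lam fun x => u ‖x‖ :=
  ⟨hu.isClassicalSolution hφ hψ hlam, fun _ hv x hx =>
    le_of_tendsto' (hlim _ ⟨norm_nonneg x, mem_closedBall_zero_iff.1 hx⟩) fun n =>
      gelfandIter_le_classical hφ hψ.continuous hψ.nonneg hlam.le hv n x hx⟩

theorem gelfandIter_bounded_of_classical (hφ : Continuous φ) (hψ : Continuous ψ)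
    (hψ0 : ∀ r, 0 ≤ ψ r) (hlam : 0 ≤ lam) {v : Plane → ℝ}
    (hv : IsClassicalSolution φ ψ Real.exp α lam v) :
    ∃ B, ∀ n, ∀ r ∈ Icc (0 : ℝ) 1, gelfandIter φ ψ α lam n r ≤ B := by
  obtain ⟨B, hB⟩ := (isCompact_closedBall (0 : Plane) 1).bddAbove_image hv.continuousOn
  refine ⟨B, fun n r hr => ?_⟩
  have hn : ‖EuclideanSpace.single (0 : Fin 2) r‖ = r := by
    simp [abs_of_nonneg hr.1]
  have hmem : EuclideanSpace.single (0 : Fin 2) r ∈ Metric.closedBall (0 : Plane) 1 := by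
    rw [mem_closedBall_zero_iff, hn]; exact hr.2
  have := gelfandIter_le_classical hφ hψ hψ0 hlam hv n _ hmem
  rw [hn] at this
  exact this.trans (hB (mem_image_of_mem v hmem))

/-- Existence of a classical solution at `lam'` gives a minimal radial one for every smaller
positive parameter. -/
theorem exists_minimal_of_classical (hφ : LinearlyBoundedProfile ℓ φ)
    (hψ : LinearlyBoundedProfile ℓ ψ) (hα : 0 ≤ α) (hlam : 0 < lam) {lam' : ℝ}
    (hle : lam ≤ lam') {v : Plane → ℝ} (hv : IsClassicalSolution φ ψ Real.exp α lam' v) :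
    ∃ u, IsRadialSolution φ ψ α lam u ∧
      IsMinimalSolution φ ψ Real.exp α lam (fun x => u ‖x‖) ∧
      ∀ r ∈ Icc (0 : ℝ) 1, Tendsto (fun n => gelfandIter φ ψ α lam n r) atTop (𝓝 (u r)) := by
  obtain ⟨B, hB⟩ := gelfandIter_bounded_of_classical hφ.continuous hψ.continuous hψ.nonneg
    (hlam.le.trans hle) hv
  obtain ⟨u, hu, hlim⟩ := exists_isRadialSolution_of_bounded hφ hψ hα hlam.le (B := B)
    fun n r hr => (gelfandIter_mono_param hφ.continuous hψ.continuous hψ.nonneg α hlam.le hle n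
      r hr).trans (hB n r hr)
  exact ⟨u, hu, isMinimalSolution_of_tendsto hφ.continuous hψ hlam hu hlim, hlim⟩

/-- Radial solutions bounded near the critical value converge to a classical extremal
solution. -/
theorem exists_extremal_of_bound (hφ : LinearlyBoundedProfile ℓ φ)
    (hψ : LinearlyBoundedProfile ℓ ψ) (hα : 0 ≤ α)
    (hbdd : BddAbove {lam : ℝ | 0 < lam ∧ ∃ u, IsClassicalSolution φ ψ Real.exp α lam u})
    {lam₀ A : ℝ} (hlam₀ : 0 < lam₀) (hsol : ∃ u, IsClassicalSolution φ ψ Real.exp α lam₀ u)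
    (hA : ∀ lam u, lam₀ ≤ lam → IsRadialSolution φ ψ α lam u → u 0 ≤ A) :
    ∃ u, IsRadialSolution φ ψ α (criticalValue φ ψ Real.exp α) u ∧
      IsExtremalSolution φ ψ Real.exp α fun x => u ‖x‖ := by
  set lamS := criticalValue φ ψ Real.exp α with hS
  have hmem₀ : lam₀ ∈ {lam : ℝ | 0 < lam ∧ ∃ u, IsClassicalSolution φ ψ Real.exp α lam u} :=
    ⟨hlam₀, hsol⟩
  have hSpos : 0 < lamS := hlam₀.trans_le (le_csSup hbdd hmem₀)
  have hkey : ∀ lam, ∃ u : ℝ → ℝ, Continuous u ∧ (lam ∈ Ioo 0 lamS →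
      IsRadialSolution φ ψ α lam u ∧ IsMinimalSolution φ ψ Real.exp α lam (fun x => u ‖x‖) ∧
      (∀ r ∈ Icc (0 : ℝ) 1, Tendsto (fun n => gelfandIter φ ψ α lam n r) atTop (𝓝 (u r))) ∧
      ∀ r ∈ Icc (0 : ℝ) 1, u r ≤ A) := by
    intro lam
    by_cases hlam : lam ∉ Ioo 0 lamS
    -- A dummy value outside the parameter interval, so that a family continuous for every parameter
    -- can be chosen.
    · exact ⟨0, continuous_const, fun h => absurd h hlam⟩
    rw [not_not] at hlam
    -- The bound `A` is available only from `lam₀` on. Smaller parameters inherit it, by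
    -- monotonicity of the iterates, from a solvable parameter above both `lam` and `lam₀`.
    obtain ⟨lam₁, h₁, hlt⟩ := exists_lt_of_lt_csSup ⟨lam₀, hmem₀⟩ hlam.2
    obtain ⟨lam₂, h₂, hle, hle₀⟩ : ∃ lam₂ ∈ {lam : ℝ | 0 < lam ∧
        ∃ u, IsClassicalSolution φ ψ Real.exp α lam u}, lam ≤ lam₂ ∧ lam₀ ≤ lam₂ := by
      rcases le_total lam₁ lam₀ with h | h
      · exact ⟨lam₀, hmem₀, hlt.le.trans h, le_rfl⟩
      · exact ⟨lam₁, h₁, hlt.le, h⟩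
    obtain ⟨v, hv⟩ := h₂.2
    obtain ⟨u, hu, hmin, hlim⟩ := exists_minimal_of_classical hφ hψ hα hlam.1 hle hv
    obtain ⟨w, hw, -, -⟩ := exists_minimal_of_classical hφ hψ hα h₂.1 le_rfl hv
    refine ⟨u, hu.continuous hφ.continuous, fun _ => ⟨hu, hmin, hlim, fun r hr =>
      le_of_tendsto' (hlim r hr) fun n => ?_⟩⟩
    calc gelfandIter φ ψ α lam n r ≤ gelfandIter φ ψ α lam₂ n r :=
          gelfandIter_mono_param hφ.continuous hψ.continuous hψ.nonneg α hlam.1.le hle n r hr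
      _ ≤ w r := gelfandIter_le_of_isRadialSolution hφ.continuous hψ.continuous hψ.nonneg
          h₂.1.le hw n r hr
      _ ≤ w 0 := hw.le_apply_zero hφ.continuous hψ.nonneg h₂.1.le hr
      _ ≤ A := hA lam₂ w hle₀ hw
  choose U hUc hUprop using hkey
  have hU := fun lam h => (hUprop lam h).1
  have hUmin := fun lam h => (hUprop lam h).2.1
  have hUlim := fun lam h => (hUprop lam h).2.2.1
  have hUA := fun lam h => (hUprop lam h).2.2.2
  have hUmono : ∀ r ∈ Icc (0 : ℝ) 1, MonotoneOn (fun lam => U lam r) (Ioo 0 lamS) := by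
    intro r hr lam hlam lam' hlam' hle
    exact le_of_tendsto_of_tendsto' (hUlim lam hlam r hr) (hUlim lam' hlam' r hr) fun n =>
      gelfandIter_mono_param hφ.continuous hψ.continuous hψ.nonneg α hlam.1.le hle n r hr
  have hlim : ∀ r ∈ Icc (0 : ℝ) 1, Tendsto (fun lam => U lam r) (𝓝[<] lamS)
      (𝓝 (sSup ((fun lam => U lam r) '' Ioo 0 lamS))) := fun r hr =>
    (hUmono r hr).tendsto_nhdsWithin_Ioo_left ⟨lamS / 2, half_pos hSpos, half_lt_self hSpos⟩
      ⟨A, forall_mem_image.2 fun lam hlam => hUA lam hlam r hr⟩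
  have hev : ∀ᶠ lam in 𝓝[<] lamS, lam ∈ Ioo 0 lamS := Ioo_mem_nhdsLT hSpos
  obtain ⟨w, hw, hwu⟩ := exists_isRadialSolution_of_tendsto hφ.continuous hφ.nonneg hψ.continuous
    hψ.nonneg (fun r hr => hψ.le_one hr) hα hUc (tendsto_id.mono_left nhdsWithin_le_nhds)
    (hev.mono fun lam h => h.1.le) (hev.mono fun lam h => hUA lam h) hlim fun r hr => by
      refine (hlim r hr).congr' ?_
      filter_upwards [hev] with lam hlam
      obtain ⟨h, hh, h1, h2⟩ := hU lam hlam
      conv_lhs => rw [h1]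
      exact radialSolve_congr hφ.continuous hh (continuous_gelfandSource hψ.continuous
        (hUc lam) lam) α h2 hr
  refine ⟨w, hw, hSpos, fun lam x => U lam ‖x‖, hUmin, fun x hx => ?_⟩
  have hx' : ‖x‖ ∈ Icc (0 : ℝ) 1 := ⟨norm_nonneg x, mem_closedBall_zero_iff.1 hx⟩
  have h1 := hlim _ hx'
  rw [← hwu _ hx'] at h1
  exact h1

end Radial

/-- Minimal solutions bound each other from above, so they coincide on the closed ball, and so do
their limits. Estimates proved for the radial extremal solution thus apply to any extremal solution.
-/
theorem IsExtremalSolution.eqOn {φ ψ f : ℝ → ℝ} {α : ℝ} {u v : Plane → ℝ}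
    (hu : IsExtremalSolution φ ψ f α u) (hv : IsExtremalSolution φ ψ f α v) :
    EqOn u v (Metric.closedBall 0 1) := by
  obtain ⟨hpos, U, hU, hUlim⟩ := hu
  obtain ⟨-, V, hV, hVlim⟩ := hv
  intro x hx
  refine tendsto_nhds_unique ((hUlim x hx).congr' ?_) (hVlim x hx)
  filter_upwards [Ioo_mem_nhdsLT hpos] with lam hlam
  exact le_antisymm ((hU lam hlam).2 _ (hV lam hlam).1 x hx)
    ((hV lam hlam).2 _ (hU lam hlam).1 x hx)

/-! ### A priori estimates for radial solutions. -/

section Estimates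

variable {φ ψ : ℝ → ℝ} {ℓ α lam : ℝ} {u : ℝ → ℝ}

theorem monotoneOn_Icc_of_hasDerivAt {f f' : ℝ → ℝ} {a b : ℝ} (hc : ContinuousOn f (Icc a b))
    (hd : ∀ x ∈ Ioo a b, HasDerivAt f (f' x) x) (hf' : ∀ x ∈ Ioo a b, 0 ≤ f' x) :
    MonotoneOn f (Icc a b) := by
  refine monotoneOn_of_deriv_nonneg (convex_Icc a b) hc (fun x hx => ?_) fun x hx => ?_
  · rw [interior_Icc] at hx
    exact (hd x hx).differentiableAt.differentiableWithinAt
  · rw [interior_Icc] at hx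
    rw [(hd x hx).deriv]
    exact hf' x hx

theorem antitoneOn_Icc_of_hasDerivAt {f f' : ℝ → ℝ} {a b : ℝ} (hc : ContinuousOn f (Icc a b))
    (hd : ∀ x ∈ Ioo a b, HasDerivAt f (f' x) x) (hf' : ∀ x ∈ Ioo a b, f' x ≤ 0) :
    AntitoneOn f (Icc a b) := by
  refine antitoneOn_of_deriv_nonpos (convex_Icc a b) hc (fun x hx => ?_) fun x hx => ?_
  · rw [interior_Icc] at hx
    exact (hd x hx).differentiableAt.differentiableWithinAt
  · rw [interior_Icc] at hx
    rw [(hd x hx).deriv]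
    exact hf' x hx

/-- With `W = ∫₀ᵗ x E(x) dx`, the function `(2 + α t²) W - t² E` vanishes at `0` and has derivative
`2αtW + αt³E(1 - φ) ≥ 0`. -/
theorem radialSlope_one_ge (hφ : LinearlyBoundedProfile ℓ φ) (hα : 0 < α) {s : ℝ} (hs : 0 < s) :
    1 / (2 + α * s ^ 2) ≤ radialSlope φ α (fun _ => 1) s := by
  have hE := fun t => driftWeight_pos φ α t
  set W : ℝ → ℝ := fun s => ∫ t in (0 : ℝ)..s, t * driftWeight φ α t * 1 with hW
  have hWd : ∀ t, HasDerivAt W (t * driftWeight φ α t * 1) t :=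
    hasDerivAt_weightedIntegral hφ.continuous continuous_const α
  have hWc : Continuous W := continuous_iff_continuousAt.2 fun t => (hWd t).continuousAt
  have hEc := continuous_driftWeight hφ.continuous α
  have hW0 : ∀ t, 0 ≤ t → 0 ≤ W t := fun t ht =>
    intervalIntegral.integral_nonneg ht fun x hx => by
      have := hE x; have := hx.1; positivity
  have hmono : MonotoneOn (fun t => (2 + α * t ^ 2) * W t - t ^ 2 * driftWeight φ α t)
      (Icc 0 s) := by
    refine monotoneOn_Icc_of_hasDerivAt (by fun_prop) (fun t _ =>
      ((((hasDerivAt_pow 2 t).const_mul α).const_add 2).mul (hWd t)).sub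
        ((hasDerivAt_pow 2 t).mul (hasDerivAt_driftWeight hφ.continuous α t))) fun t ht => ?_
    have h1 := hφ.le_one ht.1.le
    have h2 := mul_nonneg (mul_nonneg hα.le ht.1.le) (hW0 t ht.1.le)
    have h3 : 0 ≤ α * t ^ 3 * driftWeight φ α t * (1 - φ t) := by
      have := hE t; have := ht.1; have : 0 ≤ 1 - φ t := by linarith
      positivity
    simp only [Nat.cast_ofNat, Nat.add_one_sub_one, pow_one]
    linarith
  have h := hmono ⟨le_rfl, hs.le⟩ ⟨hs.le, le_rfl⟩ hs.le
  have hW00 : W 0 = 0 := intervalIntegral.integral_same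
  simp only [hW00, mul_zero, ne_eq, OfNat.ofNat_ne_zero, not_false_eq_true, zero_pow, zero_mul,
    sub_zero] at h
  have hsq := sq_mul_radialSlope φ (fun _ => 1) α s
  rw [eq_div_iff (hE s).ne'] at hsq
  have hpos : 0 < 2 + α * s ^ 2 := by positivity
  rw [div_le_iff₀ hpos]
  have h5 : s ^ 2 * driftWeight φ α s * 1 ≤
      s ^ 2 * driftWeight φ α s * (radialSlope φ α (fun _ => 1) s * (2 + α * s ^ 2)) := by
    have : s ^ 2 * driftWeight φ α s * (radialSlope φ α (fun _ => 1) s * (2 + α * s ^ 2)) =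
      (2 + α * s ^ 2) * W s := by rw [hW]; simp only; rw [← hsq]; ring
    rw [this]; linarith
  exact le_of_mul_le_mul_left h5 (mul_pos (by positivity) (hE s))

/-- Monotonicity of `ψ` and `u` bounds the slope below by `lam ψ(t) e^{u(t)}` times the slope for
source `1`. Multiplication by `e^{-u}` removes the nonlinearity, leaving an explicit function to
integrate. -/
theorem IsRadialSolution.exp_neg_ge (hφ : LinearlyBoundedProfile ℓ φ)
    (hψ : LinearlyBoundedProfile ℓ ψ) (hα : 0 < α) (hlam : 0 ≤ lam)
    (hu : IsRadialSolution φ ψ α lam u) {r : ℝ} (hr : r ∈ Icc (0 : ℝ) 1) :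
    Real.exp (-u 0) + lam / α * (Real.log (1 + α * r ^ 2 / 2) / 2 - ℓ * r) ≤
      Real.exp (-u r) := by
  have hanti := hu.antitoneOn hφ.continuous hψ.nonneg hlam
  obtain ⟨h, hh, hueq, heq⟩ := hu
  have hud : ∀ t, HasDerivAt u (-(t * radialSlope φ α h t)) t := by
    rw [hueq]; exact hasDerivAt_radialSolve hφ.continuous hh α
  have hne : ∀ t : ℝ, 1 + α * t ^ 2 / 2 ≠ 0 := fun t => by positivity
  have hD : ∀ t, HasDerivAt (fun t => Real.exp (-u t) -
      lam / α * (Real.log (1 + α * t ^ 2 / 2) / 2 - ℓ * t))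
      (Real.exp (-u t) * (t * radialSlope φ α h t) -
        lam / α * (α * t / (2 + α * t ^ 2) - ℓ)) t := by
    intro t
    have h1 : HasDerivAt (fun t : ℝ => 1 + α * t ^ 2 / 2) (α * t) t :=
      ((((hasDerivAt_pow 2 t).const_mul α).div_const 2).const_add 1).congr_deriv (by
        simp; ring)
    have h2 := (((h1.log (hne t)).div_const 2).sub ((hasDerivAt_id t).const_mul ℓ)).const_mul
      (lam / α)
    refine ((hud t).neg.exp.sub h2).congr_deriv ?_
    have : (2 : ℝ) + α * t ^ 2 ≠ 0 := by positivity
    simp only [Pi.neg_apply, neg_neg, mul_one]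
    congr 3
    have := hne t
    field_simp
  have hmono : MonotoneOn (fun t => Real.exp (-u t) -
      lam / α * (Real.log (1 + α * t ^ 2 / 2) / 2 - ℓ * t)) (Icc 0 1) := by
    refine monotoneOn_Icc_of_hasDerivAt (fun t _ => (hD t).continuousAt.continuousWithinAt)
      (fun t _ => hD t) fun t ht => ?_
    have ht' : t ∈ Icc (0 : ℝ) 1 := Ioo_subset_Icc_self ht
    have hk : lam * ψ t * Real.exp (u t) * radialSlope φ α (fun _ => 1) t ≤
        radialSlope φ α h t := by
      rw [← radialSlope_const_mul]
      refine radialSlope_mono hφ.continuous continuous_const hh α ht.1.le fun x hx => ?_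
      have hx' : x ∈ Icc (0 : ℝ) 1 := ⟨hx.1, hx.2.trans ht.2.le⟩
      rw [heq x hx', mul_one]
      exact mul_le_mul (mul_le_mul_of_nonneg_left (hψ.antitone hx.2) hlam)
        (Real.exp_le_exp.2 (hanti hx' ht' hx.2)) (Real.exp_pos _).le
        (mul_nonneg hlam (hψ.nonneg x))
    have hk1 := radialSlope_one_ge hφ hα ht.1
    have hden : 0 < 2 + α * t ^ 2 := by have := ht.1; positivity
    have h3 : Real.exp (-u t) * (t * (lam * ψ t * Real.exp (u t) *
        radialSlope φ α (fun _ => 1) t)) ≤ Real.exp (-u t) * (t * radialSlope φ α h t) :=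
      mul_le_mul_of_nonneg_left (mul_le_mul_of_nonneg_left hk ht.1.le) (Real.exp_pos _).le
    have h4 : Real.exp (-u t) * (t * (lam * ψ t * Real.exp (u t) *
        radialSlope φ α (fun _ => 1) t)) = lam * t * ψ t * radialSlope φ α (fun _ => 1) t := by
      have : Real.exp (-u t) * Real.exp (u t) = 1 := by rw [← Real.exp_add]; simp
      linear_combination lam * t * ψ t * radialSlope φ α (fun _ => 1) t * this
    have h5 : lam * t * ψ t * (1 / (2 + α * t ^ 2)) ≤
        lam * t * ψ t * radialSlope φ α (fun _ => 1) t :=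
      mul_le_mul_of_nonneg_left hk1 (mul_nonneg (mul_nonneg hlam ht.1.le) (hψ.nonneg t))
    have h6 : lam * t * (1 - ℓ * t) * (1 / (2 + α * t ^ 2)) ≤
        lam * t * ψ t * (1 / (2 + α * t ^ 2)) :=
      mul_le_mul_of_nonneg_right (mul_le_mul_of_nonneg_left (hψ.lower t ht.1.le)
        (mul_nonneg hlam ht.1.le)) (by positivity)
    have h7 : lam / α * (α * t / (2 + α * t ^ 2) - ℓ) ≤
        lam * t * (1 - ℓ * t) * (1 / (2 + α * t ^ 2)) := by
      have hℓ := hψ.one_le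
      have : lam * t * (1 - ℓ * t) * (1 / (2 + α * t ^ 2)) -
          lam / α * (α * t / (2 + α * t ^ 2) - ℓ) = 2 * lam * ℓ / (α * (2 + α * t ^ 2)) := by
        field_simp; ring
      have h8 : 0 ≤ 2 * lam * ℓ / (α * (2 + α * t ^ 2)) := by positivity
      linarith
    linarith
  have := hmono ⟨le_rfl, zero_le_one⟩ hr hr.1
  simp at this
  linarith

theorem driftPotential_le (hφ : LinearlyBoundedProfile ℓ φ) {r : ℝ} (hr : 0 ≤ r) :
    driftPotential φ r ≤ r ^ 2 / 2 := by
  have h1 : ∫ t in (0 : ℝ)..r, t = r ^ 2 / 2 := by simp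
  rw [← h1]
  refine intervalIntegral.integral_mono_on hr
    ((continuous_id.mul hφ.continuous).intervalIntegrable _ _)
    (continuous_id.intervalIntegrable _ _) fun t ht => ?_
  exact mul_le_of_le_one_right ht.1 (hφ.le_one ht.1)

/-- Every radial solution is bounded at the origin in terms of `α / lam` only: a larger value
would force it to become negative within distance `α^{-1/2}`. -/
theorem IsRadialSolution.apply_zero_le (hφ : LinearlyBoundedProfile ℓ φ)
    (hψ : LinearlyBoundedProfile ℓ ψ) (hα : 0 < α) (hlam : 0 < lam)
    (hu : IsRadialSolution φ ψ α lam u) {R : ℝ} (hR : R ∈ Ioc (0 : ℝ) 1)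
    (hRα : α * R ^ 2 = 1 / 5) (hRℓ : ℓ * R ≤ 1 / 10) :
    u 0 ≤ 3 * Real.log (40 * α / lam) := by
  have huc := hu.continuous hφ.continuous
  have huR := hu.nonneg hφ.continuous hψ.nonneg hlam.le ⟨hR.1.le, hR.2⟩
  obtain ⟨h, hh, hueq, heq⟩ := hu
  have hud : ∀ t, HasDerivAt u (-(t * radialSlope φ α h t)) t := by
    rw [hueq]; exact hasDerivAt_radialSolve hφ.continuous hh α
  have hec : Continuous fun t => Real.exp (u t) := Real.continuous_exp.comp huc
  have h0c : Continuous (0 : ℝ → ℝ) := continuous_const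
  -- The drift-free slope for the source `e^u`. The actual slope lies below `lam * q` on `[0,1]` and
  -- above three quarters of it on `[0,R]`.
  set q := radialSlope 0 0 fun t => Real.exp (u t) with hq
  have hqc : Continuous q := continuous_radialSlope h0c hec 0
  have hqd : ∀ t, 0 < t → HasDerivAt q ((Real.exp (u t) - 2 * q t) / t) t := fun t ht => by
    simpa using hasDerivAt_radialSlope h0c hec 0 ht
  have hqpos : ∀ t ∈ Icc (0 : ℝ) 1, 0 < q t := fun t ht =>
    radialSlope_pos h0c hec 0 ht ⟨zero_lt_one, le_rfl⟩ (fun _ _ => (Real.exp_pos _).le)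
      fun _ _ => Real.exp_pos _
  have hweight : ∀ t, driftWeight 0 0 t = 1 := fun t => by simp [driftWeight]
  have hqint : ∀ c s : ℝ, c * q s = ∫ τ in (0 : ℝ)..1, c * (τ * Real.exp (u (s * τ))) := by
    intro c s
    rw [intervalIntegral.integral_const_mul, hq, radialSlope]
    simp [hweight]
  have hslice : ∀ c s : ℝ, Continuous fun τ : ℝ => c * (τ * Real.exp (u (s * τ))) := by
    intro c s; fun_prop
  have hupper : ∀ s ∈ Icc (0 : ℝ) 1, radialSlope φ α h s ≤ lam * q s := by
    intro s hs
    rw [hqint]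
    refine intervalIntegral.integral_mono_on zero_le_one
      ((continuous_radialSlope_slice hφ.continuous hh α s).intervalIntegrable _ _)
      ((hslice lam s).intervalIntegrable _ _) fun τ hτ => ?_
    have hm : s * τ ∈ Icc (0 : ℝ) 1 := ⟨mul_nonneg hs.1 hτ.1, mul_le_one₀ hs.2 hτ.1 hτ.2⟩
    rw [heq _ hm, gelfandSource]
    have h1 := driftWeight_ratio_le_one hφ.continuous hφ.nonneg hα.le hm.1
      (mul_le_of_le_one_right hs.1 hτ.2)
    have h0 : 0 ≤ driftWeight φ α (s * τ) / driftWeight φ α s :=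
      div_nonneg (driftWeight_pos _ _ _).le (driftWeight_pos _ _ _).le
    have h2 : driftWeight φ α (s * τ) / driftWeight φ α s * ψ (s * τ) ≤ 1 :=
      mul_le_one₀ h1 (hψ.nonneg _) (hψ.le_one hm.1)
    have h3 : 0 ≤ lam * (τ * Real.exp (u (s * τ))) := by have := hτ.1; positivity
    calc _ = driftWeight φ α (s * τ) / driftWeight φ α s * ψ (s * τ) *
          (lam * (τ * Real.exp (u (s * τ)))) := by ring
      _ ≤ _ := mul_le_of_le_one_left h3 h2
  -- The choice of `R` costs one factor `9/10` for the weights and one for `ψ`. Any resulting factor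
  -- above `1/2` would suffice for the final absorption.
  have hlower : ∀ s ∈ Icc (0 : ℝ) R, 3 / 4 * lam * q s ≤ radialSlope φ α h s := by
    intro s hs
    rw [hqint]
    refine intervalIntegral.integral_mono_on zero_le_one
      ((hslice _ s).intervalIntegrable _ _)
      ((continuous_radialSlope_slice hφ.continuous hh α s).intervalIntegrable _ _)
      fun τ hτ => ?_
    have hm0 : 0 ≤ s * τ := mul_nonneg hs.1 hτ.1
    have hmR : s * τ ≤ R := (mul_le_of_le_one_right hs.1 hτ.2).trans hs.2
    rw [heq _ ⟨hm0, hmR.trans hR.2⟩, gelfandSource]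
    have hE1 : (1 : ℝ) ≤ driftWeight φ α (s * τ) := by
      rw [← driftWeight_zero φ α]
      exact monotoneOn_driftWeight hφ.continuous hφ.nonneg hα.le (mem_Ici.2 le_rfl) hm0 hm0
    have hE2 : driftWeight φ α s ≤ Real.exp (1 / 10) := by
      refine Real.exp_le_exp.2 ?_
      have h1 := driftPotential_le hφ hs.1
      have h2 : s ^ 2 ≤ R ^ 2 := pow_le_pow_left₀ hs.1 hs.2 2
      have h3 := mul_le_mul_of_nonneg_left (h1.trans (by linarith : s ^ 2 / 2 ≤ R ^ 2 / 2)) hα.le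
      linarith
    have hE3 : driftWeight φ α s ≤ 10 / 9 := by
      refine hE2.trans ?_
      have h1 : (9 / 10 : ℝ) ≤ Real.exp (-(1 / 10)) := by
        have := Real.add_one_le_exp (-(1 / 10) : ℝ); linarith
      rw [Real.exp_neg, le_inv_comm₀ (by norm_num) (Real.exp_pos _)] at h1
      exact h1.trans (by norm_num)
    have hE4 : 9 / 10 ≤ driftWeight φ α (s * τ) / driftWeight φ α s := by
      rw [le_div_iff₀ (driftWeight_pos _ _ _)]; linarith
    have hψ9 : 9 / 10 ≤ ψ (s * τ) := by
      have h1 := hψ.lower _ hm0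
      have h2 := mul_le_mul_of_nonneg_left hmR (zero_le_one.trans hψ.one_le)
      linarith
    have h2 : 3 / 4 ≤ driftWeight φ α (s * τ) / driftWeight φ α s * ψ (s * τ) := by
      have := mul_le_mul hE4 hψ9 (by norm_num) (by linarith)
      linarith
    have h3 : 0 ≤ lam * (τ * Real.exp (u (s * τ))) := by have := hτ.1; positivity
    calc _ = 3 / 4 * (lam * (τ * Real.exp (u (s * τ)))) := by ring
      _ ≤ driftWeight φ α (s * τ) / driftWeight φ α s * ψ (s * τ) *
          (lam * (τ * Real.exp (u (s * τ)))) := mul_le_mul_of_nonneg_right h2 h3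
      _ = _ := by ring
  -- With `m = t² q = ∫₀ᵗ x e^{u(x)} dx`, the quantity `t² e^u - 2m + lam m²/2` is the first
  -- integral of Liouville's equation. Here its derivative is `t³ e^u` times the excess of `lam * q`
  -- over the true slope, so it increases from `0`.
  have hG : ∀ r ∈ Ioc (0 : ℝ) 1, 2 * q r - lam * r ^ 2 * q r ^ 2 / 2 ≤ Real.exp (u r) := by
    intro r hr
    have hmono : MonotoneOn (fun t => t ^ 2 * Real.exp (u t) - 2 * (t ^ 2 * q t) +
        lam * (t ^ 2 * q t) ^ 2 / 2) (Icc 0 1) := by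
      refine monotoneOn_Icc_of_hasDerivAt (f' := fun t => t ^ 3 * Real.exp (u t) *
        (lam * q t - radialSlope φ α h t)) (by fun_prop) (fun t ht => ?_) fun t ht => ?_
      · have h1 : HasDerivAt (fun t => t ^ 2 * q t) (t * Real.exp (u t)) t :=
          ((hasDerivAt_pow 2 t).mul (hqd t ht.1)).congr_deriv (by
            have := ht.1.ne'; field_simp; simp; ring)
        refine ((((hasDerivAt_pow 2 t).mul (hud t).exp).sub (h1.const_mul 2)).add
          (((h1.pow 2).const_mul lam).div_const 2)).congr_deriv ?_
        simp
        ring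
      · have := hupper t (Ioo_subset_Icc_self ht)
        have := ht.1
        have : 0 ≤ lam * q t - radialSlope φ α h t := by linarith
        positivity
    have h1 := hmono ⟨le_rfl, zero_le_one⟩ ⟨hr.1.le, hr.2⟩ hr.1.le
    simp at h1
    have hr2 : 0 < r ^ 2 := pow_pos hr.1 2
    have h2 : r ^ 2 * (2 * q r - lam * r ^ 2 * q r ^ 2 / 2) ≤ r ^ 2 * Real.exp (u r) := by
      nlinarith
    exact le_of_mul_le_mul_left h2 hr2
  set b := 2 * Real.exp (-u 0) / lam with hb
  have hbpos : 0 < b := by positivity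
  have hq0 : 1 / (lam * q 0) = b := by
    rw [hq, radialSlope_zero, hb, Real.exp_neg]; field_simp
  -- The preceding inequality is a Riccati inequality for `q`, so `1 / (lam q)` grows at rate at
  -- most `t/2`; the bound is the explicit Liouville profile.
  have hqge : ∀ r ∈ Icc (0 : ℝ) R, 4 / (r ^ 2 + 4 * b) ≤ lam * q r := by
    have hanti : AntitoneOn (fun t => 1 / (lam * q t) - t ^ 2 / 4) (Icc 0 1) := by
      have hne : ∀ t ∈ Icc (0 : ℝ) 1, lam * q t ≠ 0 := fun t ht =>
        (mul_pos hlam (hqpos t ht)).ne'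
      refine antitoneOn_Icc_of_hasDerivAt (f' := fun t =>
        -(lam * ((Real.exp (u t) - 2 * q t) / t)) / (lam * q t) ^ 2 - t / 2) ?_ ?_ ?_
      · exact (continuousOn_const.div (by fun_prop) hne).sub (by fun_prop)
      · intro t ht
        have h1 := ((hqd t ht.1).const_mul lam).fun_inv (hne t (Ioo_subset_Icc_self ht))
        simp only [one_div]
        exact (h1.sub ((hasDerivAt_pow 2 t).div_const 4)).congr_deriv (by simp; ring)
      · intro t ht
        have h1 := hG t ⟨ht.1, ht.2.le⟩
        have hqt := hqpos t (Ioo_subset_Icc_self ht)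
        have ht0 := ht.1
        have h2 : -(lam * ((Real.exp (u t) - 2 * q t) / t)) / (lam * q t) ^ 2 - t / 2 =
            (2 * q t - lam * t ^ 2 * q t ^ 2 / 2 - Real.exp (u t)) / (lam * t * q t ^ 2) := by
          field_simp; ring
        rw [h2]
        exact div_nonpos_of_nonpos_of_nonneg (by linarith) (by positivity)
    intro r hr
    have hr1 : r ∈ Icc (0 : ℝ) 1 := ⟨hr.1, hr.2.trans hR.2⟩
    have h1 := hanti ⟨le_rfl, zero_le_one⟩ hr1 hr.1
    simp only [hq0] at h1
    have hqr := mul_pos hlam (hqpos r hr1)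
    have h2 : 1 / (lam * q r) ≤ (r ^ 2 + 4 * b) / 4 := by nlinarith
    rw [div_le_iff₀ (by positivity)]
    rw [div_le_iff₀ hqr] at h2
    linarith
  -- Integrating the slope bound gives `u(R) ≤ u(0) - (3/2) log((R² + 4b) / (4b))`. As `log (4b)`
  -- contains `-u(0)`, the coefficient `3/2 > 1` together with `u(R) ≥ 0` bounds `u(0)`.
  have hlog : AntitoneOn (fun t => u t + 3 / 2 * Real.log (t ^ 2 + 4 * b)) (Icc 0 R) := by
    have hpos : ∀ t : ℝ, 0 < t ^ 2 + 4 * b := fun t => by positivity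
    refine antitoneOn_Icc_of_hasDerivAt (f' := fun t => -(t * radialSlope φ α h t) +
      3 * t / (t ^ 2 + 4 * b)) ?_ ?_ ?_
    · exact huc.continuousOn.add (continuousOn_const.mul
        (ContinuousOn.log (by fun_prop) fun t _ => (hpos t).ne'))
    · intro t ht
      refine ((hud t).add ((((hasDerivAt_pow 2 t).add_const (4 * b)).log
        (hpos t).ne').const_mul (3 / 2))).congr_deriv ?_
      simp
      ring
    · intro t ht
      have h1 := hlower t (Ioo_subset_Icc_self ht)
      have h2 := hqge t (Ioo_subset_Icc_self ht)
      have h3 : 3 / (t ^ 2 + 4 * b) ≤ radialSlope φ α h t := by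
        have : 3 / (t ^ 2 + 4 * b) = 3 / 4 * (4 / (t ^ 2 + 4 * b)) := by ring
        rw [this]; linarith
      have h4 := mul_le_mul_of_nonneg_left h3 ht.1.le
      have : 3 * t / (t ^ 2 + 4 * b) = t * (3 / (t ^ 2 + 4 * b)) := by ring
      linarith
  have h1 := hlog ⟨le_rfl, hR.1.le⟩ ⟨hR.1.le, le_rfl⟩ hR.1.le
  have hR2 : 0 < R ^ 2 := pow_pos hR.1 2
  have h2 : Real.log (R ^ 2) ≤ Real.log (R ^ 2 + 4 * b) :=
    Real.log_le_log hR2 (by linarith)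
  have h3 : Real.log (4 * b) = Real.log (8 / lam) - u 0 := by
    have : 4 * b = 8 / lam * Real.exp (-u 0) := by rw [hb]; ring
    rw [this, Real.log_mul (by positivity) (Real.exp_pos _).ne', Real.log_exp]; ring
  have h4 : Real.log (40 * α / lam) = Real.log (8 / lam) - Real.log (R ^ 2) := by
    rw [← Real.log_div (by positivity) hR2.ne']
    have h5 : 40 * α = 8 / R ^ 2 := by rw [eq_div_iff hR2.ne']; linarith
    rw [h5]
    congr 1
    ring
  simp only [ne_eq, OfNat.ofNat_ne_zero, not_false_eq_true, zero_pow, zero_add] at h1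
  rw [h4]
  linarith

end Estimates

/-! ### The explicit supersolution. -/

/-- The function `D` for which `-log D` is, up to constants, a supersolution. -/
noncomputable def layerDenom (ℓ α δ s : ℝ) : ℝ :=
  δ + (Real.log (1 + α * s ^ 2) + 2 * (α * s ^ 2) / (1 + α * s ^ 2) + 6 * ℓ * |s|) / Real.log α

/-- The main part of the derivative of `layerDenom`. -/
noncomputable def layerSlope (α s : ℝ) : ℝ :=
  α * s * (α * s ^ 2 + 3) / (1 + α * s ^ 2) ^ 2

section Supersolution

variable {φ ψ M : ℝ → ℝ} {ℓ α δ lam : ℝ}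

/-- In `y = α s²` the product is `y(y + 3)/(1 + y)²`, maximal at `y = 3`. -/
theorem mul_layerSlope_le (hα : 0 ≤ α) (s : ℝ) : s * layerSlope α s ≤ 9 / 8 := by
  rw [layerSlope, ← mul_div_assoc, div_le_iff₀ (by positivity)]
  nlinarith [sq_nonneg (α * s ^ 2 - 3)]

theorem layerSlope_le (hα : 0 ≤ α) {s : ℝ} (hs : 0 ≤ s) : layerSlope α s ≤ 3 * α * s := by
  have h0 : 0 ≤ α * s ^ 2 := by positivity
  rw [layerSlope, div_le_iff₀ (by positivity)]
  have h1 : α * s ^ 2 + 3 ≤ 3 * (1 + α * s ^ 2) ^ 2 := by nlinarith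
  have h2 := mul_le_mul_of_nonneg_left h1 (mul_nonneg hα hs)
  linarith

theorem layerSlope_nonneg (hα : 0 ≤ α) {s : ℝ} (hs : 0 ≤ s) : 0 ≤ layerSlope α s := by
  unfold layerSlope; positivity

theorem continuous_layerSlope (hα : 0 ≤ α) : Continuous (layerSlope α) := by
  unfold layerSlope
  exact Continuous.div (by fun_prop) (by fun_prop) fun s => by positivity

theorem hasDerivAt_mul_layerSlope (hα : 0 ≤ α) (s : ℝ) :
    HasDerivAt (fun s => s * layerSlope α s) (2 * α * s * (3 - α * s ^ 2) / (1 + α * s ^ 2) ^ 3)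
      s := by
  have hne : (1 + α * s ^ 2) ≠ 0 := by positivity
  have hy : HasDerivAt (fun s : ℝ => α * s ^ 2) (2 * α * s) s :=
    ((hasDerivAt_pow 2 s).const_mul α).congr_deriv (by simp; ring)
  have h1 := (hy.mul (hy.add_const 3)).div ((hy.const_add 1).pow 2) (pow_ne_zero 2 hne)
  have h2 : (fun s => s * layerSlope α s) =
      fun s => (α * s ^ 2) * (α * s ^ 2 + 3) / (1 + α * s ^ 2) ^ 2 := by
    ext t; rw [layerSlope]; ring
  rw [h2]
  refine h1.congr_deriv ?_
  simp
  field_simp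
  ring

theorem continuous_layerDenom (hα : 0 ≤ α) (ℓ δ : ℝ) : Continuous (layerDenom ℓ α δ) := by
  have hne : ∀ s : ℝ, 1 + α * s ^ 2 ≠ 0 := fun s => by positivity
  have h1 : Continuous fun s : ℝ => Real.log (1 + α * s ^ 2) :=
    Continuous.log (by fun_prop) hne
  have h2 : Continuous fun s : ℝ => 2 * (α * s ^ 2) / (1 + α * s ^ 2) :=
    Continuous.div (by fun_prop) (by fun_prop) hne
  unfold layerDenom
  fun_prop

theorem hasDerivAt_layerDenom (hα : 0 ≤ α) (ℓ δ : ℝ) {s : ℝ} (hs : 0 < s) :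
    HasDerivAt (layerDenom ℓ α δ) ((2 * layerSlope α s + 6 * ℓ) / Real.log α) s := by
  have hne : (1 + α * s ^ 2) ≠ 0 := by positivity
  have hy : HasDerivAt (fun s : ℝ => α * s ^ 2) (2 * α * s) s :=
    ((hasDerivAt_pow 2 s).const_mul α).congr_deriv (by simp; ring)
  have h1 := ((((hy.const_add 1).log hne).add ((hy.const_mul 2).div (hy.const_add 1) hne)).add
    ((hasDerivAt_abs_pos hs).const_mul (6 * ℓ))).div_const (Real.log α) |>.const_add δ
  refine h1.congr_deriv ?_
  congr 1
  rw [layerSlope]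
  field_simp
  ring

theorem le_layerDenom (hα : 1 < α) (hℓ : 0 ≤ ℓ) (δ s : ℝ) : δ ≤ layerDenom ℓ α δ s := by
  have h0 : 0 ≤ α * s ^ 2 := by positivity
  have h1 := Real.log_nonneg (by linarith : 1 ≤ 1 + α * s ^ 2)
  have h2 := Real.log_pos hα
  have : 0 ≤ (Real.log (1 + α * s ^ 2) + 2 * (α * s ^ 2) / (1 + α * s ^ 2) + 6 * ℓ * |s|) /
      Real.log α := by positivity
  rw [layerDenom]; linarith

/-- Here `α s⁴ ≥ 1`, so `(1 + α s²)² ≥ α` and the logarithm alone already contributes one half. -/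
theorem half_le_layerDenom (hα : 1 < α) (hℓ : 0 < ℓ) (hδ : 0 ≤ δ) (hαℓ : 16 * ℓ ^ 4 ≤ α) {s : ℝ}
    (hs : 1 / (2 * ℓ) ≤ s) : 1 / 2 ≤ layerDenom ℓ α δ s := by
  have hs0 : 0 < s := lt_of_lt_of_le (by positivity) hs
  have h2 := Real.log_pos hα
  have h4 : 1 ≤ α * s ^ 4 := by
    rw [div_le_iff₀ (by positivity)] at hs
    have h5 : (1 : ℝ) ≤ (s * (2 * ℓ)) ^ 4 := one_le_pow₀ hs
    have h6 : 16 * ℓ ^ 4 * s ^ 4 ≤ α * s ^ 4 := by gcongr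
    nlinarith
  have h3 : Real.log α ≤ 2 * Real.log (1 + α * s ^ 2) := by
    rw [← Real.log_rpow (by positivity)]
    refine Real.log_le_log (by linarith) ?_
    norm_cast
    nlinarith [mul_le_mul_of_nonneg_left h4 (by linarith : 0 ≤ α), sq_nonneg s]
  have h7 : 0 ≤ 2 * (α * s ^ 2) / (1 + α * s ^ 2) + 6 * ℓ * |s| := by positivity
  have h8 : 1 / 2 ≤ (Real.log (1 + α * s ^ 2) + 2 * (α * s ^ 2) / (1 + α * s ^ 2) + 6 * ℓ * |s|) /
      Real.log α := by
    rw [le_div_iff₀ h2]; linarith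
  rw [layerDenom]; linarith

/-- Both sides vanish at `0`, so their derivatives are compared. Differentiating `s σ E`, with `σ`
the layer slope, gives a gain; differentiating `1/D` gives a loss, which the factor `1 - δ` absorbs.
The bound `φ ≥ 1/2` holds on this range. -/
theorem weightedIntegral_inner_le (hφ : LinearlyBoundedProfile ℓ φ) (hα : 1 < α) (hδ : 0 < δ)
    (hδL : 14 + 36 * ℓ ≤ δ ^ 2 * Real.log α) {s : ℝ} (hs : s ∈ Icc 0 (1 / (2 * ℓ))) :
    2 * α / Real.log α * (1 - δ) *
        ∫ t in (0 : ℝ)..s, t * driftWeight φ α t * (φ t / layerDenom ℓ α δ t) ≤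
      2 / Real.log α * (s * layerSlope α s) * (driftWeight φ α s / layerDenom ℓ α δ s) := by
  have hℓ := hφ.one_le
  have hα0 : 0 ≤ α := by linarith
  have hL := Real.log_pos hα
  have hDc := continuous_layerDenom hα0 ℓ δ
  have hDδ := le_layerDenom hα (by linarith : 0 ≤ ℓ) δ
  have hDpos : ∀ t, 0 < layerDenom ℓ α δ t := fun t => hδ.trans_le (hDδ t)
  have hEpos := driftWeight_pos φ α
  have hEc := continuous_driftWeight hφ.continuous α
  have hhc : Continuous fun t => φ t / layerDenom ℓ α δ t :=
    hφ.continuous.div hDc fun t => (hDpos t).ne'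
  have hX := hasDerivAt_weightedIntegral hφ.continuous hhc α
  have hsl := continuous_layerSlope hα0
  have hmono : MonotoneOn (fun s => 2 / Real.log α * (s * layerSlope α s) *
      (driftWeight φ α s / layerDenom ℓ α δ s) - 2 * α / Real.log α * (1 - δ) *
        ∫ t in (0 : ℝ)..s, t * driftWeight φ α t * (φ t / layerDenom ℓ α δ t))
      (Icc 0 (1 / (2 * ℓ))) := by
    refine monotoneOn_Icc_of_hasDerivAt ?_ (fun t ht =>
      (((hasDerivAt_mul_layerSlope hα0 t).const_mul (2 / Real.log α)).mul
        ((hasDerivAt_driftWeight hφ.continuous α t).div (hasDerivAt_layerDenom hα0 ℓ δ ht.1)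
          (hDpos t).ne')).sub ((hX t).const_mul (2 * α / Real.log α * (1 - δ)))) fun t ht => ?_
    · have hXc : Continuous fun s =>
          ∫ t in (0 : ℝ)..s, t * driftWeight φ α t * (φ t / layerDenom ℓ α δ t) :=
        continuous_iff_continuousAt.2 fun t => (hX t).continuousAt
      have : Continuous fun s => driftWeight φ α s / layerDenom ℓ α δ s :=
        hEc.div hDc fun t => (hDpos t).ne'
      fun_prop
    · have ht0 := ht.1
      have hD := hDpos t
      have hE := hEpos t
      set D := layerDenom ℓ α δ t
      set E := driftWeight φ α t
      set σ := layerSlope α t with hσ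
      have hφ1 := hφ.le_one ht0.le
      have hφ2 : 1 / 2 ≤ φ t := by
        have h1 := hφ.lower t ht0.le
        have h2 : ℓ * t ≤ 1 / 2 := by
          have := mul_le_mul_of_nonneg_left ht.2.le (by linarith : 0 ≤ ℓ)
          rwa [show ℓ * (1 / (2 * ℓ)) = 1 / 2 by field_simp] at this
        linarith
      have ht1 : t ≤ 1 / 2 := ht.2.le.trans (by
        rw [div_le_div_iff₀ (by positivity) (by norm_num)]; linarith)
      have hσ0 : 0 ≤ σ := layerSlope_nonneg hα0 ht0.le
      have hσ1 : σ ≤ 3 * α * t := layerSlope_le hα0 ht0.le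
      have hσ2 : t * σ ≤ 9 / 8 := mul_layerSlope_le hα0 t
      -- the loss from `D'/D` is absorbed by `δ`
      have hloss : t * σ * ((2 * σ + 6 * ℓ) / Real.log α) ≤ δ * (α * t * φ t) * D := by
        -- The bounds `tσ ≤ 9/8` and `σ ≤ 3αt` give `27/4`, rounded up to `7`. The required lower
        -- bound on `δ² log α` is twice `7 + 18ℓ`, the two coming from `φ ≥ 1/2`.
        have h1 : t * σ * (2 * σ + 6 * ℓ) ≤ α * t * (7 + 18 * ℓ) := by
          have h2 : t * σ * σ ≤ 9 / 8 * (3 * α * t) :=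
            mul_le_mul hσ2 hσ1 hσ0 (by norm_num)
          have h3 : t * σ ≤ 1 * (3 * α * t) :=
            mul_le_mul (by linarith) hσ1 hσ0 zero_le_one
          have h4 : t * σ * ℓ ≤ 3 * α * t * ℓ := by
            rw [one_mul] at h3; exact mul_le_mul_of_nonneg_right h3 (by linarith)
          have h5 : 0 ≤ α * t := mul_nonneg hα0 ht0.le
          nlinarith
        have h2 : 7 + 18 * ℓ ≤ δ * φ t * D * Real.log α := by
          have h3 : δ * (1 / 2) * δ ≤ δ * φ t * D :=
            mul_le_mul (mul_le_mul_of_nonneg_left hφ2 hδ.le) (hDδ t) hδ.le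
              (mul_nonneg hδ.le (by linarith))
          have h4 := mul_le_mul_of_nonneg_right h3 hL.le
          nlinarith
        rw [← mul_div_assoc, div_le_iff₀ hL]
        refine h1.trans ?_
        have := mul_le_mul_of_nonneg_left h2 (mul_nonneg hα0 ht0.le)
        linarith
      -- This is where the term `2y/(1+y)` of `D` is needed. It makes `tσ - 1 = (y - 1)/(1 + y)²`,
      -- positive for `y > 1`; without it `tσ - 1` would be `-1/(1+y)`, too negative for large `y`.
      have hgain : 0 ≤ 2 * α * t * (3 - α * t ^ 2) / (1 + α * t ^ 2) ^ 3 +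
          (t * σ - 1) * (α * t * φ t) := by
        have hy : 0 ≤ α * t ^ 2 := by positivity
        have h1 : 2 * α * t * (3 - α * t ^ 2) / (1 + α * t ^ 2) ^ 3 +
            (t * σ - 1) * (α * t * φ t) = α * t * (2 * (3 - α * t ^ 2) +
              ((α * t ^ 2) ^ 2 - 1) * φ t) / (1 + α * t ^ 2) ^ 3 := by
          rw [hσ, layerSlope]
          field_simp
          ring
        rw [h1]
        refine div_nonneg (mul_nonneg (by positivity) ?_) (by positivity)
        generalize α * t ^ 2 = y at hy
        rcases le_total y 1 with h | h
        · nlinarith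
        · have : 0 ≤ (y ^ 2 - 1) * (φ t - 1 / 2) := mul_nonneg (by nlinarith) (by linarith)
          nlinarith [sq_nonneg (y - 2)]
      have heq : 2 / Real.log α * (2 * α * t * (3 - α * t ^ 2) / (1 + α * t ^ 2) ^ 3) * (E / D) +
          2 / Real.log α * (t * σ) * ((E * (α * (t * φ t)) * D -
            E * ((2 * σ + 6 * ℓ) / Real.log α)) / D ^ 2) -
          2 * α / Real.log α * (1 - δ) * (t * E * (φ t / D)) =
          2 / Real.log α * (E / D ^ 2) * ((2 * α * t * (3 - α * t ^ 2) / (1 + α * t ^ 2) ^ 3 +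
          (t * σ - 1) * (α * t * φ t)) * D + (δ * (α * t * φ t) * D -
            t * σ * ((2 * σ + 6 * ℓ) / Real.log α))) := by
        field_simp
        ring
      refine le_of_le_of_eq ?_ heq.symm
      refine mul_nonneg (by positivity) (add_nonneg (mul_nonneg hgain hD.le) (by linarith))
  have h := hmono ⟨le_rfl, hs.1.trans hs.2⟩ hs hs.1
  simp at h
  simpa using h

/-- Beyond `1/(2ℓ)` the profile `φ` may degenerate, but `D ≥ 1/2` and `E' = α s φ E` contains the
same factor `φ` as the integrand. The constant `9/2` is the value `2 · (9/8) · 2` of the inner bound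
at the junction. -/
theorem weightedIntegral_outer_le (hφ : LinearlyBoundedProfile ℓ φ) (hα : 1 < α) (hδ : 0 < δ)
    (hαℓ : 16 * ℓ ^ 4 ≤ α) (hδL : 14 + 36 * ℓ ≤ δ ^ 2 * Real.log α) {s : ℝ}
    (hs : 1 / (2 * ℓ) ≤ s) :
    2 * α / Real.log α * (1 - δ) *
        ∫ t in (0 : ℝ)..s, t * driftWeight φ α t * (φ t / layerDenom ℓ α δ t) ≤
      9 / 2 / Real.log α * driftWeight φ α s := by
  have hℓ := hφ.one_le
  have hα0 : 0 ≤ α := by linarith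
  have hL := Real.log_pos hα
  have hDc := continuous_layerDenom hα0 ℓ δ
  have hDpos : ∀ t, 0 < layerDenom ℓ α δ t := fun t =>
    hδ.trans_le (le_layerDenom hα (by linarith) δ t)
  have hhc : Continuous fun t => φ t / layerDenom ℓ α δ t :=
    hφ.continuous.div hDc fun t => (hDpos t).ne'
  have hX := hasDerivAt_weightedIntegral hφ.continuous hhc α
  have hs0 : 0 < 1 / (2 * ℓ) := by positivity
  have hderiv : ∀ t, HasDerivAt (fun s => 9 / 2 / Real.log α * driftWeight φ α s -
      2 * α / Real.log α * (1 - δ) *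
        ∫ t in (0 : ℝ)..s, t * driftWeight φ α t * (φ t / layerDenom ℓ α δ t)) _ t := fun t =>
    ((hasDerivAt_driftWeight hφ.continuous α t).const_mul (9 / 2 / Real.log α)).sub
      ((hX t).const_mul (2 * α / Real.log α * (1 - δ)))
  have hmono : MonotoneOn (fun s => 9 / 2 / Real.log α * driftWeight φ α s -
      2 * α / Real.log α * (1 - δ) *
        ∫ t in (0 : ℝ)..s, t * driftWeight φ α t * (φ t / layerDenom ℓ α δ t))
      (Icc (1 / (2 * ℓ)) s) := by
    refine monotoneOn_Icc_of_hasDerivAt (fun t _ => (hderiv t).continuousAt.continuousWithinAt)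
      (fun t _ => hderiv t) fun t ht => ?_
    have ht0 : 0 < t := hs0.trans ht.1
    have hD := half_le_layerDenom hα (by linarith) hδ.le hαℓ ht.1.le
    have hE := driftWeight_pos φ α t
    have hφ0 := hφ.nonneg t
    have h1 : (1 - δ) * (φ t / layerDenom ℓ α δ t) ≤ 2 * φ t := by
      have h2 : φ t / layerDenom ℓ α δ t ≤ 2 * φ t := by
        rw [div_le_iff₀ (hDpos t)]; nlinarith
      have h3 : 0 ≤ φ t / layerDenom ℓ α δ t := div_nonneg hφ0 (hDpos t).le
      nlinarith
    have h4 : 9 / 2 / Real.log α * (driftWeight φ α t * (α * (t * φ t))) -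
        2 * α / Real.log α * (1 - δ) * (t * driftWeight φ α t * (φ t / layerDenom ℓ α δ t)) =
        α * t * driftWeight φ α t / Real.log α *
          (9 / 2 * φ t - 2 * ((1 - δ) * (φ t / layerDenom ℓ α δ t))) := by ring
    rw [h4]
    exact mul_nonneg (by positivity) (by linarith)
  have h := hmono ⟨le_rfl, hs⟩ ⟨hs, le_rfl⟩ hs
  have hin := weightedIntegral_inner_le hφ hα hδ hδL ⟨hs0.le, le_rfl⟩
  have hD := half_le_layerDenom hα (by linarith) hδ.le hαℓ (le_refl (1 / (2 * ℓ)))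
  have hsl := mul_layerSlope_le hα0 (1 / (2 * ℓ))
  have hE := driftWeight_pos φ α (1 / (2 * ℓ))
  simp only at h
  have h5 : driftWeight φ α (1 / (2 * ℓ)) / layerDenom ℓ α δ (1 / (2 * ℓ)) ≤
      2 * driftWeight φ α (1 / (2 * ℓ)) := by
    rw [div_le_iff₀ (hDpos _)]; nlinarith
  have h6 : 2 / Real.log α * (1 / (2 * ℓ) * layerSlope α (1 / (2 * ℓ))) *
      (driftWeight φ α (1 / (2 * ℓ)) / layerDenom ℓ α δ (1 / (2 * ℓ))) ≤
      2 / Real.log α * (9 / 8) * (2 * driftWeight φ α (1 / (2 * ℓ))) :=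
    mul_le_mul (mul_le_mul_of_nonneg_left hsl (by positivity)) h5
      (div_nonneg hE.le (hDpos _).le) (by positivity)
  have h7 : 2 / Real.log α * (9 / 8) * (2 * driftWeight φ α (1 / (2 * ℓ))) =
      9 / 2 / Real.log α * driftWeight φ α (1 / (2 * ℓ)) := by ring
  linarith

/-- The pointwise supersolution inequality. -/
theorem radialSlope_layer_le (hφ : LinearlyBoundedProfile ℓ φ) (hψ : LinearlyBoundedProfile ℓ ψ)
    (hα : 1 < α) (hδ : 0 < δ) (hδ1 : δ < 1) (hαℓ : 16 * ℓ ^ 4 ≤ α)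
    (hδL : 14 + 36 * ℓ ≤ δ ^ 2 * Real.log α) {m s : ℝ} (hs : s ∈ Ioo (0 : ℝ) 1) (hm0 : 0 ≤ m)
    (hm : ∀ t ∈ Icc 0 s, ψ t ≤ m * φ t) :
    2 * α / Real.log α * (1 - δ) *
        (s * radialSlope φ α (fun t => ψ t / layerDenom ℓ α δ t) s) ≤
      (2 * layerSlope α s + 6 * ℓ) / Real.log α / layerDenom ℓ α δ s +
        9 * ℓ / Real.log α * m := by
  have hℓ := hφ.one_le
  have hα0 : 0 ≤ α := by linarith
  have hL := Real.log_pos hα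
  have hDc := continuous_layerDenom hα0 ℓ δ
  have hDpos : ∀ t, 0 < layerDenom ℓ α δ t := fun t =>
    hδ.trans_le (le_layerDenom hα (by linarith) δ t)
  have hE := driftWeight_pos φ α s
  have hφD : Continuous fun t => φ t / layerDenom ℓ α δ t :=
    hφ.continuous.div hDc fun t => (hDpos t).ne'
  have hψD : Continuous fun t => ψ t / layerDenom ℓ α δ t :=
    hψ.continuous.div hDc fun t => (hDpos t).ne'
  have hs0 := hs.1
  -- The integral bounds carry `φ` in the source; this passes to `ψ` at the cost of a bound for
  -- `ψ/φ` on `[0,s]`.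
  have hcomp : ∀ c, (∀ t ∈ Icc 0 s, ψ t ≤ c * φ t) →
      radialSlope φ α (fun t => ψ t / layerDenom ℓ α δ t) s ≤
        c * radialSlope φ α (fun t => φ t / layerDenom ℓ α δ t) s := by
    intro c hc
    rw [← radialSlope_const_mul]
    refine radialSlope_mono hφ.continuous hψD (continuous_const.mul hφD) α hs0.le fun t ht => ?_
    change ψ t / layerDenom ℓ α δ t ≤ c * (φ t / layerDenom ℓ α δ t)
    rw [← mul_div_assoc]
    exact div_le_div_of_nonneg_right (hc t ht) (hDpos t).le
  set μ := 2 * α / Real.log α * (1 - δ) with hμ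
  have hμ0 : 0 ≤ μ := mul_nonneg (by positivity) (by linarith)
  set k := radialSlope φ α (fun t => φ t / layerDenom ℓ α δ t) s with hk
  have hsq := sq_mul_radialSlope φ (fun t => φ t / layerDenom ℓ α δ t) α s
  rw [← hk, eq_div_iff hE.ne'] at hsq
  have hslope0 := layerSlope_nonneg hα0 hs0.le
  rcases le_total s (1 / (2 * ℓ)) with hle | hle
  · have hin := weightedIntegral_inner_le hφ hα hδ hδL ⟨hs0.le, hle⟩
    rw [← hμ, ← hsq] at hin
    have hk1 : μ * (s * k) ≤ 2 / Real.log α * layerSlope α s / layerDenom ℓ α δ s := by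
      have h1 : s * driftWeight φ α s * (μ * (s * k)) ≤ s * driftWeight φ α s *
          (2 / Real.log α * layerSlope α s / layerDenom ℓ α δ s) := by
        calc _ = μ * (s ^ 2 * k * driftWeight φ α s) := by ring
          _ ≤ _ := hin
          _ = _ := by ring
      exact le_of_mul_le_mul_left h1 (mul_pos hs0 hE)
    have hℓs : ℓ * s ≤ 1 / 2 := by
      have := mul_le_mul_of_nonneg_left hle (by linarith : 0 ≤ ℓ)
      rwa [show ℓ * (1 / (2 * ℓ)) = 1 / 2 by field_simp] at this
    have hℓs0 : 0 ≤ ℓ * s := by positivity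
    -- For `ℓs ≤ 1/2` one has `(1 + 2ℓs)(1 - ℓs) ≥ 1`. The extra term `4ℓ sσ ≤ (9/2)ℓ` is paid for
    -- by the `6ℓ|s|` in `D`.
    have h2 := hcomp (1 + 2 * ℓ * s) fun t ht => by
      have h3 := hψ.le_one ht.1
      have h4 := hφ.lower s hs0.le
      have h5 := hφ.antitone ht.2
      have h6 : 1 - ℓ * s ≤ φ t := h4.trans h5
      nlinarith
    have h3 : μ * (s * radialSlope φ α (fun t => ψ t / layerDenom ℓ α δ t) s) ≤
        (1 + 2 * ℓ * s) * (μ * (s * k)) := by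
      have := mul_le_mul_of_nonneg_left h2 (mul_nonneg hμ0 hs0.le)
      linarith
    have h4 : (1 + 2 * ℓ * s) * (μ * (s * k)) ≤ (1 + 2 * ℓ * s) *
        (2 / Real.log α * layerSlope α s / layerDenom ℓ α δ s) :=
      mul_le_mul_of_nonneg_left hk1 (by linarith)
    have h5 : (1 + 2 * ℓ * s) * (2 / Real.log α * layerSlope α s / layerDenom ℓ α δ s) ≤
        (2 * layerSlope α s + 6 * ℓ) / Real.log α / layerDenom ℓ α δ s := by
      have h6 : (1 + 2 * ℓ * s) * (2 / Real.log α * layerSlope α s / layerDenom ℓ α δ s) =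
          (2 * layerSlope α s + 4 * ℓ * (s * layerSlope α s)) / Real.log α /
            layerDenom ℓ α δ s := by ring
      rw [h6]
      have h7 := mul_layerSlope_le hα0 s
      have h8 : 4 * ℓ * (s * layerSlope α s) ≤ 6 * ℓ := by nlinarith
      have := hDpos s
      gcongr
    have h6 : 0 ≤ 9 * ℓ / Real.log α * m := by positivity
    linarith
  · have hout := weightedIntegral_outer_le hφ hα hδ hαℓ hδL hle
    rw [← hμ, ← hsq] at hout
    have hk1 : μ * (s * k) ≤ 9 * ℓ / Real.log α := by
      have hℓs : 1 ≤ 2 * (ℓ * s) := by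
        rw [div_le_iff₀ (by positivity)] at hle; linarith
      have h1 : s * driftWeight φ α s * (μ * (s * k)) ≤ s * driftWeight φ α s *
          (9 * ℓ / Real.log α) := by
        calc _ = μ * (s ^ 2 * k * driftWeight φ α s) := by ring
          _ ≤ _ := hout
          _ ≤ 9 / 2 / Real.log α * driftWeight φ α s * (2 * (ℓ * s)) :=
            le_mul_of_one_le_right (by positivity) hℓs
          _ = _ := by ring
      exact le_of_mul_le_mul_left h1 (mul_pos hs0 hE)
    have h2 := mul_le_mul_of_nonneg_left (hcomp m hm) (mul_nonneg hμ0 hs0.le)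
    have h3 := mul_le_mul_of_nonneg_left hk1 hm0
    have h4 : 0 ≤ (2 * layerSlope α s + 6 * ℓ) / Real.log α / layerDenom ℓ α δ s := by
      have := hDpos s; positivity
    linarith

/-- By induction the bound gives `e^u ≤ D(1) e^K / D`, with `K` the full integral correction. The
hypothesis on `lam` turns the next source into at most `(2α / log α)(1 - δ) ψ/D`, and integrating
`radialSlope_layer_le` closes the induction. -/
theorem gelfandIter_le_layer (hφ : LinearlyBoundedProfile ℓ φ)
    (hψ : LinearlyBoundedProfile ℓ ψ) (hα : 1 < α) (hδ : 0 < δ) (hδ1 : δ < 1)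
    (hαℓ : 16 * ℓ ^ 4 ≤ α) (hδL : 14 + 36 * ℓ ≤ δ ^ 2 * Real.log α)
    (hM0 : ∀ s ∈ Ioo (0 : ℝ) 1, 0 ≤ M s)
    (hM : ∀ s ∈ Ioo (0 : ℝ) 1, ∀ t ∈ Icc 0 s, ψ t ≤ M s * φ t)
    (hMi : IntegrableOn M (Ioo 0 1)) (hlam : 0 ≤ lam)
    (hlamle : lam * (layerDenom ℓ α δ 1 *
      Real.exp (9 * ℓ / Real.log α * ∫ s in (0 : ℝ)..1, M s)) ≤
        2 * α / Real.log α * (1 - δ)) (n : ℕ) :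
    ∀ r ∈ Icc (0 : ℝ) 1, gelfandIter φ ψ α lam n r ≤
      Real.log (layerDenom ℓ α δ 1) - Real.log (layerDenom ℓ α δ r) +
        9 * ℓ / Real.log α * ∫ s in r..1, M s := by
  have hℓ := hφ.one_le
  have hα0 : 0 ≤ α := by linarith
  have hL := Real.log_pos hα
  have hDc := continuous_layerDenom hα0 ℓ δ
  have hDpos : ∀ t, 0 < layerDenom ℓ α δ t := fun t =>
    hδ.trans_le (le_layerDenom hα (by linarith) δ t)
  have hMint : ∀ r ∈ Icc (0 : ℝ) 1, IntervalIntegrable M volume r 1 := fun r hr => by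
    rw [intervalIntegrable_iff_integrableOn_Ioo_of_le hr.2]
    exact hMi.mono_set (Ioo_subset_Ioo_left hr.1)
  have hder : ∀ r ∈ Icc (0 : ℝ) 1, ∫ s in r..1,
      (2 * layerSlope α s + 6 * ℓ) / Real.log α / layerDenom ℓ α δ s =
      Real.log (layerDenom ℓ α δ 1) - Real.log (layerDenom ℓ α δ r) ∧
      IntervalIntegrable (fun s => (2 * layerSlope α s + 6 * ℓ) / Real.log α /
        layerDenom ℓ α δ s) volume r 1 := by
    intro r hr
    have hc : Continuous fun s => (2 * layerSlope α s + 6 * ℓ) / Real.log α /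
        layerDenom ℓ α δ s := by
      have := continuous_layerSlope hα0
      exact Continuous.div (by fun_prop) hDc fun t => (hDpos t).ne'
    refine ⟨intervalIntegral.integral_eq_sub_of_hasDerivAt_of_le
      (f := fun s => Real.log (layerDenom ℓ α δ s)) hr.2
      (hDc.log fun t => (hDpos t).ne').continuousOn (fun s hs => ?_)
      (hc.intervalIntegrable _ _), hc.intervalIntegrable _ _⟩
    exact (hasDerivAt_layerDenom hα0 ℓ δ (hr.1.trans_lt hs.1)).log (hDpos s).ne'
  have hMmono : ∀ r ∈ Icc (0 : ℝ) 1, 0 ≤ ∫ s in r..1, M s ∧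
      ∫ s in r..1, M s ≤ ∫ s in (0 : ℝ)..1, M s := by
    intro r hr
    have hnn : ∀ᵐ s ∂(volume.restrict (Ioc (0 : ℝ) 1)), 0 ≤ M s := by
      rw [← Measure.restrict_congr_set Ioo_ae_eq_Ioc]
      exact (ae_restrict_iff' measurableSet_Ioo).2 (Eventually.of_forall hM0)
    refine ⟨?_, intervalIntegral.integral_mono_interval hr.1 hr.2 le_rfl hnn
      (hMint 0 ⟨le_rfl, zero_le_one⟩)⟩
    rw [intervalIntegral.integral_of_le hr.2]
    exact integral_nonneg_of_ae (ae_restrict_of_ae_restrict_of_subset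
      (Ioc_subset_Ioc_left hr.1) hnn)
  induction n with
  | zero =>
    intro r hr
    rw [← (hder r hr).1]
    have h1 : 0 ≤ ∫ s in r..1, (2 * layerSlope α s + 6 * ℓ) / Real.log α /
        layerDenom ℓ α δ s := by
      refine intervalIntegral.integral_nonneg hr.2 fun s hs => ?_
      have := hDpos s
      have := layerSlope_nonneg hα0 (hr.1.trans hs.1)
      positivity
    have h2 : 0 ≤ 9 * ℓ / Real.log α * ∫ s in r..1, M s :=
      mul_nonneg (by positivity) (hMmono r hr).1
    exact add_nonneg h1 h2
  | succ n ih =>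
    intro r hr
    have hψD : Continuous fun t => ψ t / layerDenom ℓ α δ t :=
      hψ.continuous.div hDc fun t => (hDpos t).ne'
    have hsrc := continuous_gelfandSource hψ.continuous
      (continuous_gelfandIter hφ.continuous hψ.continuous α lam n) lam
    have hle : ∀ t ∈ Icc (0 : ℝ) 1, gelfandSource ψ lam (gelfandIter φ ψ α lam n) t ≤
        2 * α / Real.log α * (1 - δ) * (ψ t / layerDenom ℓ α δ t) := by
      intro t ht
      set K := 9 * ℓ / Real.log α * ∫ s in (0 : ℝ)..1, M s
      have h1 : Real.exp (gelfandIter φ ψ α lam n t) ≤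
          layerDenom ℓ α δ 1 / layerDenom ℓ α δ t * Real.exp K := by
        rw [← Real.exp_log (div_pos (hDpos 1) (hDpos t)), ← Real.exp_add,
          Real.log_div (hDpos 1).ne' (hDpos t).ne']
        refine Real.exp_le_exp.2 ((ih t ht).trans ?_)
        have := mul_le_mul_of_nonneg_left (hMmono t ht).2
          (by positivity : 0 ≤ 9 * ℓ / Real.log α)
        linarith
      have hψ0 := hψ.nonneg t
      have hDt := hDpos t
      calc lam * ψ t * Real.exp (gelfandIter φ ψ α lam n t)
          ≤ lam * ψ t * (layerDenom ℓ α δ 1 / layerDenom ℓ α δ t * Real.exp K) :=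
            mul_le_mul_of_nonneg_left h1 (mul_nonneg hlam hψ0)
        _ = lam * (layerDenom ℓ α δ 1 * Real.exp K) * (ψ t / layerDenom ℓ α δ t) := by ring
        _ ≤ _ := mul_le_mul_of_nonneg_right hlamle (by positivity)
    rw [← (hder r hr).1, ← intervalIntegral.integral_const_mul,
      ← intervalIntegral.integral_add (hder r hr).2 ((hMint r hr).const_mul _)]
    refine intervalIntegral.integral_mono_on_of_le_Ioo hr.2
      ((continuous_id.mul (continuous_radialSlope hφ.continuous hsrc α)).intervalIntegrable _ _)
      ((hder r hr).2.add ((hMint r hr).const_mul _)) fun s hs => ?_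
    have hs' : s ∈ Ioo (0 : ℝ) 1 := ⟨hr.1.trans_lt hs.1, hs.2⟩
    have h1 := radialSlope_mono
      (g := fun t => 2 * α / Real.log α * (1 - δ) * (ψ t / layerDenom ℓ α δ t))
      hφ.continuous hsrc (continuous_const.mul hψD) α hs'.1.le
      fun t ht => hle t ⟨ht.1, ht.2.trans hs'.2.le⟩
    rw [radialSlope_const_mul] at h1
    have h2 := mul_le_mul_of_nonneg_left h1 hs'.1.le
    have h3 := radialSlope_layer_le hφ hψ hα hδ hδ1 hαℓ hδL hs' (hM0 s hs') (hM s hs')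
    linarith

/-- Solvability below the leading-order critical value. -/
theorem exists_classical_of_layer (hφ : LinearlyBoundedProfile ℓ φ)
    (hψ : LinearlyBoundedProfile ℓ ψ) (hα : 1 < α) (hδ : 0 < δ) (hδ1 : δ < 1)
    (hαℓ : 16 * ℓ ^ 4 ≤ α) (hδL : 14 + 36 * ℓ ≤ δ ^ 2 * Real.log α)
    (hM0 : ∀ s ∈ Ioo (0 : ℝ) 1, 0 ≤ M s)
    (hM : ∀ s ∈ Ioo (0 : ℝ) 1, ∀ t ∈ Icc 0 s, ψ t ≤ M s * φ t)
    (hMi : IntegrableOn M (Ioo 0 1)) (hlam : 0 < lam)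
    (hlamle : lam * (layerDenom ℓ α δ 1 *
      Real.exp (9 * ℓ / Real.log α * ∫ s in (0 : ℝ)..1, M s)) ≤
        2 * α / Real.log α * (1 - δ)) :
    ∃ u, IsClassicalSolution φ ψ Real.exp α lam u := by
  have hb : ∀ n, ∀ r ∈ Icc (0 : ℝ) 1, gelfandIter φ ψ α lam n r ≤ gelfandIter φ ψ α lam n 0 := by
    intro n r hr
    cases n with
    | zero => exact le_rfl
    | succ n =>
      exact radialSolve_antitoneOn hφ.continuous (continuous_gelfandSource hψ.continuous
        (continuous_gelfandIter hφ.continuous hψ.continuous α lam n) lam) α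
        (fun t _ => gelfandSource_nonneg hψ.nonneg hlam.le _ t) ⟨le_rfl, zero_le_one⟩ hr hr.1
  obtain ⟨u, hu, -⟩ := exists_isRadialSolution_of_bounded hφ hψ (by linarith) hlam.le
    fun n r hr => (hb n r hr).trans (gelfandIter_le_layer hφ hψ hα hδ hδ1 hαℓ hδL hM0 hM hMi
      hlam.le hlamle n 0 ⟨le_rfl, zero_le_one⟩)
  exact ⟨_, hu.isClassicalSolution hφ.continuous hψ hlam⟩

end Supersolution

/-! ### Asymptotics of the critical value. -/

section Asymptotics

variable {φ ψ M : ℝ → ℝ} {ℓ : ℝ}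

theorem log_one_add_le {α : ℝ} (hα : 1 ≤ α) : Real.log (1 + α) ≤ Real.log α + 1 := by
  have h1 : Real.log (1 + α) ≤ Real.log (α * 2) := Real.log_le_log (by linarith) (by linarith)
  rw [Real.log_mul (by linarith) (by norm_num)] at h1
  have := Real.log_two_lt_d9
  linarith

/-- The left side is at most `e^{-2Ax} ≤ 1/(1 + 2Ax)`, which is at most `1 - Ax` when `2Ax ≤ 1`. It
is used with `x = 1/√(log α)` to check the parameter condition with `δ = Ax`. -/
theorem one_sub_mul_one_add_mul_exp_le {A B a κ x : ℝ} (hA : 0 ≤ A) (hx : 0 ≤ x)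
    (hAx : 2 * A * x ≤ 1) (hax : 0 ≤ 1 + a * x) (hB : a + κ + 2 * A ≤ B) :
    (1 - B * x) * ((1 + a * x) * Real.exp (κ * x)) ≤ 1 - A * x := by
  have h1 : 1 - B * x ≤ Real.exp (-(B * x)) := by
    have := Real.add_one_le_exp (-(B * x)); linarith
  have h2 : 1 + a * x ≤ Real.exp (a * x) := by
    have := Real.add_one_le_exp (a * x); linarith
  have h3 : (1 - B * x) * ((1 + a * x) * Real.exp (κ * x)) ≤
      Real.exp (-(B * x)) * (Real.exp (a * x) * Real.exp (κ * x)) := by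
    have h4 : 0 ≤ (1 + a * x) * Real.exp (κ * x) := mul_nonneg hax (Real.exp_pos _).le
    exact mul_le_mul h1 (mul_le_mul_of_nonneg_right h2 (Real.exp_pos _).le) h4
      (Real.exp_pos _).le
  rw [← Real.exp_add, ← Real.exp_add] at h3
  have h5 : Real.exp (-(B * x) + (a * x + κ * x)) ≤ Real.exp (-(2 * A * x)) :=
    Real.exp_le_exp.2 (by nlinarith)
  have h6 : Real.exp (-(2 * A * x)) ≤ 1 - A * x := by
    rw [Real.exp_neg, inv_le_comm₀ (Real.exp_pos _) (by linarith)]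
    have h7 : 1 + 2 * A * x ≤ Real.exp (2 * A * x) := by
      have := Real.add_one_le_exp (2 * A * x); linarith
    refine le_trans ?_ h7
    have h8 : 0 < 1 - A * x := by linarith
    rw [inv_le_iff_one_le_mul₀ h8]
    have : 0 ≤ A * x := mul_nonneg hA hx
    nlinarith
  linarith

/-- Solvability at the leading order of the critical value, up to `1/√log α`. -/
theorem eventually_solvable (hφ : LinearlyBoundedProfile ℓ φ) (hψ : LinearlyBoundedProfile ℓ ψ)
    (hM0 : ∀ s ∈ Ioo (0 : ℝ) 1, 0 ≤ M s)
    (hM : ∀ s ∈ Ioo (0 : ℝ) 1, ∀ t ∈ Icc 0 s, ψ t ≤ M s * φ t)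
    (hMi : IntegrableOn M (Ioo 0 1)) :
    ∃ B : ℝ, 0 < B ∧ ∀ᶠ α : ℝ in atTop, B * (1 / √(Real.log α)) ≤ 1 / 2 ∧
      ∃ u, IsClassicalSolution φ ψ Real.exp α
        (2 * α / Real.log α * (1 - B * (1 / √(Real.log α)))) u := by
  have hℓ := hφ.one_le
  -- The smallest constant for which `δ = A / √(log α)` meets the absorption condition.
  set A := √(14 + 36 * ℓ) with hA
  have hA0 : 0 < A := Real.sqrt_pos.2 (by linarith)
  have hAsq : A ^ 2 = 14 + 36 * ℓ := Real.sq_sqrt (by linarith)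
  set I := ∫ s in (0 : ℝ)..1, M s with hI
  have hI0 : 0 ≤ I := by
    rw [hI, intervalIntegral.integral_of_le zero_le_one, integral_Ioc_eq_integral_Ioo]
    exact setIntegral_nonneg measurableSet_Ioo hM0
  -- Here `A + 3 + 6ℓ` comes from the bound on `D(1)`, `9ℓI` from the exponential correction, and
  -- `2A` from the target factor `1 - Ax`.
  set B := A + 3 + 6 * ℓ + 9 * ℓ * I + 2 * A with hB
  have hB0 : 0 < B := by positivity
  have hxlim : Tendsto (fun α : ℝ => B * (1 / √(Real.log α))) atTop (𝓝 0) := by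
    have h1 : Tendsto (fun α : ℝ => √(Real.log α)) atTop atTop :=
      Real.tendsto_sqrt_atTop.comp Real.tendsto_log_atTop
    simpa using h1.inv_tendsto_atTop.const_mul B
  refine ⟨B, hB0, ?_⟩
  filter_upwards [hxlim.eventually (gt_mem_nhds (by norm_num : (0 : ℝ) < 1 / 2)),
    eventually_gt_atTop 1, eventually_ge_atTop (16 * ℓ ^ 4)] with α hBx hα hαℓ
  refine ⟨hBx.le, ?_⟩
  have hL := Real.log_pos hα
  set L := Real.log α with hLdef
  set x := 1 / √L with hx
  have hx0 : 0 < x := by positivity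
  have hx2 : x ^ 2 = 1 / L := by rw [hx, div_pow, Real.sq_sqrt hL.le, one_pow]
  have hAB : 2 * A ≤ B := by
    have : 0 ≤ A + 3 + 6 * ℓ + 9 * ℓ * I := by positivity
    linarith
  have hAx : 2 * A * x ≤ 1 / 2 := (mul_le_mul_of_nonneg_right hAB hx0.le).trans hBx.le
  have hx1 : x ≤ 1 := by
    have : 1 ≤ B := by
      have : 0 ≤ A + 6 * ℓ + 9 * ℓ * I + 2 * A := by positivity
      linarith
    nlinarith
  have hα0 : 0 < α := by linarith
  refine exists_classical_of_layer hφ hψ hα (δ := A * x) (by positivity) (by linarith) hαℓ ?_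
    hM0 hM hMi (by have : 0 < 1 - B * x := by linarith
                   positivity) ?_
  · rw [mul_pow, hAsq, hx2]
    have : (14 + 36 * ℓ) * (1 / L) * L = 14 + 36 * ℓ := by field_simp
    exact this.ge
  · have hD : layerDenom ℓ α (A * x) 1 ≤ 1 + (A + 3 + 6 * ℓ) * x := by
      have h1 := log_one_add_le hα.le
      have h2 : 2 * α / (1 + α) ≤ 2 := by rw [div_le_iff₀ (by linarith)]; linarith
      have h3 : (Real.log (1 + α) + 2 * α / (1 + α) + 6 * ℓ) / L ≤ 1 + (3 + 6 * ℓ) * x := by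
        have h4 : (Real.log (1 + α) + 2 * α / (1 + α) + 6 * ℓ) / L ≤ (L + (3 + 6 * ℓ)) / L :=
          div_le_div_of_nonneg_right (by linarith) hL.le
        have h5 : (L + (3 + 6 * ℓ)) / L = 1 + (3 + 6 * ℓ) * x ^ 2 := by
          rw [hx2]; field_simp
        have h6 : x ^ 2 ≤ x := by nlinarith
        have h7 := mul_le_mul_of_nonneg_left h6 (by linarith : 0 ≤ 3 + 6 * ℓ)
        linarith
      have h8 : layerDenom ℓ α (A * x) 1 =
          A * x + (Real.log (1 + α) + 2 * α / (1 + α) + 6 * ℓ) / L := by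
        simp [layerDenom, hLdef]
      rw [h8]; linarith
    have hK : Real.exp (9 * ℓ / L * I) ≤ Real.exp (9 * ℓ * I * x) := by
      refine Real.exp_le_exp.2 ?_
      have h1 : 9 * ℓ / L * I = 9 * ℓ * I * x ^ 2 := by rw [hx2]; ring
      have h6 : x ^ 2 ≤ x := by nlinarith
      rw [h1]
      exact mul_le_mul_of_nonneg_left h6 (by positivity)
    have hprod : layerDenom ℓ α (A * x) 1 * Real.exp (9 * ℓ / L * I) ≤
        (1 + (A + 3 + 6 * ℓ) * x) * Real.exp (9 * ℓ * I * x) :=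
      mul_le_mul hD hK (Real.exp_pos _).le (by positivity)
    have hmain := one_sub_mul_one_add_mul_exp_le (A := A) (B := B) (a := A + 3 + 6 * ℓ)
      (κ := 9 * ℓ * I) hA0.le hx0.le (by linarith) (by positivity) (by rw [hB])
    have h9 : 0 ≤ 1 - B * x := by linarith
    have h10 := (mul_le_mul_of_nonneg_left hprod h9).trans hmain
    rw [mul_assoc]
    exact mul_le_mul_of_nonneg_left h10 (by positivity)

theorem log_sub_le_log_one_add_half {α : ℝ} (hα : 0 < α) :
    Real.log α - 1 ≤ Real.log (1 + α / 2) := by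
  have h1 : Real.log (α / 2) ≤ Real.log (1 + α / 2) :=
    Real.log_le_log (by linarith) (by linarith)
  rw [Real.log_div hα.ne' (by norm_num)] at h1
  have := Real.log_two_lt_d9
  linarith

/-- Upper bound for the parameters of solvability. -/
theorem le_of_isClassicalSolution (hφ : LinearlyBoundedProfile ℓ φ)
    (hψ : LinearlyBoundedProfile ℓ ψ) {α lam : ℝ} (hα : 1 < α)
    (hαℓ : 2 * (1 + 2 * ℓ) ≤ Real.log α) (hlam : 0 < lam) {v : Plane → ℝ}
    (hv : IsClassicalSolution φ ψ Real.exp α lam v) :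
    lam ≤ 2 * α / Real.log α * (1 + 2 * (1 + 2 * ℓ) / Real.log α) := by
  have hℓ := hφ.one_le
  have hα0 : 0 < α := by linarith
  obtain ⟨u, hu, -⟩ := exists_minimal_of_classical hφ hψ hα0.le hlam le_rfl hv
  have h1 := hu.exp_neg_ge hφ hψ hα0 hlam.le ⟨zero_le_one, le_rfl⟩
  rw [hu.apply_one] at h1
  simp only [neg_zero, Real.exp_zero, one_pow, mul_one] at h1
  have h2 := Real.exp_pos (-u 0)
  have h3 := log_sub_le_log_one_add_half hα0
  set L := Real.log α
  have hL : 0 < L := by linarith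
  have h4 : lam / α * ((L - 1) / 2 - ℓ) ≤ lam / α * (Real.log (1 + α / 2) / 2 - ℓ) :=
    mul_le_mul_of_nonneg_left (by linarith) (by positivity)
  have h5 : lam * (L - (1 + 2 * ℓ)) ≤ 2 * α := by
    have h6 : lam / α * ((L - 1) / 2 - ℓ) ≤ 1 := by linarith
    have h7 := mul_le_mul_of_nonneg_left h6 (by linarith : 0 ≤ 2 * α)
    have h8 : 2 * α * (lam / α * ((L - 1) / 2 - ℓ)) = lam * (L - (1 + 2 * ℓ)) := by
      field_simp; ring
    linarith
  set c := 1 + 2 * ℓ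
  have hc : 0 < c := by positivity
  have h9 : lam ≤ 2 * α / (L - c) := by rw [le_div_iff₀ (by linarith)]; exact h5
  refine h9.trans ?_
  have h10 : 2 * α / L * (1 + 2 * c / L) = 2 * α * (L + 2 * c) / L ^ 2 := by field_simp
  rw [h10, div_le_div_iff₀ (by linarith) (by positivity)]
  nlinarith [mul_nonneg (mul_nonneg hα0.le hc.le) (by linarith : 0 ≤ L - 2 * c)]

/-- Existence and quantitative properties of the extremal solution for large drift. -/
theorem eventually_exists_extremal (hφ : LinearlyBoundedProfile ℓ φ)
    (hψ : LinearlyBoundedProfile ℓ ψ) (hM0 : ∀ s ∈ Ioo (0 : ℝ) 1, 0 ≤ M s)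
    (hM : ∀ s ∈ Ioo (0 : ℝ) 1, ∀ t ∈ Icc 0 s, ψ t ≤ M s * φ t)
    (hMi : IntegrableOn M (Ioo 0 1)) :
    ∃ B : ℝ, 0 < B ∧ ∀ᶠ α : ℝ in atTop,
      0 < criticalValue φ ψ Real.exp α ∧
      |criticalValue φ ψ Real.exp α / (2 * α / Real.log α) - 1| ≤ B * (1 / √(Real.log α)) ∧
      ∃ u, IsRadialSolution φ ψ α (criticalValue φ ψ Real.exp α) u ∧
        (IsExtremalSolution φ ψ Real.exp α fun x => u ‖x‖) ∧
        u 0 ≤ 3 * Real.log (40 * Real.log α) ∧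
        (1 - B * (1 / √(Real.log α))) *
          (1 - (4 * Real.log (Real.log α) + 1 + 2 * ℓ) / Real.log α) ≤
            Real.exp (-u (1 / Real.log α ^ 2)) := by
  have hℓ := hφ.one_le
  obtain ⟨B₀, hB₀, hsolv⟩ := eventually_solvable hφ hψ hM0 hM hMi
  set B := B₀ + 2 * (1 + 2 * ℓ) with hB
  refine ⟨B, by positivity, ?_⟩
  -- Ensures that the last factor of the outer estimate is positive, so that inequalities for the
  -- parameter may be multiplied by it.
  have hloglim : Tendsto (fun L : ℝ => (4 * Real.log L + 1 + 2 * ℓ) / L) atTop (𝓝 0) := by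
    have h1 : Tendsto (fun L : ℝ => Real.log L / L) atTop (𝓝 0) :=
      Real.isLittleO_log_id_atTop.tendsto_div_nhds_zero
    have h2 : Tendsto (fun L : ℝ => (1 + 2 * ℓ) / L) atTop (𝓝 0) :=
      tendsto_const_nhds.div_atTop tendsto_id
    have h3 := (h1.const_mul 4).add h2
    simp only [mul_zero, add_zero] at h3
    exact h3.congr fun L => by ring
  filter_upwards [hsolv, eventually_gt_atTop 1, eventually_ge_atTop (20 * ℓ ^ 2),
    Real.tendsto_log_atTop.eventually_ge_atTop (2 * (1 + 2 * ℓ)),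
    (hloglim.comp Real.tendsto_log_atTop).eventually (gt_mem_nhds one_pos)]
    with α hs hα hα2 hL2 hll
  obtain ⟨hBx, hsol⟩ := hs
  have hα0 : 0 < α := by linarith
  simp only [Function.comp_apply] at hll
  set L := Real.log α with hLdef
  have hL1 : 1 ≤ L := by linarith
  have hL0 : 0 < L := by linarith
  set x := 1 / √L with hx
  have hx0 : 0 < x := by positivity
  have hx2 : x ^ 2 = 1 / L := by rw [hx, div_pow, Real.sq_sqrt hL0.le, one_pow]
  have hx1 : x ≤ 1 := by
    rw [hx, div_le_one (by positivity)]; exact Real.one_le_sqrt.2 hL1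
  set lam₀ := 2 * α / L * (1 - B₀ * x) with hlam₀
  have hlam₀α : α / L ≤ lam₀ := by
    have h1 : 2 * α / L * (1 / 2) ≤ 2 * α / L * (1 - B₀ * x) :=
      mul_le_mul_of_nonneg_left (by linarith) (by positivity)
    have h2 : 2 * α / L * (1 / 2) = α / L := by ring
    rw [hlam₀]; linarith
  have hlam₀0 : 0 < lam₀ := lt_of_lt_of_le (by positivity) hlam₀α
  have hub : ∀ lam ∈ {lam : ℝ | 0 < lam ∧ ∃ u, IsClassicalSolution φ ψ Real.exp α lam u},
      lam ≤ 2 * α / L * (1 + 2 * (1 + 2 * ℓ) / L) := fun lam ⟨h0, v, hv⟩ =>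
    le_of_isClassicalSolution hφ hψ hα hL2 h0 hv
  have hbdd : BddAbove {lam : ℝ | 0 < lam ∧ ∃ u, IsClassicalSolution φ ψ Real.exp α lam u} :=
    ⟨_, hub⟩
  have hcle : criticalValue φ ψ Real.exp α ≤ 2 * α / L * (1 + 2 * (1 + 2 * ℓ) / L) :=
    csSup_le ⟨lam₀, hlam₀0, hsol⟩ hub
  have hcge : lam₀ ≤ criticalValue φ ψ Real.exp α := le_csSup hbdd ⟨hlam₀0, hsol⟩
  -- The radius on which the drift is negligible; `α ≥ 20ℓ²` is exactly what `ℓR ≤ 1/10` requires.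
  set R := √(1 / (5 * α)) with hR
  have hR2 : R ^ 2 = 1 / (5 * α) := Real.sq_sqrt (by positivity)
  have hR0 : 0 < R := Real.sqrt_pos.2 (by positivity)
  have hRα : α * R ^ 2 = 1 / 5 := by rw [hR2]; field_simp
  have hRℓ : ℓ * R ≤ 1 / 10 := by
    refine abs_le_of_sq_le_sq' (a := ℓ * R) (b := 1 / 10) ?_ (by norm_num) |>.2
    rw [mul_pow, hR2, mul_one_div, div_le_iff₀ (by positivity)]
    linarith
  have hR1 : R ≤ 1 := by nlinarith
  have hapriori : ∀ lam u, lam₀ ≤ lam → IsRadialSolution φ ψ α lam u →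
      u 0 ≤ 3 * Real.log (40 * L) := by
    intro lam u hle hu
    have hlam : 0 < lam := hlam₀0.trans_le hle
    refine (hu.apply_zero_le hφ hψ hα0 hlam ⟨hR0, hR1⟩ hRα hRℓ).trans ?_
    have h1 : α ≤ L * lam := by
      have := hlam₀α.trans hle
      rw [div_le_iff₀ hL0] at this; linarith
    have h2 : Real.log (40 * α / lam) ≤ Real.log (40 * L) := by
      refine Real.log_le_log (by positivity) ?_
      rw [div_le_iff₀ hlam]; linarith
    linarith
  obtain ⟨u, hu, hext⟩ := exists_extremal_of_bound hφ hψ hα0.le hbdd hlam₀0 hsol hapriori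
  have hc0 : 0 < criticalValue φ ψ Real.exp α := hlam₀0.trans_le hcge
  set lamS := criticalValue φ ψ Real.exp α with hlamS
  refine ⟨hc0, ?_, u, hu, hext, hapriori _ u hcge hu, ?_⟩
  · have hpos : 0 < 2 * α / L := by positivity
    have hx2' : 1 / L ≤ x := by rw [← hx2]; nlinarith
    rw [abs_le]
    constructor
    · have h1 : 1 - B₀ * x ≤ lamS / (2 * α / L) := by
        rw [le_div_iff₀ hpos]; linarith
      have h2 : B₀ * x ≤ B * x := mul_le_mul_of_nonneg_right (by linarith) hx0.le
      linarith
    · have h1 : lamS / (2 * α / L) ≤ 1 + 2 * (1 + 2 * ℓ) / L := by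
        rw [div_le_iff₀ hpos]; linarith
      have h2 : 2 * (1 + 2 * ℓ) / L ≤ B * x := by
        have h3 : 2 * (1 + 2 * ℓ) / L = 2 * (1 + 2 * ℓ) * (1 / L) := by ring
        rw [h3]
        exact mul_le_mul (by linarith) hx2' (by positivity) (by linarith)
      linarith
  · have hρ : 1 / L ^ 2 ∈ Icc (0 : ℝ) 1 :=
      ⟨by positivity, by rw [div_le_one (by positivity)]; exact one_le_pow₀ hL1⟩
    have h1 := hu.exp_neg_ge hφ hψ hα0 hc0.le hρ
    -- At `r = L^{-2}` one has `α r² = α / L⁴`, so the logarithm loses only `O(log L)` and remains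
    -- asymptotic to `L`.
    have h2 : L - 4 * Real.log L - 1 ≤ Real.log (1 + α * (1 / L ^ 2) ^ 2 / 2) := by
      have h3 : Real.log (α / L ^ 4 / 2) ≤ Real.log (1 + α * (1 / L ^ 2) ^ 2 / 2) := by
        refine Real.log_le_log (by positivity) ?_
        have : α * (1 / L ^ 2) ^ 2 / 2 = α / L ^ 4 / 2 := by field_simp
        rw [this]; linarith
      rw [Real.log_div (by positivity) (by norm_num), Real.log_div hα0.ne' (by positivity),
        Real.log_pow] at h3
      have := Real.log_two_lt_d9
      push_cast at h3
      linarith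
    have h4 : ℓ * (1 / L ^ 2) ≤ ℓ := mul_le_of_le_one_right (by linarith) hρ.2
    have h5 : (1 - B * x) * (1 - (4 * Real.log L + 1 + 2 * ℓ) / L) ≤
        (1 - B₀ * x) * (1 - (4 * Real.log L + 1 + 2 * ℓ) / L) := by
      refine mul_le_mul_of_nonneg_right ?_ (by linarith)
      have := mul_le_mul_of_nonneg_right (by linarith : B₀ ≤ B) hx0.le
      linarith
    have h6 : (1 - B₀ * x) * (1 - (4 * Real.log L + 1 + 2 * ℓ) / L) =
        lam₀ / α * ((L - 4 * Real.log L - 1) / 2 - ℓ) := by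
      rw [hlam₀]; field_simp; ring
    have h7 : 0 ≤ (L - 4 * Real.log L - 1) / 2 - ℓ := by
      have h8 : (1 - (4 * Real.log L + 1 + 2 * ℓ) / L) * L = L - 4 * Real.log L - 1 - 2 * ℓ := by
        field_simp; ring
      have h9 := mul_nonneg (by linarith : 0 ≤ 1 - (4 * Real.log L + 1 + 2 * ℓ) / L) hL0.le
      linarith
    have h8 : lam₀ / α * ((L - 4 * Real.log L - 1) / 2 - ℓ) ≤
        lamS / α * (Real.log (1 + α * (1 / L ^ 2) ^ 2 / 2) / 2 - ℓ * (1 / L ^ 2)) :=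
      mul_le_mul (div_le_div_of_nonneg_right hcge hα0.le) (by linarith) h7 (by positivity)
    have h9 := Real.exp_pos (-u 0)
    linarith

end Asymptotics

/-! ### Integrals over the disk. -/

/-- The disk is split at radius `ρ`, with the crude bound `a` on the small disk, whose area is a
fraction `ρ²` of the whole, and the bound `b` outside. -/
theorem integral_unitBall_le {f : Plane → ℝ} {a b ρ : ℝ} (hρ : 0 ≤ ρ) (hρ1 : ρ ≤ 1) (hb : 0 ≤ b)
    (hf0 : ∀ x ∈ Metric.ball (0 : Plane) 1, 0 ≤ f x)
    (ha : ∀ x ∈ Metric.ball (0 : Plane) 1, f x ≤ a)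
    (hfb : ∀ x ∈ Metric.ball (0 : Plane) 1, ρ ≤ ‖x‖ → f x ≤ b) :
    ∫ x in Metric.ball (0 : Plane) 1, f x ≤
      (a * ρ ^ 2 + b) * volume.real (Metric.ball (0 : Plane) 1) := by
  have ha0 : 0 ≤ a := (hf0 0 (Metric.mem_ball_self one_pos)).trans
    (ha 0 (Metric.mem_ball_self one_pos))
  have hfin : ∀ r : ℝ, volume (Metric.ball (0 : Plane) r) ≠ ⊤ := fun r =>
    measure_ball_lt_top.ne
  have hi1 : IntegrableOn ((Metric.ball (0 : Plane) ρ).indicator fun _ => a)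
      (Metric.ball (0 : Plane) 1) :=
    (integrableOn_const (hfin 1)).indicator Metric.isOpen_ball.measurableSet
  have hi2 : IntegrableOn (fun _ : Plane => b) (Metric.ball (0 : Plane) 1) :=
    integrableOn_const (hfin 1)
  have hle : ∫ x in Metric.ball (0 : Plane) 1, f x ≤
      ∫ x in Metric.ball (0 : Plane) 1, ((Metric.ball (0 : Plane) ρ).indicator (fun _ => a) x + b) := by
    refine integral_mono_of_nonneg
      ((ae_restrict_iff' Metric.isOpen_ball.measurableSet).2 (Eventually.of_forall hf0))
      (hi1.add hi2)
      ((ae_restrict_iff' Metric.isOpen_ball.measurableSet).2 (Eventually.of_forall fun x hx => ?_))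
    by_cases hxρ : x ∈ Metric.ball (0 : Plane) ρ
    · simp only [indicator_of_mem hxρ]; linarith [ha x hx]
    · simp only [indicator_of_notMem hxρ, zero_add]
      exact hfb x hx (by simpa using hxρ)
  refine hle.trans (le_of_eq ?_)
  have hvol : volume.real (Metric.ball (0 : Plane) ρ) =
      ρ ^ 2 * volume.real (Metric.ball (0 : Plane) 1) := by
    rw [Measure.real, Measure.addHaar_ball _ _ hρ]
    simp [Measure.real, ENNReal.toReal_mul, ENNReal.toReal_ofReal, hρ]
  rw [integral_add hi1 hi2, setIntegral_indicator Metric.isOpen_ball.measurableSet,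
    inter_eq_right.2 (Metric.ball_subset_ball hρ1), setIntegral_const, setIntegral_const, hvol]
  simp only [smul_eq_mul]
  ring

theorem tendsto_log_rpow_mul_inv_pow (c p : ℝ) (hc : 0 < c) :
    Tendsto (fun L : ℝ => (3 * Real.log (c * L)) ^ p * (1 / L ^ 2) ^ 2) atTop (𝓝 0) := by
  have h1 := (isLittleO_log_rpow_rpow_atTop p (zero_lt_one' ℝ)).tendsto_div_nhds_zero
  have h2 : Tendsto (fun L : ℝ => c * L) atTop atTop := tendsto_id.const_mul_atTop hc
  have h3 : Tendsto (fun L : ℝ => 3 ^ p * c * (1 / L ^ 3)) atTop (𝓝 0) := by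
    have := (tendsto_pow_atTop (α := ℝ) (n := 3) (by norm_num)).inv_tendsto_atTop.const_mul
      (3 ^ p * c)
    simpa using this
  have h4 := (h1.comp h2).mul h3
  rw [mul_zero] at h4
  refine h4.congr' ?_
  filter_upwards [eventually_gt_atTop 0, h2.eventually_gt_atTop 1] with L hL hcL
  rw [Real.mul_rpow (by norm_num) (Real.log_pos hcL).le]
  simp only [Function.comp_apply, Real.rpow_one]
  field_simp

section Limits

variable {φ ψ : ℝ → ℝ} {ℓ B : ℝ}

theorem tendsto_layer_factor (ℓ B : ℝ) :
    Tendsto (fun α : ℝ => (1 - B * (1 / √(Real.log α))) *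
      (1 - (4 * Real.log (Real.log α) + 1 + 2 * ℓ) / Real.log α)) atTop (𝓝 1) := by
  have h1 : Tendsto (fun L : ℝ => Real.log L / L) atTop (𝓝 0) :=
    Real.isLittleO_log_id_atTop.tendsto_div_nhds_zero
  have h2 : Tendsto (fun L : ℝ => (1 + 2 * ℓ) / L) atTop (𝓝 0) :=
    tendsto_const_nhds.div_atTop tendsto_id
  have h3 := (h1.const_mul 4).add h2
  have h4 : Tendsto (fun L : ℝ => B * (1 / √L)) atTop (𝓝 0) := by
    simpa using Real.tendsto_sqrt_atTop.inv_tendsto_atTop.const_mul B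
  have h5 := ((tendsto_const_nhds (x := (1 : ℝ))).sub h4).mul
    ((tendsto_const_nhds (x := (1 : ℝ))).sub h3)
  simp only [mul_zero, add_zero, sub_zero, mul_one] at h5
  refine (h5.comp Real.tendsto_log_atTop).congr fun α => ?_
  simp only [Function.comp_apply]
  ring

/-- Smallness away from the origin together with a logarithmic bound give convergence of all the
integrals. -/
theorem tendsto_integrals_of_bounds (hψ : LinearlyBoundedProfile ℓ ψ)
    {w : ℝ → Plane → ℝ} {η : ℝ → ℝ} (hη : Tendsto η atTop (𝓝 1))
    (hw : ∀ᶠ α : ℝ in atTop, ∃ u : ℝ → ℝ, Continuous u ∧ AntitoneOn u (Icc 0 1) ∧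
      (∀ r ∈ Icc (0 : ℝ) 1, 0 ≤ u r) ∧ (∀ x ∈ Metric.ball (0 : Plane) 1, w α x = u ‖x‖) ∧
      u 0 ≤ 3 * Real.log (40 * Real.log α) ∧ η α ≤ Real.exp (-u (1 / Real.log α ^ 2))) :
    (∀ p : ℝ, 1 ≤ p →
      Tendsto (fun α : ℝ => ∫ x in Metric.ball (0 : Plane) 1, (w α x) ^ p) atTop (𝓝 0)) ∧
    Tendsto (fun α : ℝ => ∫ x in Metric.ball (0 : Plane) 1, ψ ‖x‖ * Real.exp (w α x))
      atTop (𝓝 (∫ x in Metric.ball (0 : Plane) 1, ψ ‖x‖)) := by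
  have hL1 : ∀ᶠ α : ℝ in atTop, 1 ≤ Real.log α := Real.tendsto_log_atTop.eventually_ge_atTop 1
  have hη0 : ∀ᶠ α in atTop, 0 < η α := hη.eventually (lt_mem_nhds one_pos)
  have hρ : ∀ {L : ℝ}, 1 ≤ L → 1 / L ^ 2 ∈ Icc (0 : ℝ) 1 := fun {L} hL =>
    ⟨by positivity, by rw [div_le_one (by positivity)]; exact one_le_pow₀ hL⟩
  constructor
  · intro p hp
    have hb : Tendsto (fun α => (-Real.log (η α)) ^ p) atTop (𝓝 0) := by
      have h1 : Tendsto (fun α => -Real.log (η α)) atTop (𝓝 0) := by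
        have := (hη.log one_ne_zero).neg
        simpa using this
      have := h1.rpow_const (p := p) (Or.inr (by linarith))
      rwa [Real.zero_rpow (by linarith)] at this
    have hlim := ((((tendsto_log_rpow_mul_inv_pow 40 p (by norm_num)).comp
      Real.tendsto_log_atTop).add hb).mul_const (volume.real (Metric.ball (0 : Plane) 1)))
    simp only [add_zero, zero_mul] at hlim
    refine squeeze_zero' ?_ ?_ hlim
    · filter_upwards [hw] with α ⟨u, _, _, hu0, hwu, _⟩
      refine setIntegral_nonneg Metric.isOpen_ball.measurableSet fun x hx => ?_
      rw [hwu x hx]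
      exact Real.rpow_nonneg (hu0 _ ⟨norm_nonneg x, (mem_ball_zero_iff.1 hx).le⟩) p
    · filter_upwards [hw, hL1, hη0] with α ⟨u, _, hanti, hu0, hwu, hA, hηu⟩ hL hη'
      have hρ' := hρ hL
      have huρ : u (1 / Real.log α ^ 2) ≤ -Real.log (η α) := by
        have := Real.log_le_log hη' hηu
        rw [Real.log_exp] at this
        linarith
      have hρ0 := hu0 _ hρ'
      refine integral_unitBall_le hρ'.1 hρ'.2 (Real.rpow_nonneg (hρ0.trans huρ) p) ?_ ?_ ?_
      · intro x hx
        rw [hwu x hx]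
        exact Real.rpow_nonneg (hu0 _ ⟨norm_nonneg x, (mem_ball_zero_iff.1 hx).le⟩) p
      · intro x hx
        have hx' : ‖x‖ ∈ Icc (0 : ℝ) 1 := ⟨norm_nonneg x, (mem_ball_zero_iff.1 hx).le⟩
        rw [hwu x hx]
        exact Real.rpow_le_rpow (hu0 _ hx')
          ((hanti ⟨le_rfl, zero_le_one⟩ hx' hx'.1).trans hA) (by linarith)
      · intro x hx hρx
        have hx' : ‖x‖ ∈ Icc (0 : ℝ) 1 := ⟨norm_nonneg x, (mem_ball_zero_iff.1 hx).le⟩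
        rw [hwu x hx]
        exact Real.rpow_le_rpow (hu0 _ hx') ((hanti hρ' hx' hρx).trans huρ) (by linarith)
  · have hb : Tendsto (fun α => 1 / η α - 1) atTop (𝓝 0) := by
      have := (hη.inv₀ one_ne_zero).sub_const 1
      simpa using this
    -- The radius `L^{-2}` is small enough here: its relative area `L^{-4}` beats the cubic bound on
    -- `e^u`.
    have ha : Tendsto (fun L : ℝ => (40 * L) ^ 3 * (1 / L ^ 2) ^ 2) atTop (𝓝 0) := by
      have h1 : Tendsto (fun L : ℝ => 40 ^ 3 * L⁻¹) atTop (𝓝 0) := by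
        simpa using tendsto_inv_atTop_zero.const_mul ((40 : ℝ) ^ 3)
      refine h1.congr' ?_
      filter_upwards [eventually_gt_atTop 0] with L hL
      field_simp
    have hlim := (((ha.comp Real.tendsto_log_atTop).add hb).mul_const
      (volume.real (Metric.ball (0 : Plane) 1)))
    simp only [add_zero, zero_mul] at hlim
    rw [← tendsto_sub_nhds_zero_iff]
    have hψc : Continuous fun x : Plane => ψ ‖x‖ := hψ.continuous.comp continuous_norm
    have hint : ∀ {g : Plane → ℝ}, Continuous g → IntegrableOn g (Metric.ball (0 : Plane) 1) :=
      fun hg => (hg.continuousOn.integrableOn_compact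
        (isCompact_closedBall (0 : Plane) 1)).mono_set Metric.ball_subset_closedBall
    have heq : ∀ᶠ α in atTop, ∃ u : ℝ → ℝ, Continuous u ∧ AntitoneOn u (Icc 0 1) ∧
        (∀ r ∈ Icc (0 : ℝ) 1, 0 ≤ u r) ∧
        u 0 ≤ 3 * Real.log (40 * Real.log α) ∧ η α ≤ Real.exp (-u (1 / Real.log α ^ 2)) ∧
        (∫ x in Metric.ball (0 : Plane) 1, ψ ‖x‖ * Real.exp (w α x)) -
          ∫ x in Metric.ball (0 : Plane) 1, ψ ‖x‖ =
        ∫ x in Metric.ball (0 : Plane) 1, ψ ‖x‖ * (Real.exp (u ‖x‖) - 1) := by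
      filter_upwards [hw] with α ⟨u, huc, hanti, hu0, hwu, hA, hηu⟩
      refine ⟨u, huc, hanti, hu0, hA, hηu, ?_⟩
      rw [setIntegral_congr_fun (g := fun x => ψ ‖x‖ * Real.exp (u ‖x‖))
        Metric.isOpen_ball.measurableSet fun x hx => by simp only [hwu x hx]]
      have hec : Continuous fun x : Plane => ψ ‖x‖ * Real.exp (u ‖x‖) :=
        hψc.mul (Real.continuous_exp.comp (huc.comp continuous_norm))
      rw [← integral_sub (hint hec) (hint hψc)]
      congr 1; ext x; ring
    refine squeeze_zero' ?_ ?_ hlim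
    · filter_upwards [heq] with α ⟨u, _, _, hu0, _, _, he⟩
      rw [he]
      refine setIntegral_nonneg Metric.isOpen_ball.measurableSet fun x hx => ?_
      have := Real.one_le_exp (hu0 ‖x‖ ⟨norm_nonneg x, (mem_ball_zero_iff.1 hx).le⟩)
      exact mul_nonneg (hψ.nonneg _) (by linarith)
    · filter_upwards [heq, hL1, hη0] with α ⟨u, _, hanti, hu0, hA, hηu, he⟩ hL hη'
      rw [he]
      have hρ' := hρ hL
      have hexpρ : Real.exp (u (1 / Real.log α ^ 2)) ≤ 1 / η α := by
        rw [Real.exp_neg, le_inv_comm₀ hη' (Real.exp_pos _)] at hηu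
        simpa using hηu
      have hexp0 : Real.exp (u 0) ≤ (40 * Real.log α) ^ 3 := by
        have h1 := Real.exp_le_exp.2 hA
        have h2 : 3 * Real.log (40 * Real.log α) = Real.log ((40 * Real.log α) ^ 3) := by
          rw [Real.log_pow]; norm_num
        rwa [h2, Real.exp_log (by positivity)] at h1
      have hfac : ∀ x ∈ Metric.ball (0 : Plane) 1,
          0 ≤ ψ ‖x‖ * (Real.exp (u ‖x‖) - 1) ∧
          ψ ‖x‖ * (Real.exp (u ‖x‖) - 1) ≤ Real.exp (u ‖x‖) - 1 := by
        intro x hx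
        have := Real.one_le_exp (hu0 ‖x‖ ⟨norm_nonneg x, (mem_ball_zero_iff.1 hx).le⟩)
        exact ⟨mul_nonneg (hψ.nonneg _) (by linarith),
          mul_le_of_le_one_left (by linarith) (hψ.le_one (norm_nonneg x))⟩
      refine integral_unitBall_le hρ'.1 hρ'.2 ?_ (fun x hx => (hfac x hx).1) ?_ ?_
      · have := Real.one_le_exp (hu0 _ hρ')
        linarith
      · intro x hx
        have hx' : ‖x‖ ∈ Icc (0 : ℝ) 1 := ⟨norm_nonneg x, (mem_ball_zero_iff.1 hx).le⟩
        have h1 := Real.exp_le_exp.2 (hanti ⟨le_rfl, zero_le_one⟩ hx' hx'.1)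
        linarith [(hfac x hx).2]
      · intro x hx hρx
        have hx' : ‖x‖ ∈ Icc (0 : ℝ) 1 := ⟨norm_nonneg x, (mem_ball_zero_iff.1 hx).le⟩
        have h1 := Real.exp_le_exp.2 (hanti hρ' hx' hρx)
        linarith [(hfac x hx).2]

end Limits

/-! ### Extension of the profiles to the line, and conclusion. -/

/-- The equation evaluates the profiles only at `‖x‖ < 1`, so they can be replaced by globally
continuous and monotone extensions. -/
theorem isClassicalSolution_congr {φ φ' ψ ψ' : ℝ → ℝ} (hφ : EqOn φ φ' (Icc 0 1))
    (hψ : EqOn ψ ψ' (Icc 0 1)) (f : ℝ → ℝ) :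
    IsClassicalSolution φ ψ f = IsClassicalSolution φ' ψ' f := by
  have key : ∀ {φ φ' ψ ψ' : ℝ → ℝ}, EqOn φ φ' (Icc 0 1) → EqOn ψ ψ' (Icc 0 1) →
      ∀ {α lam u}, IsClassicalSolution φ ψ f α lam u → IsClassicalSolution φ' ψ' f α lam u :=
    fun hφ hψ _ _ _ h => ⟨h.contDiffOn, h.continuousOn, fun x hx => by
      have hx' : ‖x‖ ∈ Icc (0 : ℝ) 1 := ⟨norm_nonneg x, (mem_ball_zero_iff.1 hx).le⟩
      rw [← hφ hx', ← hψ hx']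
      exact h.equation x hx, h.pos, h.boundary⟩
  funext α lam u
  exact propext ⟨key hφ hψ, key hφ.symm hψ.symm⟩

theorem criticalValue_congr {φ φ' ψ ψ' : ℝ → ℝ} (hφ : EqOn φ φ' (Icc 0 1))
    (hψ : EqOn ψ ψ' (Icc 0 1)) (f : ℝ → ℝ) :
    criticalValue φ ψ f = criticalValue φ' ψ' f := by
  funext α
  rw [criticalValue, criticalValue, isClassicalSolution_congr hφ hψ]

theorem isExtremalSolution_congr {φ φ' ψ ψ' : ℝ → ℝ} (hφ : EqOn φ φ' (Icc 0 1))
    (hψ : EqOn ψ ψ' (Icc 0 1)) (f : ℝ → ℝ) :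
    IsExtremalSolution φ ψ f = IsExtremalSolution φ' ψ' f := by
  funext α u
  simp only [IsExtremalSolution, IsMinimalSolution, criticalValue_congr hφ hψ,
    isClassicalSolution_congr hφ hψ]

/-- The extension of a profile on `[0,1]` by constants. -/
def clampProfile (φ : ℝ → ℝ) (r : ℝ) : ℝ := φ (max 0 (min r 1))

theorem clampProfile_eqOn (φ : ℝ → ℝ) : EqOn φ (clampProfile φ) (Icc 0 1) := fun r hr => by
  rw [clampProfile, min_eq_left hr.2, max_eq_right hr.1]

theorem linearlyBoundedProfile_clampProfile {φ : ℝ → ℝ} {L : NNReal} {ℓ : ℝ}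
    (hlip : LipschitzOnWith L φ (Icc 0 1)) (hanti : AntitoneOn φ (Icc 0 1))
    (hnn : ∀ r ∈ Icc (0 : ℝ) 1, 0 ≤ φ r) (h0 : φ 0 = 1) (hℓ : 1 ≤ ℓ) (hL : (L : ℝ) ≤ ℓ) :
    LinearlyBoundedProfile ℓ (clampProfile φ) := by
  have hmem : ∀ r : ℝ, max 0 (min r 1) ∈ Icc (0 : ℝ) 1 := fun r =>
    ⟨le_max_left _ _, max_le zero_le_one (min_le_right _ _)⟩
  refine ⟨hℓ, ?_, ?_, fun r => hnn _ (hmem r), by simp [clampProfile, h0], fun r hr => ?_⟩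
  · exact hlip.continuousOn.comp_continuous (by fun_prop) hmem
  · exact fun r s hrs => hanti (hmem r) (hmem s)
      (max_le_max le_rfl (min_le_min hrs le_rfl))
  · have h1 := hlip.dist_le_mul _ (hmem r) 0 ⟨le_rfl, zero_le_one⟩
    rw [Real.dist_eq, Real.dist_eq, h0, sub_zero, abs_of_nonneg (hmem r).1] at h1
    have h2 : max 0 (min r 1) ≤ r := max_le hr (min_le_left _ _)
    have h3 := mul_le_mul hL h2 (hmem r).1 (by linarith : 0 ≤ ℓ)
    have h4 := neg_abs_le (φ (max 0 (min r 1)) - 1)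
    rw [clampProfile]
    linarith

theorem AdmissibleProfiles.le_profileRatioMax {φ ψ : ℝ → ℝ} (h : AdmissibleProfiles φ ψ) {s t : ℝ}
    (hs : s ∈ Ioo (0 : ℝ) 1) (ht : t ∈ Icc 0 s) : ψ t / φ t ≤ profileRatioMax φ ψ s := by
  obtain ⟨_, hφl⟩ := h.lipschitz_phi
  obtain ⟨_, hψl⟩ := h.lipschitz_psi
  have hsub : Icc 0 s ⊆ Icc (0 : ℝ) 1 := Icc_subset_Icc_right hs.2.le
  have hc : ContinuousOn (fun r => ψ r / φ r) (Icc 0 s) :=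
    (hψl.continuousOn.mono hsub).div (hφl.continuousOn.mono hsub) fun r hr =>
      (h.pos_phi r ⟨hr.1, hr.2.trans_lt hs.2⟩).ne'
  exact le_csSup (isCompact_Icc.bddAbove_image hc) (mem_image_of_mem _ ht)

theorem lemma5p3 (φ ψ : ℝ → ℝ) (hφψ : AdmissibleProfiles φ ψ) :
    -- asymptotics of the critical value
    (∃ ε : ℝ → ℝ, ε =O[atTop] (fun α : ℝ => 1 / √(Real.log α)) ∧
      ∀ᶠ α : ℝ in atTop,
        criticalValue φ ψ Real.exp α = 2 * α / Real.log α * (1 + ε α)) ∧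
    -- for large `α` the extremal solution exists and is a classical solution at `λ*(α)`
    (∀ᶠ α : ℝ in atTop, ∃ u : Plane → ℝ, IsExtremalSolution φ ψ Real.exp α u ∧
      IsClassicalSolution φ ψ Real.exp α (criticalValue φ ψ Real.exp α) u) ∧
    -- asymptotics of the extremal solution
    (∀ uStar : ℝ → Plane → ℝ,
      (∀ᶠ α : ℝ in atTop, IsExtremalSolution φ ψ Real.exp α (uStar α)) →
        (fun α : ℝ => uStar α 0) =O[atTop] (fun α : ℝ => Real.log (Real.log α)) ∧
        (∀ p : ℝ, 1 ≤ p →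
          Tendsto (fun α : ℝ => ∫ x in Metric.ball (0 : Plane) 1, (uStar α x) ^ p)
            atTop (𝓝 0)) ∧
        Tendsto (fun α : ℝ => ∫ x in Metric.ball (0 : Plane) 1, ψ ‖x‖ * Real.exp (uStar α x))
          atTop (𝓝 (∫ x in Metric.ball (0 : Plane) 1, ψ ‖x‖))) := by
  obtain ⟨Lφ, hLφ⟩ := hφψ.lipschitz_phi
  obtain ⟨Lψ, hLψ⟩ := hφψ.lipschitz_psi
  set ℓ : ℝ := max 1 (max (Lφ : ℝ) Lψ) with hℓ
  have hφ : LinearlyBoundedProfile ℓ (clampProfile φ) :=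
    linearlyBoundedProfile_clampProfile hLφ hφψ.antitone_phi hφψ.nonneg_phi hφψ.phi_zero
      (le_max_left _ _) ((le_max_left _ _).trans (le_max_right _ _))
  have hψ : LinearlyBoundedProfile ℓ (clampProfile ψ) :=
    linearlyBoundedProfile_clampProfile hLψ hφψ.antitone_psi hφψ.nonneg_psi hφψ.psi_zero
      (le_max_left _ _) ((le_max_right _ _).trans (le_max_right _ _))
  have hφeq := clampProfile_eqOn φ
  have hψeq := clampProfile_eqOn ψ
  have hM0 : ∀ s ∈ Ioo (0 : ℝ) 1, 0 ≤ profileRatioMax φ ψ s := fun s hs => by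
    have := hφψ.le_profileRatioMax hs (t := 0) ⟨le_rfl, hs.1.le⟩
    rw [hφψ.phi_zero, hφψ.psi_zero, div_one] at this
    linarith
  have hM : ∀ s ∈ Ioo (0 : ℝ) 1, ∀ t ∈ Icc 0 s,
      clampProfile ψ t ≤ profileRatioMax φ ψ s * clampProfile φ t := fun s hs t ht => by
    have ht1 : t < 1 := ht.2.trans_lt hs.2
    have := hφψ.le_profileRatioMax hs ht
    rw [← hφeq ⟨ht.1, ht1.le⟩, ← hψeq ⟨ht.1, ht1.le⟩]
    rwa [div_le_iff₀ (hφψ.pos_phi t ⟨ht.1, ht1⟩)] at this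
  obtain ⟨B, hB, hmain⟩ := eventually_exists_extremal hφ hψ hM0 hM hφψ.integrable_ratio
  rw [criticalValue_congr hφeq hψeq, isClassicalSolution_congr hφeq hψeq,
    isExtremalSolution_congr hφeq hψeq]
  refine ⟨⟨fun α => criticalValue (clampProfile φ) (clampProfile ψ) Real.exp α /
    (2 * α / Real.log α) - 1, ?_, ?_⟩, ?_, fun uStar hu => ?_⟩
  · refine Asymptotics.IsBigO.of_bound B ?_
    filter_upwards [hmain] with α hα
    rw [Real.norm_eq_abs, Real.norm_eq_abs, abs_of_nonneg (by positivity : 0 ≤ 1 / √(Real.log α))]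
    exact hα.2.1
  · filter_upwards [eventually_gt_atTop 1] with α hα
    have h1 : 2 * α / Real.log α ≠ 0 :=
      (div_pos (by linarith) (Real.log_pos hα)).ne'
    rw [add_sub_cancel, mul_div_cancel₀ _ h1]
  · filter_upwards [hmain] with α ⟨hpos, _, u, hu, hext, _⟩
    exact ⟨_, hext, hu.isClassicalSolution hφ.continuous hψ hpos⟩
  · have hrad : ∀ᶠ α : ℝ in atTop, ∃ u : ℝ → ℝ, Continuous u ∧ AntitoneOn u (Icc 0 1) ∧
        (∀ r ∈ Icc (0 : ℝ) 1, 0 ≤ u r) ∧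
        (∀ x ∈ Metric.ball (0 : Plane) 1, uStar α x = u ‖x‖) ∧
        u 0 ≤ 3 * Real.log (40 * Real.log α) ∧ (1 - B * (1 / √(Real.log α))) *
          (1 - (4 * Real.log (Real.log α) + 1 + 2 * ℓ) / Real.log α) ≤
            Real.exp (-u (1 / Real.log α ^ 2)) := by
      filter_upwards [hmain, hu] with α ⟨hpos, _, u, hurad, hext, hA, hη⟩ huα
      exact ⟨u, hurad.continuous hφ.continuous, hurad.antitoneOn hφ.continuous hψ.nonneg hpos.le,
        fun r hr => hurad.nonneg hφ.continuous hψ.nonneg hpos.le hr,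
        fun x hx => huα.eqOn hext (Metric.ball_subset_closedBall hx), hA, hη⟩
    obtain ⟨hp, hexp⟩ := tendsto_integrals_of_bounds hψ (tendsto_layer_factor ℓ B) hrad
    have hψint : ∀ g : Plane → ℝ, ∫ x in Metric.ball (0 : Plane) 1, ψ ‖x‖ * g x =
        ∫ x in Metric.ball (0 : Plane) 1, clampProfile ψ ‖x‖ * g x := fun g =>
      setIntegral_congr_fun Metric.isOpen_ball.measurableSet fun x hx => by
        simp only [hψeq ⟨norm_nonneg x, (mem_ball_zero_iff.1 hx).le⟩]
    refine ⟨?_, hp, ?_⟩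
    -- Once `log α ≥ 40`, `3 log (40 log α)` is at most `6 log log α`.
    · refine Asymptotics.IsBigO.of_bound 6 ?_
      filter_upwards [hrad, Real.tendsto_log_atTop.eventually_ge_atTop 40]
        with α ⟨u, _, _, hu0, huu, hA, _⟩ hL
      have h0 := huu 0 (Metric.mem_ball_self one_pos)
      rw [norm_zero] at h0
      have h1 : Real.log 40 ≤ Real.log (Real.log α) := Real.log_le_log (by norm_num) hL
      have h2 : 0 < Real.log 40 := Real.log_pos (by norm_num)
      rw [Real.log_mul (by norm_num) (by linarith)] at hA
      rw [h0, Real.norm_eq_abs, Real.norm_eq_abs, abs_of_nonneg (hu0 0 ⟨le_rfl, zero_le_one⟩),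
        abs_of_nonneg (by linarith)]
      linarith
    · have h1 := hψint fun _ => 1
      simp only [mul_one] at h1
      rw [h1]
      exact hexp.congr fun α => (hψint fun x => Real.exp (uStar α x)).symm
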